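/- **Setting.** Let $d,m,q\ge 1$, $n=mq$, $N=n^d$, $Q=q^d$, and let $\Lambda_N=(\tfrac1n\mathbb Z)^d\cap[0,1)^d$ be the periodic lattice on the unit torus, $|\cdot|$ the Euclidean distance on the torus. Divide the torus into the $M=m^d$ cubes $C_k$ of side $1/m$ (each containing $Q$ sites), $k$ ranging over the coarse lattice, ordered lexicographically. Let $L>0$, $\beta>0$, and let $V:[0,\infty)\to\mathbb R$ be $C^1$ with $V(r)=0$ for $r\ge 1$; put $J(x-y)=L^{-d}\,V\!\left(\tfrac nL|x-y|\right)$. Let $h:\Lambda_N\to\mathbb R$ be constant on each cell $C_k$ (for example $h=0$ or $h$ constant). For $\sigma\in\{\pm1\}^{\Lambda_N}$ let $$H_N(\sigma)=-\tfrac12\sum_x\sum_{y\ne x}J(x-y)\sigma(x)\sigma(y)+\sum_x h(x)\sigma(x).$$ Let $P_N$ be the product over the sites of a probability measure $\rho$ on $\{\pm1\}$ charging both points, let $\mu_{N,\beta}(d\sigma)=Z_N^{-1}e^{-\beta H_N(\sigma)}P_N(d\sigma)$, and let $\mathbf F(\sigma)=\eta$ with $\eta(k)=\sum_{x\in C_k}\sigma(x)$.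 Put $$\bar H^{(0)}_M(\eta)=\mathbb E_{P_N}[H_N\mid \mathbf F(\sigma)=\eta],\qquad \bar\mu^{(0)}_{M,\beta}(d\eta)=\frac{1}{\bar Z^{(0)}_M}\,e^{-\beta\bar H^{(0)}_M(\eta)}\,(P_N\circ\mathbf F^{-1})(d\eta),$$ and let the small parameter be $\epsilon=\beta\,\frac qL\,\sup_{r\ge0}|V'(r)|$. **Corrections.** Let $\bar J(k,l)$ be the average of $J(x-y)$ over the pairs $x\in C_k$, $y\in C_l$ with $x\ne y$, and put $E(x,y)=J(x-y)-\bar J(k,l)$ for $x\in C_k$, $y\in C_l$. Let $$j^1_{kl}=\sum_{x\in C_k,\,y\in C_l}E(x,y)^2,\qquad j^2_{kl}=\sum_{x\in C_k;\ y,y'\in C_l}E(x,y)E(x,y'),\qquad j^2_{k_1k_2k_3}=\sum_{x\in C_{k_1},\,y\in C_{k_2},\,z\in C_{k_3}}E(x,y)E(y,z),$$ where each occurring pair ($E(x,y)$, $E(x,y')$, $E(y,z)$) is restricted to distinct sites. For $i=1,\dots,4$ let $E_i(\alpha)$ be the mean of the product of $i$ spins at distinct sites of a cell, uniformly over the configurations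 of $Q$ spins with exactly $\alpha$ plus spins: with $\omega=Q-\alpha$, $$E_i(\alpha)=\frac{\sum_{j=0}^{i}(-1)^j\binom ij\,(\alpha)_{i-j}\,(\omega)_j}{(Q)_i},\qquad (a)_r=a(a-1)\cdots(a-r+1)$$ (read as $0$ if $(Q)_i=0$). Write $E_i^k=E_i(\alpha(k))$ with $\alpha(k)=(\eta(k)+Q)/2$. Define $$-\bar H^{(1)}_M(\eta)=\tfrac\beta8\sum_k\Big(4j^2_{kk}\big[-E_4^k+E_2^k\big]+2j^1_{kk}\big[E_4^k+1-2E_2^k\big]\Big)$$ $$\qquad+\tfrac\beta2\sum_{k<l}\Big(j^1_{kl}\big[E_2^kE_2^l-E_2^l-E_2^k+1\big]+j^2_{kl}\big[-2E_2^kE_2^l+E_2^k+E_2^l\big]\Big)$$ $$\qquad+\tfrac\beta2\sum_{k}\sum_{l\ne k}j^2_{kkl}\big[-E_3^kE_1^l+2E_1^kE_1^l-E_3^lE_1^k\big],$$ $$-\bar H^{(2)}_M(\eta)=\beta\sum_{k_1<k_2<k_3}\big(T_{k_1k_2k_3}+T_{k_2k_3k_1}+T_{k_3k_1k_2}\big),\qquad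 T_{abc}=j^2_{abc}\big(-E_1^aE_2^bE_1^c+E_1^aE_1^c\big),$$ and the residuum, a function of the coarse variables only, $$R(\eta)=\beta\big(\bar H^{(1)}_M(\eta)+\bar H^{(2)}_M(\eta)\big).$$ **Theorem (a posteriori error).** For every $d\ge1$ there are constants $\delta_0>0$ and $K>0$, depending only on $d$, such that for all $m,q,L,\beta,V,h,\rho$ as above with $Q\epsilon<\delta_0$, the relative entropy $\mathcal R(\bar\mu^{(0)}_{M,\beta}\,|\,\mu_{N,\beta}\circ\mathbf F^{-1})$ is finite and $$\left|\frac1N\,\mathcal R\big(\bar\mu^{(0)}_{M,\beta}\,\big|\,\mu_{N,\beta}\circ\mathbf F^{-1}\big)-\frac1N\Big(\mathbb E_{\bar\mu^{(0)}_{M,\beta}}[R(\eta)]+\log\mathbb E_{\bar\mu^{(0)}_{M,\beta}}\big[e^{-R(\eta)}\big]\Big)\right|\le K\,\epsilon^3 .$$ -/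

import Mathlib

open MeasureTheory ProbabilityTheory

namespace CoarseGrain

noncomputable section

/-- Sites of the microscopic lattice `((1/n)ℤ)^d ∩ [0,1)^d` with `n = m * q`; the index `x`
stands for the point `x / n` of the torus. -/
abbrev Site (d m q : ℕ) : Type := Fin d → Fin (m * q)

/-- Cells of the coarse lattice: `k` stands for the cube `∏ i, [k i / m, (k i + 1) / m)`. -/
abbrev Cell (d m : ℕ) : Type := Fin d → Fin m

/-- Microscopic spin configurations: `true` is the spin `+1`, `false` is the spin `-1`. -/
abbrev Config (d m q : ℕ) : Type := Site d m q → Bool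

/-- Coarse configurations `η`. They are taken integer valued; all the measures below on this space
are carried by the image of the block-spin map. -/
abbrev CoarseConfig (d m : ℕ) : Type := Cell d m → ℤ

/-- The value `±1` of a spin. -/
def spin (b : Bool) : ℤ := if b then 1 else -1

/-- The cell that contains a site. -/
def cellOf {d m q : ℕ} (x : Site d m q) : Cell d m := fun i => (x i).divNat

/-- The sites of the cell `C_k`. -/
def cellSites {d m : ℕ} (q : ℕ) (k : Cell d m) : Finset (Site d m q) :=
  Finset.univ.filter fun x => cellOf x = k

/-- The Euclidean distance `|x - y|` on the torus `(ℝ/ℤ)^d` between two sites. -/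
def torusDist {d m q : ℕ} (x y : Site d m q) : ℝ :=
  Real.sqrt (∑ i, ‖(((((x i : ℕ) : ℝ) - ((y i : ℕ) : ℝ)) / ((m * q : ℕ) : ℝ) : ℝ) :
    UnitAddCircle)‖ ^ 2)

/-- The pair potential `J(x - y) = L^{-d} V((n / L) |x - y|)`. -/
def pairJ {d m q : ℕ} (L : ℝ) (V : ℝ → ℝ) (x y : Site d m q) : ℝ :=
  1 / L ^ d * V (((m * q : ℕ) : ℝ) / L * torusDist x y)

/-- The supremum norm of the derivative of `V` on `[0, ∞)`. -/
def supDeriv (V : ℝ → ℝ) : ℝ :=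
  ⨆ r : Set.Ici (0 : ℝ), |derivWithin V (Set.Ici 0) r|

/-- The small parameter `ε = β (q / L) ‖∇V‖_∞`. -/
def smallParam (q : ℕ) (L β : ℝ) (V : ℝ → ℝ) : ℝ := β * ((q : ℝ) / L) * supDeriv V

/-- The microscopic Hamiltonian
`H_N(σ) = -(1/2) ∑_x ∑_{y ≠ x} J(x-y) σ(x) σ(y) + ∑_x h(x) σ(x)`. -/
def microH {d m q : ℕ} (L : ℝ) (V : ℝ → ℝ) (h : Site d m q → ℝ) (σ : Config d m q) : ℝ :=
  -(1 / 2) * ∑ x, ∑ y ∈ Finset.univ.filter (fun y => y ≠ x),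
      pairJ L V x y * (spin (σ x) : ℝ) * (spin (σ y) : ℝ)
    + ∑ x, h x * (spin (σ x) : ℝ)

/-- The prior `P_N`: the product over the sites of a law `ρ` of a single spin. -/
def prior (d m q : ℕ) (ρ : Measure Bool) : Measure (Config d m q) := Measure.pi fun _ => ρ

/-- The microscopic Gibbs measure `μ_{N,β}(dσ) = Z_N⁻¹ e^{-β H_N(σ)} P_N(dσ)`. -/
def microGibbs {d m q : ℕ} (ρ : Measure Bool) (L β : ℝ) (V : ℝ → ℝ) (h : Site d m q → ℝ) :
    Measure (Config d m q) :=
  (prior d m q ρ).tilted fun σ => -β * microH L V h σ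

/-- The block-spin map `F(σ)(k) = ∑_{x ∈ C_k} σ(x)`. -/
def blockSpin {d m q : ℕ} (σ : Config d m q) : CoarseConfig d m :=
  fun k => ∑ x ∈ cellSites q k, spin (σ x)

/-- The first approximation `H̄⁽⁰⁾(η) = E[H_N | η]`: the mean of `H_N` under the prior
conditioned on `F(σ) = η`. -/
def coarseH0 {d m q : ℕ} (ρ : Measure Bool) (L : ℝ) (V : ℝ → ℝ) (h : Site d m q → ℝ)
    (η : CoarseConfig d m) : ℝ :=
  ∫ σ, microH L V h σ ∂(ProbabilityTheory.cond (prior d m q ρ) (blockSpin ⁻¹' {η}))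

/-- The first coarse Gibbs measure `μ̄⁽⁰⁾(dη) = (Z̄⁽⁰⁾)⁻¹ e^{-β H̄⁽⁰⁾(η)} P̄(dη)`, where
`P̄ = P_N ∘ F⁻¹`. -/
def coarseGibbs0 {d m q : ℕ} (ρ : Measure Bool) (L β : ℝ) (V : ℝ → ℝ) (h : Site d m q → ℝ) :
    Measure (CoarseConfig d m) :=
  ((prior d m q ρ).map blockSpin).tilted fun η => -β * coarseH0 ρ L V h η

/-- The averaged potential `J̄(k,l)`: the mean of `J(x-y)` over the pairs `x ∈ C_k`, `y ∈ C_l`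
with `x ≠ y`; there are `Q²` of them if `k ≠ l` and `Q (Q - 1)` if `k = l`, `Q = q ^ d`. -/
def avgJ {d m : ℕ} (q : ℕ) (L : ℝ) (V : ℝ → ℝ) (k l : Cell d m) : ℝ :=
  (∑ x ∈ cellSites q k, ∑ y ∈ (cellSites q l).filter (fun y => y ≠ x), pairJ L V x y) /
    (if k = l then (q : ℝ) ^ d * ((q : ℝ) ^ d - 1) else ((q : ℝ) ^ d) ^ 2)

/-- `J(x-y) - J̄(k,l)` for `x ∈ C_k`, `y ∈ C_l`. -/
def errJ {d m q : ℕ} (L : ℝ) (V : ℝ → ℝ) (x y : Site d m q) : ℝ :=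
  pairJ L V x y - avgJ q L V (cellOf x) (cellOf y)

/-- `j¹_{kl} = ∑_{x ∈ C_k, y ∈ C_l} (J(x-y) - J̄(k,l))²`, with `y ≠ x` (automatic if `k ≠ l`). -/
def j1 {d m : ℕ} (q : ℕ) (L : ℝ) (V : ℝ → ℝ) (k l : Cell d m) : ℝ :=
  ∑ x ∈ cellSites q k, ∑ y ∈ (cellSites q l).filter (fun y => y ≠ x), errJ L V x y ^ 2

/-- `j²_{kl} = ∑_{x ∈ C_k, y, y' ∈ C_l} (J(x-y) - J̄(k,l)) (J(x-y') - J̄(k,l))`,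
with `y, y' ≠ x` (automatic if `k ≠ l`). -/
def j2 {d m : ℕ} (q : ℕ) (L : ℝ) (V : ℝ → ℝ) (k l : Cell d m) : ℝ :=
  ∑ x ∈ cellSites q k, ∑ y ∈ (cellSites q l).filter (fun y => y ≠ x),
    ∑ y' ∈ (cellSites q l).filter (fun y' => y' ≠ x), errJ L V x y * errJ L V x y'

/-- `j²_{k₁k₂k₃} = ∑_{x ∈ C_{k₁}, y ∈ C_{k₂}, z ∈ C_{k₃}} (J(x-y) - J̄(k₁,k₂)) (J(y-z) - J̄(k₂,k₃))`,
with `x ≠ y` and `z ≠ y` (automatic for different cells). -/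
def j3 {d m : ℕ} (q : ℕ) (L : ℝ) (V : ℝ → ℝ) (k₁ k₂ k₃ : Cell d m) : ℝ :=
  ∑ y ∈ cellSites q k₂, ∑ x ∈ (cellSites q k₁).filter (fun x => x ≠ y),
    ∑ z ∈ (cellSites q k₃).filter (fun z => z ≠ y), errJ L V x y * errJ L V y z

/-- `E₁(α)`, the mean of one spin in a cell of `Q` sites with `α` plus spins. -/
def E1 (Q α : ℝ) : ℝ := (2 * α - Q) / Q

/-- `E₂(α)`, the mean of a product of two spins at different sites of such a cell. (If there
are fewer sites than spins the quotient is `0`; in the same way for `E₃`, `E₄`. The corrections below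
do not depend on that value.) -/
def E2 (Q α : ℝ) : ℝ :=
  let ω := Q - α
  (α * (α - 1) - 2 * α * ω + ω * (ω - 1)) / (Q * (Q - 1))

/-- `E₃(α)`, the mean of a product of three spins at different sites of such a cell. -/
def E3 (Q α : ℝ) : ℝ :=
  let ω := Q - α
  (α * (α - 1) * (α - 2) - 3 * α * (α - 1) * ω + 3 * α * (ω - 1) * ω
      - (ω - 2) * (ω - 1) * ω) /
    (Q * (Q - 1) * (Q - 2))

/-- `E₄(α)`, the mean of a product of four spins at different sites of such a cell. -/
def E4 (Q α : ℝ) : ℝ :=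
  let ω := Q - α
  (α * (α - 1) * (α - 2) * (α - 3) - 4 * α * (α - 1) * (α - 2) * ω
      + 6 * α * (α - 1) * (ω - 1) * ω - 4 * α * (ω - 2) * (ω - 1) * ω
      + ω * (ω - 1) * (ω - 2) * (ω - 3)) /
    (Q * (Q - 1) * (Q - 2) * (Q - 3))

/-- `α(k) = (η(k) + Q) / 2`, the number of plus spins in the cell `C_k`. -/
def plusCount {d m : ℕ} (q : ℕ) (η : CoarseConfig d m) (k : Cell d m) : ℝ :=
  ((η k : ℝ) + (q : ℝ) ^ d) / 2

open Classical in
/-- The correction `H̄⁽¹⁾(η)`; cells are ordered lexicographically. -/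
def coarseH1 {d m : ℕ} (q : ℕ) (L β : ℝ) (V : ℝ → ℝ) (η : CoarseConfig d m) : ℝ :=
  let Q : ℝ := (q : ℝ) ^ d
  let e₁ : Cell d m → ℝ := fun k => E1 Q (plusCount q η k)
  let e₂ : Cell d m → ℝ := fun k => E2 Q (plusCount q η k)
  let e₃ : Cell d m → ℝ := fun k => E3 Q (plusCount q η k)
  let e₄ : Cell d m → ℝ := fun k => E4 Q (plusCount q η k);
  -(β / 8 * ∑ k : Cell d m,
        (4 * j2 q L V k k * (-e₄ k + e₂ k) + 2 * j1 q L V k k * (e₄ k + 1 - 2 * e₂ k))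
    + β / 2 * ∑ k : Cell d m, ∑ l ∈ Finset.univ.filter (fun l : Cell d m => toLex k < toLex l),
        (j1 q L V k l * (e₂ k * e₂ l - e₂ l - e₂ k + 1)
          + j2 q L V k l * (-2 * e₂ k * e₂ l + e₂ k + e₂ l))
    + β / 2 * ∑ k : Cell d m, ∑ l ∈ Finset.univ.filter (fun l : Cell d m => l ≠ k),
        j3 q L V k k l * (-e₃ k * e₁ l + 2 * e₁ k * e₁ l - e₃ l * e₁ k))

open Classical in
/-- The correction `H̄⁽²⁾(η)`; cells are ordered lexicographically. The overall minus sign is the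
one of `H̄(η) - H̄⁽⁰⁾(η) = -β⁻¹ log E[exp (-β (H_N - H̄⁽⁰⁾(η))) | η]`. -/
def coarseH2 {d m : ℕ} (q : ℕ) (L β : ℝ) (V : ℝ → ℝ) (η : CoarseConfig d m) : ℝ :=
  let Q : ℝ := (q : ℝ) ^ d
  let e₁ : Cell d m → ℝ := fun k => E1 Q (plusCount q η k)
  let e₂ : Cell d m → ℝ := fun k => E2 Q (plusCount q η k)
  let T : Cell d m → Cell d m → Cell d m → ℝ := fun a b c =>
    j3 q L V a b c * (-e₁ a * e₂ b * e₁ c + e₁ a * e₁ c);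
  -(β * ∑ k₁ : Cell d m,
      ∑ k₂ ∈ Finset.univ.filter (fun k₂ : Cell d m => toLex k₁ < toLex k₂),
        ∑ k₃ ∈ Finset.univ.filter (fun k₃ : Cell d m => toLex k₂ < toLex k₃),
          (T k₁ k₂ k₃ + T k₂ k₃ k₁ + T k₃ k₁ k₂))

/-- The residuum `R(η) = β (H̄⁽¹⁾(η) + H̄⁽²⁾(η))`. -/
def residuum {d m : ℕ} (q : ℕ) (L β : ℝ) (V : ℝ → ℝ) (η : CoarseConfig d m) : ℝ :=
  β * (coarseH1 q L β V η + coarseH2 q L β V η)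

end

end CoarseGrain

/-!
Both coarse measures are tilts of the image `P̄` of the prior under the block-spin map, so the
exact coarse measure is the tilt of `coarseGibbs0` by the function `η ↦ log E[exp W | η]`. Here
`W`, the `pairEnergy` of `coupling`, is the fluctuating part of `-β H`: by the definition of the
averaged potential the remaining part of `-β H` is a function of the block spins
(`logFiberMean_add_coarseH0`, `map_microGibbs`). The relative entropy of a measure with respect
to its tilt by `f` is explicit (`klDiv_tilted_right`) and Lipschitz in `f` for the supremum norm
(`abs_tilted_entropy_sub_le`). It therefore suffices to show, with an error of order `ε ^ 3` per
site, that `log E[exp W | η]` is half the conditional second moment of `W`, and that the latter is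
exactly minus the residuum.

Conditioning the prior on the block spins gives the uniform distribution on the orbit of
a configuration under the permutations of the sites inside the cells (`sum_fiber_eq_orbitMean`), and
only this exchangeability is used; no cluster expansion is needed. The couplings
`a x y = β (J(x-y) - J̄)` sum to zero over every pair of cells and satisfy `∑ y, |a x y| ≤ γ` with
`γ = C ε` and `C` depending only on the dimension (`sum_abs_coupling_le`: the potential is Lipschitz
if its range exceeds the cell size, and its total strength is bounded otherwise).

For the first claim, consider the orbit mean tilted by `exp (t W)`. A transposition inside a cell
preserves the untilted mean and changes `W` by at most `4 γ`, whatever the size of the system. Hence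
an observable depending on few sites has the same tilted and untilted mean up to `O(γ)`
(`abs_tiltMean_sub_orbitMean_le`). Expanding the change of variables by a transposition to second
order shows that the tilted two-point function, after subtraction of its linear response, varies
only by `O(γ ^ 2)` inside a pair of cells (`abs_twoPoint_sub_le`). As the couplings sum to zero over
pairs of cells, this variation is all that contributes to the tilted mean of `W`, which is thus
`t E[W ^ 2 | η] + O(N γ ^ 3)`; it is the derivative of `log E[exp (t W) | η]`, and integration over
`t` gives `abs_log_orbitMean_exp_sub_le`.

For the second claim, the moments `E1`, ..., `E4` follow from the fact that block spins are constant
on the orbit (`sum_rule`). Two pairs of cells contribute to the second moment only if they share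
a cell (`sum_meeting_edges`), and the point reflection that exchanges two cells gives the symmetry
of the coefficients `j2` and `j3` (`sum_rowSum_reflection`).
-/

namespace CoarseGrain

noncomputable section

/-! ### Means over the permutations inside cells -/

section Orbit

variable {ι κ α : Type*}

/-- The permutations of the sites that preserve the cell map `c`. -/
def cellPerms (c : ι → κ) : Subgroup (Equiv.Perm ι) where
  carrier := {π | ∀ x, c (π x) = c x}
  mul_mem' := fun {π ρ} hπ hρ x => by
    rw [Equiv.Perm.mul_apply, hπ, hρ]
  one_mem' := fun _ => rfl
  inv_mem' := fun {π} hπ x => by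
    simpa using (hπ (π⁻¹ x)).symm

theorem swap_mem_cellPerms [DecidableEq ι] {c : ι → κ} {x y : ι} (h : c x = c y) :
    Equiv.swap x y ∈ cellPerms c := by
  intro z
  rcases eq_or_ne z x with rfl | hx
  · rw [Equiv.swap_apply_left, h]
  rcases eq_or_ne z y with rfl | hy
  · rw [Equiv.swap_apply_right, h]
  rw [Equiv.swap_apply_of_ne_of_ne hx hy]

/-- On any finite set `A` of sites a cell-preserving permutation agrees with a product of at most
`#A` transpositions inside cells. If one transposition changes `W` by at most `b`, it can
therefore be replaced by a permutation that changes `W` by at most `#A * b`. -/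
theorem exists_perm_agree [DecidableEq ι] {c : ι → κ} {W : (ι → α) → ℝ} {P : (ι → α) → Prop} {b : ℝ}
    (hP : ∀ u, ∀ π ∈ cellPerms c, P u → P (u ∘ ⇑π))
    (hW : ∀ u x y, P u → c x = c y → |W (u ∘ ⇑(Equiv.swap x y)) - W u| ≤ b)
    {π : Equiv.Perm ι} (hπ : π ∈ cellPerms c) (A : Finset ι) :
    ∃ ρ ∈ cellPerms c, (∀ x ∈ A, ρ x = π x) ∧ ∀ u, P u → |W (u ∘ ⇑ρ) - W u| ≤ A.card * b := by
  induction A using Finset.induction_on with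
  | empty => exact ⟨1, one_mem _, by simp, fun u _ => by simp⟩
  | insert a A ha ih =>
    obtain ⟨ρ, hρ, hρA, hρW⟩ := ih
    have hc : c (ρ a) = c (π a) := by rw [hρ, hπ]
    refine ⟨Equiv.swap (ρ a) (π a) * ρ, mul_mem (swap_mem_cellPerms hc) hρ, ?_, ?_⟩
    · intro x hx
      rw [Equiv.Perm.mul_apply]
      rcases Finset.mem_insert.1 hx with rfl | hx
      · rw [Equiv.swap_apply_left]
      · have hxa : x ≠ a := fun h => ha (h ▸ hx)
        rw [hρA x hx, Equiv.swap_apply_of_ne_of_ne]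
        · rw [← hρA x hx]
          exact fun h => hxa (ρ.injective h)
        · exact fun h => hxa (π.injective h)
    · intro u hu
      have h1 := hW u (ρ a) (π a) hu hc
      have h2 := hρW (u ∘ ⇑(Equiv.swap (ρ a) (π a))) (hP _ _ (swap_mem_cellPerms hc) hu)
      rw [Finset.card_insert_of_notMem ha]
      push_cast
      calc |W (u ∘ ⇑(Equiv.swap (ρ a) (π a) * ρ)) - W u|
          = |(W ((u ∘ ⇑(Equiv.swap (ρ a) (π a))) ∘ ⇑ρ) - W (u ∘ ⇑(Equiv.swap (ρ a) (π a))))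
            + (W (u ∘ ⇑(Equiv.swap (ρ a) (π a))) - W u)| := by
              rw [sub_add_sub_cancel]; rfl
        _ ≤ A.card * b + b := (abs_add_le _ _).trans (add_le_add h2 h1)
        _ = _ := by ring

variable [Fintype ι]

instance (c : ι → κ) : Fintype (cellPerms c) := Fintype.ofFinite _

/-- The mean of the observable `f` over the configurations obtained from `v` by permuting the
sites inside the cells, i.e. over the configurations with the same cell contents as `v`. -/
def orbitMean (c : ι → κ) (v : ι → α) (f : (ι → α) → ℝ) : ℝ :=
  (∑ π : cellPerms c, f (v ∘ ⇑(π : Equiv.Perm ι))) / Fintype.card (cellPerms c)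

theorem card_cellPerms_pos (c : ι → κ) : (0 : ℝ) < Fintype.card (cellPerms c) := by
  exact_mod_cast Fintype.card_pos

theorem orbitMean_congr {c : ι → κ} {v : ι → α} {f g : (ι → α) → ℝ}
    (h : ∀ π ∈ cellPerms c, f (v ∘ ⇑π) = g (v ∘ ⇑π)) : orbitMean c v f = orbitMean c v g := by
  unfold orbitMean
  rw [Finset.sum_congr rfl fun π _ => h π.1 π.2]

theorem orbitMean_const (c : ι → κ) (v : ι → α) (r : ℝ) :
    orbitMean c v (fun _ => r) = r := by
  have := card_cellPerms_pos c
  simp only [orbitMean, Finset.sum_const, Finset.card_univ, nsmul_eq_mul]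
  field_simp

theorem orbitMean_add (c : ι → κ) (v : ι → α) (f g : (ι → α) → ℝ) :
    orbitMean c v (fun u => f u + g u) = orbitMean c v f + orbitMean c v g := by
  simp only [orbitMean, Finset.sum_add_distrib, add_div]

theorem orbitMean_sub (c : ι → κ) (v : ι → α) (f g : (ι → α) → ℝ) :
    orbitMean c v (fun u => f u - g u) = orbitMean c v f - orbitMean c v g := by
  simp only [orbitMean, Finset.sum_sub_distrib, sub_div]

theorem orbitMean_const_mul (c : ι → κ) (v : ι → α) (r : ℝ) (f : (ι → α) → ℝ) :
    orbitMean c v (fun u => r * f u) = r * orbitMean c v f := by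
  simp only [orbitMean, ← Finset.mul_sum, mul_div_assoc]

theorem orbitMean_sum {β : Type*} (s : Finset β) (c : ι → κ) (v : ι → α)
    (f : β → (ι → α) → ℝ) :
    orbitMean c v (fun u => ∑ i ∈ s, f i u) = ∑ i ∈ s, orbitMean c v (f i) := by
  simp only [orbitMean, Finset.sum_comm (s := Finset.univ), Finset.sum_div]

theorem orbitMean_mono {c : ι → κ} {v : ι → α} {f g : (ι → α) → ℝ}
    (h : ∀ π ∈ cellPerms c, f (v ∘ ⇑π) ≤ g (v ∘ ⇑π)) : orbitMean c v f ≤ orbitMean c v g := by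
  unfold orbitMean
  have := card_cellPerms_pos c
  gcongr with π
  exact h π.1 π.2

theorem orbitMean_pos {c : ι → κ} {v : ι → α} {f : (ι → α) → ℝ}
    (h : ∀ u, 0 < f u) : 0 < orbitMean c v f :=
  div_pos (Finset.sum_pos (fun _ _ => h _) Finset.univ_nonempty) (card_cellPerms_pos c)

theorem orbitMean_comp (c : ι → κ) (v : ι → α) (f : (ι → α) → ℝ) {ρ : Equiv.Perm ι}
    (hρ : ρ ∈ cellPerms c) :
    orbitMean c v (fun u => f (u ∘ ⇑ρ)) = orbitMean c v f := by
  unfold orbitMean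
  congr 1
  exact Fintype.sum_equiv (Equiv.mulRight (⟨ρ, hρ⟩ : cellPerms c)) _ _ fun π => rfl

theorem orbitMean_base (c : ι → κ) (v : ι → α) (f : (ι → α) → ℝ) {ρ : Equiv.Perm ι}
    (hρ : ρ ∈ cellPerms c) :
    orbitMean c (v ∘ ⇑ρ) f = orbitMean c v f := by
  unfold orbitMean
  congr 1
  exact Fintype.sum_equiv (Equiv.mulLeft (⟨ρ, hρ⟩ : cellPerms c)) _ _ fun π => rfl

end Orbit

/-! ### Tilted means -/

section Tilt

variable {ι κ α : Type*} [Fintype ι]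

/-- The mean of `f` over the orbit of `v`, tilted by the weight `exp (t * W)`. -/
def tiltMean (c : ι → κ) (v : ι → α) (W : (ι → α) → ℝ) (t : ℝ) (f : (ι → α) → ℝ) : ℝ :=
  orbitMean c v (fun u => f u * Real.exp (t * W u)) / orbitMean c v (fun u => Real.exp (t * W u))

variable {c : ι → κ} {v : ι → α} {W : (ι → α) → ℝ} {t : ℝ}

theorem orbitMean_exp_pos (c : ι → κ) (v : ι → α) (W : (ι → α) → ℝ) (t : ℝ) :
    0 < orbitMean c v (fun u => Real.exp (t * W u)) :=
  orbitMean_pos fun _ => Real.exp_pos _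

theorem tiltMean_const (r : ℝ) : tiltMean c v W t (fun _ => r) = r := by
  rw [tiltMean, orbitMean_const_mul, mul_div_cancel_right₀ _ (orbitMean_exp_pos c v W t).ne']

theorem tiltMean_congr {f g : (ι → α) → ℝ}
    (h : ∀ π ∈ cellPerms c, f (v ∘ ⇑π) = g (v ∘ ⇑π)) :
    tiltMean c v W t f = tiltMean c v W t g := by
  unfold tiltMean
  congr 1
  exact orbitMean_congr fun π hπ => by rw [h π hπ]

theorem tiltMean_sub (f g : (ι → α) → ℝ) :
    tiltMean c v W t (fun u => f u - g u) = tiltMean c v W t f - tiltMean c v W t g := by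
  simp only [tiltMean, sub_mul, orbitMean_sub, sub_div]

theorem tiltMean_const_mul (r : ℝ) (f : (ι → α) → ℝ) :
    tiltMean c v W t (fun u => r * f u) = r * tiltMean c v W t f := by
  simp only [tiltMean, mul_assoc, orbitMean_const_mul, mul_div_assoc]

theorem tiltMean_sum {β : Type*} (s : Finset β) (f : β → (ι → α) → ℝ) :
    tiltMean c v W t (fun u => ∑ i ∈ s, f i u) = ∑ i ∈ s, tiltMean c v W t (f i) := by
  simp only [tiltMean, Finset.sum_mul, orbitMean_sum, Finset.sum_div]

theorem tiltMean_mono {f g : (ι → α) → ℝ}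
    (h : ∀ π ∈ cellPerms c, f (v ∘ ⇑π) ≤ g (v ∘ ⇑π)) :
    tiltMean c v W t f ≤ tiltMean c v W t g := by
  unfold tiltMean
  have := orbitMean_exp_pos c v W t
  gcongr
  exact orbitMean_mono fun π hπ => by gcongr; exact h π hπ

theorem abs_tiltMean_le {f : (ι → α) → ℝ} {B : ℝ}
    (h : ∀ π ∈ cellPerms c, |f (v ∘ ⇑π)| ≤ B) : |tiltMean c v W t f| ≤ B := by
  rw [abs_le]
  constructor
  · rw [← tiltMean_const (c := c) (v := v) (W := W) (t := t) (-B)]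
    exact tiltMean_mono fun π hπ => (abs_le.1 (h π hπ)).1
  · rw [← tiltMean_const (c := c) (v := v) (W := W) (t := t) B]
    exact tiltMean_mono fun π hπ => (abs_le.1 (h π hπ)).2

/-- Change of variables: a cell-preserving permutation of the sites leaves the untilted mean
invariant, and changes the tilt by the increment of `W`. -/
theorem tiltMean_comp (f : (ι → α) → ℝ) {ρ : Equiv.Perm ι} (hρ : ρ ∈ cellPerms c) :
    tiltMean c v W t f =
      tiltMean c v W t (fun u => f (u ∘ ⇑ρ) * Real.exp (t * (W (u ∘ ⇑ρ) - W u))) := by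
  unfold tiltMean
  rw [← orbitMean_comp c v (fun u => f u * Real.exp (t * W u)) hρ]
  congr 2
  ext u
  rw [mul_assoc, ← Real.exp_add]
  ring_nf

/-- First order: tilting moves the mean of a local observable only by an amount proportional to
the number of sites it depends on. Averaging `φ` over all cell-preserving permutations gives
a constant on the orbit, and each of these permutations may be replaced by one that moves few
sites. -/
theorem abs_tiltMean_sub_orbitMean_le [DecidableEq ι] {P : (ι → α) → Prop} {b B : ℝ}
    (hP : ∀ u, ∀ π ∈ cellPerms c, P u → P (u ∘ ⇑π)) (hv : P v)
    (hW : ∀ u x y, P u → c x = c y → |W (u ∘ ⇑(Equiv.swap x y)) - W u| ≤ b)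
    {φ : (ι → α) → ℝ} {A : Finset ι} (hφA : DependsOn φ (A : Set ι))
    (hφ : ∀ u, P u → |φ u| ≤ B) (ht0 : 0 ≤ t) (ht1 : t ≤ 1) (hb : A.card * b ≤ 1) :
    |tiltMean c v W t φ - orbitMean c v φ| ≤ B * (2 * (A.card * b)) := by
  have hcard := card_cellPerms_pos c
  have key : ∀ π ∈ cellPerms c,
      |tiltMean c v W t φ - tiltMean c v W t (fun u => φ (u ∘ ⇑π))| ≤ B * (2 * (A.card * b)) := by
    intro π hπ
    obtain ⟨ρ, hρ, hρA, hρW⟩ := exists_perm_agree hP hW hπ A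
    have e : ∀ u, φ (u ∘ ⇑π) = φ (u ∘ ⇑ρ) := fun u =>
      hφA fun x hx => by simp [hρA x hx]
    simp only [e]
    rw [tiltMean_comp φ hρ, ← tiltMean_sub]
    refine abs_tiltMean_le fun σ hσ => ?_
    have hu := hP v σ hσ hv
    set u := v ∘ ⇑σ
    have hd := hρW u hu
    have h1 : |t * (W (u ∘ ⇑ρ) - W u)| ≤ A.card * b := by
      rw [abs_mul, abs_of_nonneg ht0]
      exact (mul_le_of_le_one_left (abs_nonneg _) ht1).trans hd
    rw [← mul_sub_one, abs_mul]
    have h2 := Real.abs_exp_sub_one_le (h1.trans hb)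
    have h3 := hφ _ (hP u ρ hρ hu)
    exact mul_le_mul h3 (by linarith) (abs_nonneg _) ((abs_nonneg _).trans h3)
  have avg : orbitMean c v φ =
      (∑ π : cellPerms c, tiltMean c v W t (fun u => φ (u ∘ ⇑(π : Equiv.Perm ι))))
        / Fintype.card (cellPerms c) := by
    rw [← tiltMean_sum, tiltMean_congr (g := fun _ => orbitMean c v φ * Fintype.card (cellPerms c)),
      tiltMean_const, mul_div_cancel_right₀ _ hcard.ne']
    intro π hπ
    rw [← orbitMean_base c v φ hπ, orbitMean, div_mul_cancel₀ _ hcard.ne']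
  have e2 : tiltMean c v W t φ - orbitMean c v φ =
      (∑ π : cellPerms c, (tiltMean c v W t φ
        - tiltMean c v W t (fun u => φ (u ∘ ⇑(π : Equiv.Perm ι))))) /
        Fintype.card (cellPerms c) := by
    rw [avg, Finset.sum_sub_distrib, sub_div]
    simp only [Finset.sum_const, Finset.card_univ, nsmul_eq_mul]
    field_simp
  rw [e2, abs_div, abs_of_pos hcard, div_le_iff₀ hcard]
  calc _ ≤ ∑ π : cellPerms c, |tiltMean c v W t φ
        - tiltMean c v W t (fun u => φ (u ∘ ⇑(π : Equiv.Perm ι)))| := Finset.abs_sum_le_sum_abs _ _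
    _ ≤ ∑ π : cellPerms c, B * (2 * (A.card * b)) := Finset.sum_le_sum fun π _ => key π.1 π.2
    _ = _ := by
      simp only [Finset.sum_const, Finset.card_univ, nsmul_eq_mul]
      ring

theorem hasDerivAt_log_orbitMean (c : ι → κ) (v : ι → α) (W : (ι → α) → ℝ) (t : ℝ) :
    HasDerivAt (fun t => Real.log (orbitMean c v (fun u => Real.exp (t * W u))))
      (tiltMean c v W t W) t := by
  refine HasDerivAt.log ?_ (orbitMean_exp_pos c v W t).ne'
  unfold orbitMean
  refine HasDerivAt.div_const ?_ _
  refine HasDerivAt.fun_sum fun π _ => ?_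
  have := ((hasDerivAt_id t).mul_const (W (v ∘ ⇑(π : Equiv.Perm ι)))).exp
  simpa [mul_comm] using this

end Tilt

/-! ### Second-order expansion of the log-Laplace transform of a pair energy -/

section PairEnergy

variable {ι κ : Type*}

theorem abs_swap_observable_le {u : ι → ℝ} (hu : ∀ x, |u x| ≤ 1) (x x' z z' : ι) :
    |(u x' - u x) * (u z + u z') / 2| ≤ 2 := by
  have h1 : |u x' - u x| ≤ 2 := (abs_sub _ _).trans (by linarith [hu x, hu x'])
  have h2 : |u z + u z'| ≤ 2 := (abs_add_le _ _).trans (by linarith [hu z, hu z'])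
  rw [abs_div, abs_mul, abs_two]
  nlinarith [abs_nonneg (u x' - u x), abs_nonneg (u z + u z')]

variable [Fintype ι]

/-- The pair interaction energy `(1/2) ∑ x, ∑ y, a x y * u x * u y`; the couplings `a` used below
vanish on the diagonal. -/
def pairEnergy (a : ι → ι → ℝ) (u : ι → ℝ) : ℝ := (∑ x, ∑ y, a x y * (u x * u y)) / 2

/-- The increment of the pair energy under a transposition of two sites is a sum of observables,
each depending on at most three sites. -/
theorem pairEnergy_swap_sub [DecidableEq ι] {a : ι → ι → ℝ} (ha : ∀ x y, a x y = a y x)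
    (u : ι → ℝ) (x x' : ι) :
    pairEnergy a (u ∘ ⇑(Equiv.swap x x')) - pairEnergy a u =
      ∑ z, (a x z - a x' z) * ((u x' - u x) * (u z + u (Equiv.swap x x' z)) / 2) := by
  rcases eq_or_ne x x' with rfl | hxx
  · simp
  set s : ι → ℝ := u ∘ ⇑(Equiv.swap x x') with hs
  have hsym : ∑ w, ∑ z, a w z * (s w * u z) = ∑ w, ∑ z, a w z * (u w * s z) := by
    rw [Finset.sum_comm]
    refine Finset.sum_congr rfl fun w _ => Finset.sum_congr rfl fun z _ => ?_
    rw [ha]; ring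
  have h1 : pairEnergy a s - pairEnergy a u =
      (∑ w, (s w - u w) * ∑ z, a w z * (u z + s z)) / 2 := by
    have : ∑ w, (s w - u w) * ∑ z, a w z * (u z + s z) =
        (∑ w, ∑ z, a w z * (s w * s z) - ∑ w, ∑ z, a w z * (u w * u z))
        + (∑ w, ∑ z, a w z * (s w * u z) - ∑ w, ∑ z, a w z * (u w * s z)) := by
      simp only [← Finset.sum_sub_distrib, ← Finset.sum_add_distrib, Finset.mul_sum]
      refine Finset.sum_congr rfl fun w _ => Finset.sum_congr rfl fun z _ => ?_
      ring
    rw [this, hsym, pairEnergy, pairEnergy]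
    ring
  rw [h1, ← Finset.sum_subset (Finset.subset_univ {x, x'}), Finset.sum_pair hxx]
  · simp only [hs, Function.comp, Equiv.swap_apply_left, Equiv.swap_apply_right, Finset.mul_sum,
      Finset.sum_div, ← Finset.sum_add_distrib]
    refine Finset.sum_congr rfl fun z _ => ?_
    ring
  · intro w _ hw
    simp only [Finset.mem_insert, Finset.mem_singleton, not_or] at hw
    simp [hs, Equiv.swap_apply_of_ne_of_ne hw.1 hw.2]

theorem sum_abs_sub_le {a : ι → ι → ℝ} {γ : ℝ} (hγ : ∀ x, ∑ y, |a x y| ≤ γ) (x x' : ι) :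
    ∑ z, |a x z - a x' z| ≤ 2 * γ := by
  calc ∑ z, |a x z - a x' z| ≤ ∑ z, (|a x z| + |a x' z|) :=
        Finset.sum_le_sum fun z _ => abs_sub _ _
    _ ≤ 2 * γ := by rw [Finset.sum_add_distrib]; linarith [hγ x, hγ x']

theorem abs_pairEnergy_swap_sub_le [DecidableEq ι] {a : ι → ι → ℝ} {γ : ℝ}
    (ha : ∀ x y, a x y = a y x) (hγ : ∀ x, ∑ y, |a x y| ≤ γ) {u : ι → ℝ} (hu : ∀ x, |u x| ≤ 1)
    (x x' : ι) :
    |pairEnergy a (u ∘ ⇑(Equiv.swap x x')) - pairEnergy a u| ≤ 4 * γ := by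
  rw [pairEnergy_swap_sub ha]
  calc _ ≤ ∑ z, |a x z - a x' z| * 2 := by
        refine (Finset.abs_sum_le_sum_abs _ _).trans (Finset.sum_le_sum fun z _ => ?_)
        rw [abs_mul]
        exact mul_le_mul_of_nonneg_left (abs_swap_observable_le hu _ _ _ _) (abs_nonneg _)
    _ ≤ 4 * γ := by
      rw [← Finset.sum_mul]
      linarith [sum_abs_sub_le hγ x x']

variable [DecidableEq ι] {c : ι → κ} {v : ι → ℝ} {a : ι → ι → ℝ} {γ t : ℝ}

/-- Second order: moving one site of a pair inside its cell changes the tilted two-point function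
by the linear response `t * ⟨(u x u y - u x' u y) W⟩₀`, up to an error quadratic in the
strength `γ` of the couplings. -/
theorem abs_twoPoint_sub_le (ha : ∀ x y, a x y = a y x) (hγ : ∀ x, ∑ y, |a x y| ≤ γ)
    (hγ1 : 16 * γ ≤ 1) (hv : ∀ x, |v x| ≤ 1) (ht0 : 0 ≤ t) (ht1 : t ≤ 1)
    {x x' y : ι} (hc : c x = c x') (hxy : x ≠ y) (hxy' : x' ≠ y) :
    |(tiltMean c v (pairEnergy a) t (fun u => u x * u y)
        - t * orbitMean c v (fun u => u x * u y * pairEnergy a u))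
      - (tiltMean c v (pairEnergy a) t (fun u => u x' * u y)
        - t * orbitMean c v (fun u => u x' * u y * pairEnergy a u))| ≤ 144 * γ ^ 2 := by
  set W := pairEnergy a with hWdef
  set τ := Equiv.swap x x' with hτ
  have hτm : τ ∈ cellPerms c := swap_mem_cellPerms hc
  have hγ0 : 0 ≤ γ := (Finset.sum_nonneg fun _ _ => abs_nonneg _).trans (hγ x)
  have hP : ∀ u : ι → ℝ, ∀ π ∈ cellPerms c, (∀ x, |u x| ≤ 1) → ∀ x, |(u ∘ ⇑π) x| ≤ 1 :=
    fun u π _ hu x => hu _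
  have hW : ∀ (u : ι → ℝ) (x y : ι), (∀ x, |u x| ≤ 1) → c x = c y →
      |W (u ∘ ⇑(Equiv.swap x y)) - W u| ≤ 4 * γ :=
    fun u x y hu _ => abs_pairEnergy_swap_sub_le ha hγ hu x y
  have hgτ : ∀ u : ι → ℝ, (u ∘ ⇑τ) x * (u ∘ ⇑τ) y = u x' * u y := fun u => by
    simp only [Function.comp, hτ, Equiv.swap_apply_left,
      Equiv.swap_apply_of_ne_of_ne hxy.symm hxy'.symm]
  -- expansion of the exponential in the change of variables by `τ`
  have hA : |tiltMean c v W t (fun u => u x * u y) - tiltMean c v W t (fun u => u x' * u y)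
      - t * tiltMean c v W t (fun u => u x' * u y * (W (u ∘ ⇑τ) - W u))| ≤ 16 * γ ^ 2 := by
    rw [tiltMean_comp (fun u => u x * u y) hτm]
    simp only [hgτ]
    rw [← tiltMean_sub, ← tiltMean_const_mul, ← tiltMean_sub]
    refine abs_tiltMean_le fun σ hσ => ?_
    have hu := hP v σ hσ hv
    set u := v ∘ ⇑σ
    have hd := hW u x x' hu hc
    rw [← hτ] at hd
    set D := W (u ∘ ⇑τ) - W u
    have h1 : |t * D| ≤ 4 * γ := by
      rw [abs_mul, abs_of_nonneg ht0]
      exact (mul_le_of_le_one_left (abs_nonneg _) ht1).trans hd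
    have h2 := Real.abs_exp_sub_one_sub_id_le (h1.trans (by linarith))
    have h3 : |u x' * u y| ≤ 1 := by
      rw [abs_mul]; exact mul_le_one₀ (hu _) (abs_nonneg _) (hu _)
    have h4 : (t * D) ^ 2 ≤ (4 * γ) ^ 2 := by
      rw [← sq_abs]; exact pow_le_pow_left₀ (abs_nonneg _) h1 2
    calc |u x' * u y * Real.exp (t * D) - u x' * u y - t * (u x' * u y * D)|
        = |u x' * u y| * |Real.exp (t * D) - 1 - t * D| := by rw [← abs_mul]; ring_nf
      _ ≤ 1 * (t * D) ^ 2 := mul_le_mul h3 h2 (abs_nonneg _) zero_le_one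
      _ ≤ 16 * γ ^ 2 := by linarith
  -- the linear response term is a sum of local observables, hence barely feels the tilt
  have hB : |tiltMean c v W t (fun u => u x' * u y * (W (u ∘ ⇑τ) - W u))
      - orbitMean c v (fun u => u x' * u y * (W (u ∘ ⇑τ) - W u))| ≤ 128 * γ ^ 2 := by
    let φ : ι → (ι → ℝ) → ℝ := fun z u => u x' * u y * ((u x' - u x) * (u z + u (τ z)) / 2)
    have e : (fun u => u x' * u y * (W (u ∘ ⇑τ) - W u)) =
        fun u => ∑ z, (a x z - a x' z) * φ z u := by
      ext u
      rw [hWdef, hτ, pairEnergy_swap_sub ha, Finset.mul_sum]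
      refine Finset.sum_congr rfl fun z _ => ?_
      simp only [φ, hτ]
      ring
    rw [e, tiltMean_sum, orbitMean_sum, ← Finset.sum_sub_distrib]
    have hz : ∀ z, |tiltMean c v W t (φ z) - orbitMean c v (φ z)| ≤ 64 * γ := by
      intro z
      have hAc : (({x, x', y, z} : Finset ι).card : ℝ) ≤ 4 := by
        exact_mod_cast Finset.card_le_four
      have hle : ({x, x', y, z} : Finset ι).card * (4 * γ) ≤ 16 * γ := by nlinarith
      refine (abs_tiltMean_sub_orbitMean_le (P := fun u => ∀ x, |u x| ≤ 1) (b := 4 * γ)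
        (B := 2) (A := {x, x', y, z}) hP hv hW ?_ ?_ ht0 ht1 (by linarith)).trans (by linarith)
      · intro u w huw
        have hx := huw x (by simp)
        have hx' := huw x' (by simp)
        have hy := huw y (by simp)
        have hz := huw z (by simp)
        have hτz : u (τ z) = w (τ z) := by
          rcases eq_or_ne z x with rfl | h1
          · rw [hτ, Equiv.swap_apply_left, hx']
          rcases eq_or_ne z x' with rfl | h2
          · rw [hτ, Equiv.swap_apply_right, hx]
          rw [hτ, Equiv.swap_apply_of_ne_of_ne h1 h2, hz]
        simp only [φ, hx, hx', hy, hz, hτz]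
      · intro u hu
        have h3 : |u x' * u y| ≤ 1 := by
          rw [abs_mul]; exact mul_le_one₀ (hu _) (abs_nonneg _) (hu _)
        have h4 := abs_swap_observable_le hu x x' z (τ z)
        simp only [φ]
        rw [abs_mul]
        nlinarith [abs_nonneg (u x' * u y)]
    calc _ ≤ ∑ z, |a x z - a x' z| * (64 * γ) := by
          refine (Finset.abs_sum_le_sum_abs _ _).trans (Finset.sum_le_sum fun z _ => ?_)
          rw [tiltMean_const_mul, orbitMean_const_mul, ← mul_sub,
            abs_mul]
          exact mul_le_mul_of_nonneg_left (hz z) (abs_nonneg _)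
      _ ≤ 128 * γ ^ 2 := by
        rw [← Finset.sum_mul]
        nlinarith [sum_abs_sub_le hγ x x']
  have hC : orbitMean c v (fun u => u x' * u y * (W (u ∘ ⇑τ) - W u)) =
      orbitMean c v (fun u => u x * u y * W u) - orbitMean c v (fun u => u x' * u y * W u) := by
    rw [← orbitMean_comp c v (fun u => u x * u y * W u) hτm, ← orbitMean_sub]
    congr 1
    ext u
    rw [hgτ]
    ring
  rw [hC] at hB
  have hB' := mul_le_mul ht1 hB (abs_nonneg _) zero_le_one
  rw [← abs_of_nonneg ht0, ← abs_mul, abs_of_nonneg ht0] at hB'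
  rw [abs_le] at *
  constructor <;> nlinarith [hA.1, hA.2, hB'.1, hB'.2]

/-- Inside a pair of cells all pairs of different sites have the same linearized tilted two-point
function, up to a quadratic error. -/
theorem abs_twoPoint_sub_le' (ha : ∀ x y, a x y = a y x) (hγ : ∀ x, ∑ y, |a x y| ≤ γ)
    (hγ1 : 16 * γ ≤ 1) (hv : ∀ x, |v x| ≤ 1) (ht0 : 0 ≤ t) (ht1 : t ≤ 1)
    {F : ι → ι → ℝ} (hF : ∀ x y, F x y = tiltMean c v (pairEnergy a) t (fun u => u x * u y)
        - t * orbitMean c v (fun u => u x * u y * pairEnergy a u))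
    {x x' y y' : ι} (hx : c x = c x') (hy : c y = c y') (hxy : x ≠ y) (hxy' : x' ≠ y') :
    |F x y - F x' y'| ≤ 288 * γ ^ 2 := by
  have hsym : ∀ x y, F x y = F y x := fun x y => by
    rw [hF, hF]; simp only [mul_comm]
  have step : ∀ {x x' y}, c x = c x' → x ≠ y → x' ≠ y → |F x y - F x' y| ≤ 144 * γ ^ 2 := by
    intro x x' y h1 h2 h3
    rw [hF, hF]
    exact abs_twoPoint_sub_le ha hγ hγ1 hv ht0 ht1 h1 h2 h3
  have two : ∀ {r s w : ℝ}, |r - s| ≤ 144 * γ ^ 2 → |s - w| ≤ 144 * γ ^ 2 →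
      |r - w| ≤ 288 * γ ^ 2 := fun {r s w} h1 h2 =>
    (abs_sub_le r s w).trans (by linarith)
  rcases eq_or_ne x' y with rfl | h1
  · rcases eq_or_ne y' x with rfl | h2
    · rw [hsym, sub_self, abs_zero]; positivity
    · refine two (s := F x y') ?_ (step hx h2.symm hxy')
      rw [hsym x, hsym x]
      exact step hy hxy.symm h2
  · refine two (s := F x' y) (step hx hxy h1) ?_
    rw [hsym x', hsym x']
    exact step hy h1.symm hxy'.symm

variable [Fintype κ] [DecidableEq κ]

/-- The tilted mean of a pair energy whose couplings sum to zero over every pair of cells agrees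
with its linear response up to a cubic error: only the variation of the two-point function inside
the cells contributes. -/
theorem abs_tiltMean_pairEnergy_sub_le (ha : ∀ x y, a x y = a y x) (hdiag : ∀ x, a x x = 0)
    (hγ : ∀ x, ∑ y, |a x y| ≤ γ) (hγ1 : 16 * γ ≤ 1) (hv : ∀ x, |v x| ≤ 1)
    (ht0 : 0 ≤ t) (ht1 : t ≤ 1)
    (hzero : ∀ k l, ∑ x with c x = k, ∑ y with c y = l, a x y = 0) :
    |tiltMean c v (pairEnergy a) t (pairEnergy a)
      - t * orbitMean c v (fun u => pairEnergy a u ^ 2)| ≤ 144 * Fintype.card ι * γ ^ 3 := by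
  set W := pairEnergy a with hWdef
  let F : ι → ι → ℝ := fun x y => tiltMean c v W t (fun u => u x * u y)
        - t * orbitMean c v (fun u => u x * u y * W u)
  have hex : ∀ k l, ∃ r : ℝ, ∀ x y, c x = k → c y = l → x ≠ y →
      |F x y - r| ≤ 288 * γ ^ 2 := by
    intro k l
    by_cases h : ∃ x y, c x = k ∧ c y = l ∧ x ≠ y
    · obtain ⟨x, y, hx, hy, hxy⟩ := h
      exact ⟨F x y, fun x' y' hx' hy' hxy' => abs_twoPoint_sub_le' ha hγ hγ1 hv ht0 ht1
        (fun _ _ => rfl) (hx'.trans hx.symm) (hy'.trans hy.symm) hxy' hxy⟩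
    · push Not at h
      exact ⟨0, fun x y hx hy hxy => absurd (h x y hx hy) hxy⟩
  choose r hr using hex
  have e1 : tiltMean c v W t W - t * orbitMean c v (fun u => W u ^ 2) =
      (∑ x, ∑ y, a x y * F x y) / 2 := by
    have h1 : tiltMean c v W t W =
        (∑ x, ∑ y, a x y * tiltMean c v W t (fun u => u x * u y)) / 2 := by
      have : W = fun u => (1 / 2) * ∑ x, ∑ y, a x y * (u x * u y) := by
        ext u; rw [hWdef, pairEnergy]; ring
      conv_lhs => arg 5; rw [this]
      simp only [tiltMean_const_mul, tiltMean_sum]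
      ring
    have h2 : orbitMean c v (fun u => W u ^ 2) =
        (∑ x, ∑ y, a x y * orbitMean c v (fun u => u x * u y * W u)) / 2 := by
      have : (fun u => W u ^ 2) =
          fun u => (1 / 2) * ∑ x, ∑ y, a x y * (u x * u y * W u) := by
        ext u
        have : W u ^ 2 = (∑ x, ∑ y, a x y * (u x * u y)) / 2 * W u := by
          rw [sq]; congr 1
        rw [this]
        simp only [← mul_assoc, ← Finset.sum_mul]
        ring
      rw [this]
      simp only [orbitMean_const_mul, orbitMean_sum]
      ring
    rw [h1, h2]
    simp only [F, mul_sub, Finset.sum_sub_distrib, mul_left_comm _ t, ← Finset.mul_sum]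
    ring
  have e2 : ∑ x, ∑ y, a x y * r (c x) (c y) = 0 := by
    have : ∀ x, ∑ y, a x y * r (c x) (c y) =
        ∑ l, r (c x) l * ∑ y with c y = l, a x y := by
      intro x
      rw [← Finset.sum_fiberwise (s := Finset.univ) (g := c)]
      refine Finset.sum_congr rfl fun l _ => ?_
      rw [Finset.mul_sum]
      refine Finset.sum_congr rfl fun y hy => ?_
      rw [(Finset.mem_filter.1 hy).2, mul_comm]
    simp only [this]
    rw [← Finset.sum_fiberwise (s := Finset.univ) (g := c)]
    refine Finset.sum_eq_zero fun k _ => ?_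
    rw [Finset.sum_comm]
    refine Finset.sum_eq_zero fun l _ => ?_
    rw [← mul_zero (r k l), ← hzero k l, Finset.mul_sum]
    refine Finset.sum_congr rfl fun x hx => ?_
    rw [(Finset.mem_filter.1 hx).2]
  have e3 : ∑ x, ∑ y, a x y * F x y = ∑ x, ∑ y, a x y * (F x y - r (c x) (c y)) := by
    simp only [mul_sub, Finset.sum_sub_distrib, e2, sub_zero]
  rw [e1, e3, abs_div, abs_two]
  have e4 : |∑ x, ∑ y, a x y * (F x y - r (c x) (c y))| ≤
      ∑ _x : ι, γ * (288 * γ ^ 2) := by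
    refine (Finset.abs_sum_le_sum_abs _ _).trans (Finset.sum_le_sum fun x _ => ?_)
    refine (Finset.abs_sum_le_sum_abs _ _).trans ?_
    refine le_trans ?_ (mul_le_mul_of_nonneg_right (hγ x) (by positivity))
    rw [Finset.sum_mul]
    refine Finset.sum_le_sum fun y _ => ?_
    rcases eq_or_ne x y with rfl | hxy
    · simp [hdiag]
    · rw [abs_mul]
      exact mul_le_mul_of_nonneg_left (hr _ _ x y rfl rfl hxy) (abs_nonneg _)
  rw [Finset.sum_const, Finset.card_univ, nsmul_eq_mul] at e4
  nlinarith

/-- The cumulant expansion of second order: the logarithm of the exponential moment of the pair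
energy is half its second moment, up to an error of order `γ ^ 3` per site. -/
theorem abs_log_orbitMean_exp_sub_le (ha : ∀ x y, a x y = a y x) (hdiag : ∀ x, a x x = 0)
    (hγ : ∀ x, ∑ y, |a x y| ≤ γ) (hγ1 : 16 * γ ≤ 1) (hv : ∀ x, |v x| ≤ 1)
    (hzero : ∀ k l, ∑ x with c x = k, ∑ y with c y = l, a x y = 0) :
    |Real.log (orbitMean c v (fun u => Real.exp (pairEnergy a u)))
      - orbitMean c v (fun u => pairEnergy a u ^ 2) / 2| ≤ 144 * Fintype.card ι * γ ^ 3 := by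
  set W := pairEnergy a
  set m := orbitMean c v (fun u => W u ^ 2)
  let f : ℝ → ℝ := fun t =>
    Real.log (orbitMean c v (fun u => Real.exp (t * W u))) - t ^ 2 * (m / 2)
  have hf : ∀ t ∈ Set.Icc (0 : ℝ) 1,
      HasDerivWithinAt f (tiltMean c v W t W - t * m) (Set.Icc 0 1) t := by
    intro t _
    have h1 : HasDerivAt (fun t => t ^ 2 * (m / 2)) (t * m) t :=
      ((hasDerivAt_pow 2 t).mul_const (m / 2)).congr_deriv (by push_cast; ring)
    exact ((hasDerivAt_log_orbitMean c v W t).sub h1).hasDerivWithinAt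
  have := (convex_Icc (0 : ℝ) 1).norm_image_sub_le_of_norm_hasDerivWithin_le hf
    (fun t ht => abs_tiltMean_pairEnergy_sub_le ha hdiag hγ hγ1 hv ht.1 ht.2 hzero)
    (Set.left_mem_Icc.2 zero_le_one) (Set.right_mem_Icc.2 zero_le_one)
  simpa [f, orbitMean_const] using this

end PairEnergy

/-! ### Moments of exchangeable spins -/

section Moments

theorem E1_half (Q η : ℝ) : E1 Q ((η + Q) / 2) = η / Q := by
  rw [E1]; ring_nf

theorem E2_half (Q η : ℝ) : E2 Q ((η + Q) / 2) = (η ^ 2 - Q) / (Q * (Q - 1)) := by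
  rw [E2]; congr 1; ring

theorem E3_half (Q η : ℝ) :
    E3 Q ((η + Q) / 2) = (η ^ 3 - (3 * Q - 2) * η) / (Q * (Q - 1) * (Q - 2)) := by
  rw [E3]; congr 1; ring

theorem E4_half (Q η : ℝ) :
    E4 Q ((η + Q) / 2) = (η ^ 4 - (6 * Q - 8) * η ^ 2 + 3 * Q ^ 2 - 6 * Q) /
      (Q * (Q - 1) * (Q - 2) * (Q - 3)) := by
  rw [E4]; congr 1; ring

variable {ι κ : Type*}

/-- An observable that is invariant under transpositions of sites of the cell `k` outside `A`. -/
def CellInvariant [DecidableEq ι] (c : ι → κ) (k : κ) (A : Finset ι) (g : (ι → ℝ) → ℝ) : Prop :=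
  ∀ u x y, c x = k → c y = k → x ∉ A → y ∉ A → g (u ∘ ⇑(Equiv.swap x y)) = g u

theorem CellInvariant.one [DecidableEq ι] (c : ι → κ) (k : κ) : CellInvariant c k ∅ fun _ => 1 :=
  fun _ _ _ _ _ _ _ => rfl

theorem CellInvariant.spin_mul [DecidableEq ι] {c : ι → κ} {k : κ} {g : (ι → ℝ) → ℝ} {z : ι}
    (hz : c z ≠ k) (hg : CellInvariant c k ∅ g) : CellInvariant c k ∅ fun u => u z * g u := by
  intro u x y hx hy h₁ h₂
  have h1 : z ≠ x := fun h => hz (h ▸ hx)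
  have h2 : z ≠ y := fun h => hz (h ▸ hy)
  simp only [Function.comp, Equiv.swap_apply_of_ne_of_ne h1 h2]
  rw [← hg u x y hx hy h₁ h₂]

theorem CellInvariant.insert_spin_mul [DecidableEq ι] {c : ι → κ} {k : κ} {A : Finset ι}
    {g : (ι → ℝ) → ℝ} (hg : CellInvariant c k A g) (w : ι) :
    CellInvariant c k (insert w A) fun u => u w * g u := by
  intro u x y hx hy hxA hyA
  rw [Finset.mem_insert, not_or] at hxA hyA
  simp only [Function.comp, Equiv.swap_apply_of_ne_of_ne (Ne.symm hxA.1) (Ne.symm hyA.1)]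
  rw [← hg u x y hx hy hxA.2 hyA.2]

variable [Fintype ι] {c : ι → κ} {v : ι → ℝ} {Q : ℕ}

theorem orbitMean_spin_sq (hv : ∀ x, v x ^ 2 = 1) (x : ι) (g : (ι → ℝ) → ℝ) :
    orbitMean c v (fun u => u x * (u x * g u)) = orbitMean c v g := by
  refine orbitMean_congr fun π _ => ?_
  rw [← mul_assoc, ← sq, Function.comp, hv, one_mul]

variable [DecidableEq κ]

/-- The sites of the cell `k`. -/
def cellFinset (c : ι → κ) (k : κ) : Finset ι := {x | c x = k}

theorem mem_cellFinset {k : κ} {x : ι} : x ∈ cellFinset c k ↔ c x = k := by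
  simp [cellFinset]

/-- The block spin of the cell `k`. -/
def blockSum (c : ι → κ) (v : ι → ℝ) (k : κ) : ℝ := ∑ x ∈ cellFinset c k, v x

theorem blockSum_comp {π : Equiv.Perm ι} (hπ : π ∈ cellPerms c) (v : ι → ℝ) (k : κ) :
    blockSum c (v ∘ ⇑π) k = blockSum c v k := by
  unfold blockSum
  refine Finset.sum_equiv π (fun x => ?_) fun x _ => rfl
  rw [mem_cellFinset, mem_cellFinset, hπ x]

theorem card_le_of_subset_cell (hQ : ∀ k, (cellFinset c k).card = Q) {k : κ} {A : Finset ι}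
    (hA : ∀ x ∈ A, c x = k) : A.card ≤ Q := by
  rw [← hQ k]
  exact Finset.card_le_card fun x hx => mem_cellFinset.2 (hA x hx)

variable [DecidableEq ι]

/-- The sum rule behind the moments: the block spin is constant on the orbit, and the mean of
`u z * f u` does not depend on the choice of `z` among the sites under whose transpositions `f` is
invariant. -/
theorem sum_rule (hQ : ∀ k, (cellFinset c k).card = Q) {k : κ} {A : Finset ι}
    (hA : A ⊆ cellFinset c k) {f : (ι → ℝ) → ℝ}
    (hf : CellInvariant c k A f) {z : ι} (hz : c z = k) (hzA : z ∉ A) :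
    ∑ x ∈ A, orbitMean c v (fun u => u x * f u)
      + ((Q : ℝ) - A.card) * orbitMean c v (fun u => u z * f u)
      = blockSum c v k * orbitMean c v f := by
  have h1 : ∑ x ∈ cellFinset c k, orbitMean c v (fun u => u x * f u)
      = blockSum c v k * orbitMean c v f := by
    rw [← orbitMean_sum, ← orbitMean_const_mul]
    refine orbitMean_congr fun π hπ => ?_
    rw [← Finset.sum_mul, ← blockSum_comp hπ]
    rfl
  have h2 : ∀ w ∈ cellFinset c k \ A, orbitMean c v (fun u => u w * f u)
      = orbitMean c v (fun u => u z * f u) := by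
    intro w hw
    rw [Finset.mem_sdiff, mem_cellFinset] at hw
    rw [← orbitMean_comp c v (fun u => u w * f u)
      (swap_mem_cellPerms (x := w) (y := z) (hw.1.trans hz.symm))]
    congr 1
    ext u
    rw [hf u w z hw.1 hz hw.2 hzA, Function.comp, Equiv.swap_apply_left]
  rw [← h1, ← Finset.sum_sdiff hA, Finset.sum_congr rfl h2, Finset.sum_const,
    Finset.card_sdiff_of_subset hA, hQ, nsmul_eq_mul,
    Nat.cast_sub (by rw [← hQ k]; exact Finset.card_le_card hA)]
  ring


/-- The number of plus spins of the cell `k`, read off from its block spin. -/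
def plusSpins (c : ι → κ) (v : ι → ℝ) (Q : ℕ) (k : κ) : ℝ := (blockSum c v k + Q) / 2

variable {k : κ} {g : (ι → ℝ) → ℝ}

theorem orbitMean_one_spin (hQ : ∀ k, (cellFinset c k).card = Q) (hg : CellInvariant c k ∅ g)
    {x : ι} (hx : c x = k) :
    orbitMean c v (fun u => u x * g u) = E1 Q (plusSpins c v Q k) * orbitMean c v g := by
  have hcard := card_le_of_subset_cell hQ (A := {x}) (k := k) (by simp [hx])
  have hQ0 : (Q : ℝ) ≠ 0 := by
    simp only [Finset.card_singleton] at hcard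
    positivity
  have := sum_rule (v := v) hQ (A := ∅) (f := g) (z := x) (Finset.empty_subset (cellFinset c k))
    hg hx (by simp)
  simp only [Finset.sum_empty, Finset.card_empty] at this
  rw [plusSpins, E1_half]
  field_simp
  linear_combination this

theorem orbitMean_two_spins (hQ : ∀ k, (cellFinset c k).card = Q) (hv : ∀ x, v x ^ 2 = 1)
    (hg : CellInvariant c k ∅ g) {x y : ι} (hx : c x = k) (hy : c y = k) (hxy : x ≠ y) :
    orbitMean c v (fun u => u x * (u y * g u)) =
      E2 Q (plusSpins c v Q k) * orbitMean c v g := by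
  have hcard := card_le_of_subset_cell hQ (A := {x, y}) (k := k) (by simp [hx, hy])
  have hQ0 : (2 : ℝ) ≤ Q := by
    rw [Finset.card_pair hxy] at hcard
    exact_mod_cast hcard
  have h0 : (Q : ℝ) ≠ 0 := by linarith
  have h1 : (Q : ℝ) - 1 ≠ 0 := by linarith
  have := sum_rule (v := v) hQ (k := k) (A := {y}) (f := fun u => u y * g u) (z := x)
    (fun w hw => by rw [Finset.mem_singleton.1 hw]; exact mem_cellFinset.2 hy)
    (hg.insert_spin_mul y) hx
    (by simpa using hxy)
  simp only [Finset.sum_singleton, Finset.card_singleton, orbitMean_spin_sq hv,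
    orbitMean_one_spin hQ hg hy, plusSpins, E1_half] at this
  rw [plusSpins, E2_half]
  field_simp at this ⊢
  push_cast at this
  linear_combination this

theorem orbitMean_three_spins (hQ : ∀ k, (cellFinset c k).card = Q) (hv : ∀ x, v x ^ 2 = 1)
    (hg : CellInvariant c k ∅ g) {x y z : ι} (hx : c x = k) (hy : c y = k) (hz : c z = k)
    (hxy : x ≠ y) (hxz : x ≠ z) (hyz : y ≠ z) :
    orbitMean c v (fun u => u x * (u y * (u z * g u))) =
      E3 Q (plusSpins c v Q k) * orbitMean c v g := by
  have hcard := card_le_of_subset_cell hQ (A := {x, y, z}) (k := k) (by simp [hx, hy, hz])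
  have hQ0 : (3 : ℝ) ≤ Q := by
    rw [Finset.card_eq_three.2 ⟨x, y, z, hxy, hxz, hyz, rfl⟩] at hcard
    exact_mod_cast hcard
  have h0 : (Q : ℝ) ≠ 0 := by linarith
  have h1 : (Q : ℝ) - 1 ≠ 0 := by linarith
  have h2 : (Q : ℝ) - 2 ≠ 0 := by linarith
  have := sum_rule (v := v) hQ (k := k) (A := {y, z}) (f := fun u => u y * (u z * g u)) (z := x)
    (fun w hw => by
      rw [mem_cellFinset]
      rcases Finset.mem_insert.1 hw with rfl | hw
      · exact hy
      · rw [Finset.mem_singleton.1 hw, hz])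
    ((hg.insert_spin_mul z).insert_spin_mul y) hx
    (by simp [hxy, hxz])
  have e : orbitMean c v (fun u => u z * (u y * (u z * g u))) = orbitMean c v (fun u => u y * g u) := by
    rw [← orbitMean_spin_sq hv z (fun u => u y * g u)]
    congr 1; ext u; ring
  simp only [Finset.sum_pair hyz, Finset.card_pair hyz, orbitMean_spin_sq hv, e,
    orbitMean_one_spin hQ hg hy, orbitMean_one_spin hQ hg hz,
    orbitMean_two_spins hQ hv hg hy hz hyz, plusSpins, E1_half, E2_half] at this
  rw [plusSpins, E3_half]
  field_simp at this ⊢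
  push_cast at this
  linear_combination this

theorem orbitMean_four_spins (hQ : ∀ k, (cellFinset c k).card = Q) (hv : ∀ x, v x ^ 2 = 1)
    (hg : CellInvariant c k ∅ g) {x y z w : ι} (hx : c x = k) (hy : c y = k) (hz : c z = k)
    (hw : c w = k) (hxy : x ≠ y) (hxz : x ≠ z) (hxw : x ≠ w) (hyz : y ≠ z) (hyw : y ≠ w)
    (hzw : z ≠ w) :
    orbitMean c v (fun u => u x * (u y * (u z * (u w * g u)))) =
      E4 Q (plusSpins c v Q k) * orbitMean c v g := by
  have hcard := card_le_of_subset_cell hQ (A := {x, y, z, w}) (k := k) (by simp [hx, hy, hz, hw])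
  have h3 : ({y, z, w} : Finset ι).card = 3 :=
    Finset.card_eq_three.2 ⟨y, z, w, hyz, hyw, hzw, rfl⟩
  have hQ0 : (4 : ℝ) ≤ Q := by
    rw [Finset.card_insert_of_notMem (by simp [hxy, hxz, hxw]), h3] at hcard
    exact_mod_cast hcard
  have h0 : (Q : ℝ) ≠ 0 := by linarith
  have h1 : (Q : ℝ) - 1 ≠ 0 := by linarith
  have h2 : (Q : ℝ) - 2 ≠ 0 := by linarith
  have h3' : (Q : ℝ) - 3 ≠ 0 := by linarith
  have := sum_rule (v := v) hQ (k := k) (A := {y, z, w})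
    (f := fun u => u y * (u z * (u w * g u))) (z := x)
    (fun t ht => by
      rw [mem_cellFinset]
      simp only [Finset.mem_insert, Finset.mem_singleton] at ht
      rcases ht with rfl | rfl | rfl <;> assumption)
    (((hg.insert_spin_mul w).insert_spin_mul z).insert_spin_mul y) hx
    (by simp [hxy, hxz, hxw])
  have e1 : orbitMean c v (fun u => u z * (u y * (u z * (u w * g u)))) =
      orbitMean c v (fun u => u y * (u w * g u)) := by
    rw [← orbitMean_spin_sq hv z (fun u => u y * (u w * g u))]
    congr 1; ext u; ring
  have e2 : orbitMean c v (fun u => u w * (u y * (u z * (u w * g u)))) =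
      orbitMean c v (fun u => u y * (u z * g u)) := by
    rw [← orbitMean_spin_sq hv w (fun u => u y * (u z * g u))]
    congr 1; ext u; ring
  rw [Finset.sum_insert (by simp [hyz, hyw]), Finset.sum_pair hzw, h3] at this
  simp only [orbitMean_spin_sq hv, e1, e2,
    orbitMean_two_spins hQ hv hg hy hz hyz, orbitMean_two_spins hQ hv hg hz hw hzw,
    orbitMean_two_spins hQ hv hg hy hw hyw,
    orbitMean_three_spins hQ hv hg hy hz hw hyz hyw hzw, plusSpins, E2_half, E3_half] at this
  rw [plusSpins, E4_half]
  field_simp at this ⊢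
  push_cast at this
  linear_combination this

end Moments

/-! ### Correlations of cell energies -/

section PairMoments

variable {ι κ : Type*} [Fintype ι] [DecidableEq κ]
  {c : ι → κ} {v : ι → ℝ} {Q : ℕ} {k : κ} {g : (ι → ℝ) → ℝ}

/-- The part of the energy that couples the cells `k` and `l`, summed over ordered pairs. -/
def cellEnergy (a : ι → ι → ℝ) (c : ι → κ) (k l : κ) (u : ι → ℝ) : ℝ :=
  ∑ x ∈ cellFinset c k, ∑ y ∈ cellFinset c l, a x y * (u x * u y)

/-- The total coupling of the site `x` to the cell `l`. -/
def rowSum (a : ι → ι → ℝ) (c : ι → κ) (l : κ) (x : ι) : ℝ := ∑ y ∈ cellFinset c l, a x y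

theorem orbitMean_cellEnergy_mul (a : ι → ι → ℝ) (k l : κ) (g : (ι → ℝ) → ℝ) :
    orbitMean c v (fun u => cellEnergy a c k l u * g u) =
      ∑ x ∈ cellFinset c k, ∑ y ∈ cellFinset c l,
        a x y * orbitMean c v (fun u => u x * (u y * g u)) := by
  simp only [cellEnergy, Finset.sum_mul, orbitMean_sum, mul_assoc, orbitMean_const_mul]

theorem orbitMean_spin_cellEnergy (a : ι → ι → ℝ) (k l : κ) (x y : ι) :
    orbitMean c v (fun u => u x * (u y * cellEnergy a c k l u)) =
      ∑ w ∈ cellFinset c k, ∑ z ∈ cellFinset c l,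
        a w z * orbitMean c v (fun u => u x * (u y * (u w * u z))) := by
  have : (fun u : ι → ℝ => u x * (u y * cellEnergy a c k l u)) =
      fun u => cellEnergy a c k l u * (u x * u y) := by ext u; ring
  rw [this, orbitMean_cellEnergy_mul]
  refine Finset.sum_congr rfl fun w _ => Finset.sum_congr rfl fun z _ => ?_
  congr 2; ext u; ring

theorem cellEnergy_comm {a : ι → ι → ℝ} (ha : ∀ x y, a x y = a y x) (k l : κ) :
    cellEnergy a c k l = cellEnergy a c l k := by
  ext u
  unfold cellEnergy
  rw [Finset.sum_comm]
  refine Finset.sum_congr rfl fun y _ => Finset.sum_congr rfl fun x _ => ?_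
  rw [ha]; ring

variable [DecidableEq ι]

theorem orbitMean_pair_eq (hQ : ∀ k, (cellFinset c k).card = Q) (hv : ∀ x, v x ^ 2 = 1)
    (hg : CellInvariant c k ∅ g) {x w : ι} (hx : c x = k) (hw : c w = k) :
    orbitMean c v (fun u => u x * (u w * g u)) =
      (E2 Q (plusSpins c v Q k) + (1 - E2 Q (plusSpins c v Q k)) * (if x = w then 1 else 0))
        * orbitMean c v g := by
  rcases eq_or_ne x w with rfl | h
  · rw [orbitMean_spin_sq hv, if_pos rfl]; ring
  · rw [orbitMean_two_spins hQ hv hg hx hw h, if_neg h]; ring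

theorem orbitMean_triple_eq (hQ : ∀ k, (cellFinset c k).card = Q) (hv : ∀ x, v x ^ 2 = 1)
    (hg : CellInvariant c k ∅ g) {x w z : ι} (hx : c x = k) (hw : c w = k) (hz : c z = k)
    (hwz : w ≠ z) :
    orbitMean c v (fun u => u x * (u w * (u z * g u))) =
      (E3 Q (plusSpins c v Q k) + (E1 Q (plusSpins c v Q k) - E3 Q (plusSpins c v Q k)) *
        ((if x = w then 1 else 0) + (if x = z then 1 else 0))) * orbitMean c v g := by
  rcases eq_or_ne x w with rfl | h
  · rw [orbitMean_spin_sq hv, if_pos rfl, if_neg hwz, orbitMean_one_spin hQ hg hz]; ring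
  rcases eq_or_ne x z with rfl | h'
  · rw [if_pos rfl, if_neg h]
    have : (fun u : ι → ℝ => u x * (u w * (u x * g u))) =
        fun u => u x * (u x * (u w * g u)) := by ext u; ring
    rw [this, orbitMean_spin_sq hv, orbitMean_one_spin hQ hg hw]; ring
  · rw [orbitMean_three_spins hQ hv hg hx hw hz h h' hwz, if_neg h, if_neg h']; ring

theorem orbitMean_quadruple_eq (hQ : ∀ k, (cellFinset c k).card = Q) (hv : ∀ x, v x ^ 2 = 1)
    (hg : CellInvariant c k ∅ g) {x y w z : ι} (hx : c x = k) (hy : c y = k) (hw : c w = k)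
    (hz : c z = k) (hxy : x ≠ y) (hwz : w ≠ z) :
    orbitMean c v (fun u => u x * (u y * (u w * (u z * g u)))) =
      (E4 Q (plusSpins c v Q k) + (E2 Q (plusSpins c v Q k) - E4 Q (plusSpins c v Q k)) *
        ((if x = w then 1 else 0) + (if x = z then 1 else 0) +
          (if y = w then 1 else 0) + (if y = z then 1 else 0))
        + (1 - 2 * E2 Q (plusSpins c v Q k) + E4 Q (plusSpins c v Q k)) *
          ((if x = w then 1 else 0) * (if y = z then 1 else 0) +
            (if x = z then 1 else 0) * (if y = w then 1 else 0))) * orbitMean c v g := by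
  -- a site that occurs twice drops out of the product
  have drop : ∀ {p q r : ι}, orbitMean c v (fun u => u p * (u q * (u p * (u r * g u)))) =
      orbitMean c v (fun u => u q * (u r * g u)) := by
    intro p q r
    rw [← orbitMean_spin_sq hv p (fun u => u q * (u r * g u))]
    congr 1; ext u; ring
  have drop' : ∀ {p q r : ι}, orbitMean c v (fun u => u p * (u q * (u r * (u p * g u)))) =
      orbitMean c v (fun u => u q * (u r * g u)) := by
    intro p q r
    rw [← orbitMean_spin_sq hv p (fun u => u q * (u r * g u))]
    congr 1; ext u; ring
  rcases eq_or_ne x w with rfl | h1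
  · rw [drop, if_pos rfl, if_neg hwz, if_neg hxy.symm, orbitMean_pair_eq hQ hv hg hy hz]
    ring
  rcases eq_or_ne x z with rfl | h2
  · rw [drop', if_pos rfl, if_neg h1, if_neg hxy.symm, orbitMean_pair_eq hQ hv hg hy hw]
    ring
  have comm : ∀ {q r : ι}, orbitMean c v (fun u => u x * (u y * (u q * (u r * g u)))) =
      orbitMean c v (fun u => u y * (u x * (u q * (u r * g u)))) := by
    intro q r; congr 1; ext u; ring
  rcases eq_or_ne y w with rfl | h3
  · rw [comm, drop, if_pos rfl, if_neg h1, if_neg h2, if_neg hwz,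
      orbitMean_two_spins hQ hv hg hx hz h2]
    ring
  rcases eq_or_ne y z with rfl | h4
  · rw [comm, drop', if_pos rfl, if_neg h1, if_neg h2, if_neg h3,
      orbitMean_two_spins hQ hv hg hx hw h1]
    ring
  · rw [orbitMean_four_spins hQ hv hg hx hy hw hz hxy h1 h2 h3 h4 hwz, if_neg h1, if_neg h2,
      if_neg h3, if_neg h4]
    ring

variable {a : ι → ι → ℝ}

/-- The energy between two cells is uncorrelated with every observable that is exchangeable in
these cells, because its couplings sum to zero. -/
theorem orbitMean_cellEnergy_mul_eq_zero (hQ : ∀ k, (cellFinset c k).card = Q)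
    (hv : ∀ x, v x ^ 2 = 1) (hdiag : ∀ x, a x x = 0)
    (hzero : ∀ k l, ∑ x ∈ cellFinset c k, ∑ y ∈ cellFinset c l, a x y = 0) {k l : κ}
    (hgk : CellInvariant c k ∅ g) (hgl : CellInvariant c l ∅ g) :
    orbitMean c v (fun u => cellEnergy a c k l u * g u) = 0 := by
  rw [orbitMean_cellEnergy_mul]
  have : ∃ r : ℝ, ∀ x ∈ cellFinset c k, ∀ y ∈ cellFinset c l,
      a x y * orbitMean c v (fun u => u x * (u y * g u)) = a x y * r := by
    rcases eq_or_ne k l with rfl | hkl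
    · refine ⟨E2 Q (plusSpins c v Q k) * orbitMean c v g, fun x hx y hy => ?_⟩
      rcases eq_or_ne x y with rfl | hxy
      · simp [hdiag]
      · rw [orbitMean_two_spins hQ hv hgk (mem_cellFinset.1 hx) (mem_cellFinset.1 hy) hxy]
    · refine ⟨E1 Q (plusSpins c v Q k) * (E1 Q (plusSpins c v Q l) * orbitMean c v g),
        fun x hx y hy => ?_⟩
      rw [mem_cellFinset] at hx hy
      rw [orbitMean_one_spin hQ (hgk.spin_mul (by rw [hy]; exact hkl.symm)) hx,
        orbitMean_one_spin hQ hgl hy]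
  obtain ⟨r, hr⟩ := this
  rw [Finset.sum_congr rfl fun x hx => Finset.sum_congr rfl fun y hy => hr x hx y hy]
  simp only [← Finset.sum_mul, hzero, zero_mul]

theorem orbitMean_cellEnergy (hQ : ∀ k, (cellFinset c k).card = Q)
    (hv : ∀ x, v x ^ 2 = 1) (hdiag : ∀ x, a x x = 0)
    (hzero : ∀ k l, ∑ x ∈ cellFinset c k, ∑ y ∈ cellFinset c l, a x y = 0) (k l : κ) :
    orbitMean c v (cellEnergy a c k l) = 0 := by
  simpa using orbitMean_cellEnergy_mul_eq_zero (v := v) hQ hv hdiag hzero (k := k) (l := l)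
    (CellInvariant.one c k) (CellInvariant.one c l)

theorem cellInvariant_cellEnergy {j k l : κ} (hk : k ≠ j) (hl : l ≠ j) :
    CellInvariant c j ∅ (cellEnergy a c k l) := by
  intro u x y hx hy _ _
  unfold cellEnergy
  refine Finset.sum_congr rfl fun w hw => Finset.sum_congr rfl fun z hz => ?_
  rw [mem_cellFinset] at hw hz
  rw [Function.comp, Function.comp, Equiv.swap_apply_of_ne_of_ne, Equiv.swap_apply_of_ne_of_ne]
  all_goals rintro rfl; simp_all

/-- The second moment of the energy inside a single cell. -/
theorem orbitMean_cellEnergy_self_sq (hQ : ∀ k, (cellFinset c k).card = Q)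
    (hv : ∀ x, v x ^ 2 = 1) (ha : ∀ x y, a x y = a y x) (hdiag : ∀ x, a x x = 0)
    (hzero : ∀ k l, ∑ x ∈ cellFinset c k, ∑ y ∈ cellFinset c l, a x y = 0) (k : κ) :
    orbitMean c v (fun u => cellEnergy a c k k u * cellEnergy a c k k u) =
      4 * (∑ x ∈ cellFinset c k, rowSum a c k x ^ 2) *
        (-E4 Q (plusSpins c v Q k) + E2 Q (plusSpins c v Q k))
      + 2 * (∑ x ∈ cellFinset c k, ∑ y ∈ cellFinset c k, a x y ^ 2) *
        (E4 Q (plusSpins c v Q k) + 1 - 2 * E2 Q (plusSpins c v Q k)) := by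
  set e4 := E4 Q (plusSpins c v Q k) with he4
  set e2 := E2 Q (plusSpins c v Q k) with he2
  set K := cellFinset c k
  have hzK : ∑ x ∈ K, ∑ y ∈ K, a x y = 0 := hzero k k
  have col : ∀ x, ∑ w ∈ K, a w x = rowSum a c k x := fun x =>
    Finset.sum_congr rfl fun w _ => ha w x
  have inner : ∀ x ∈ K, ∀ y ∈ K, x ≠ y →
      orbitMean c v (fun u => u x * (u y * cellEnergy a c k k u)) =
        2 * (e2 - e4) * (rowSum a c k x + rowSum a c k y) + 2 * (1 - 2 * e2 + e4) * a x y := by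
    intro x hx y hy hxy
    rw [orbitMean_spin_cellEnergy]
    have h1 : ∀ w ∈ K, ∀ z ∈ K, a w z * orbitMean c v (fun u => u x * (u y * (u w * u z))) =
        e4 * a w z + (e2 - e4) * ((if x = w then a w z else 0) + (if x = z then a w z else 0) +
          (if y = w then a w z else 0) + (if y = z then a w z else 0))
        + (1 - 2 * e2 + e4) * ((if x = w then (if y = z then a w z else 0) else 0)
          + (if x = z then (if y = w then a w z else 0) else 0)) := by
      intro w hw z hz
      rcases eq_or_ne w z with rfl | hwz
      · simp [hdiag]
      have := orbitMean_quadruple_eq hQ hv (CellInvariant.one c k) (mem_cellFinset.1 hx)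
        (mem_cellFinset.1 hy) (mem_cellFinset.1 hw) (mem_cellFinset.1 hz) hxy hwz
      simp only [mul_one, orbitMean_const] at this
      rw [this, ← he4, ← he2]
      split_ifs <;> ring
    rw [Finset.sum_congr rfl fun w hw => Finset.sum_congr rfl fun z hz => h1 w hw z hz]
    simp only [Finset.sum_add_distrib, ← Finset.mul_sum, hzK]
    have s1 : ∀ x ∈ K, ∑ w ∈ K, ∑ z ∈ K, (if x = w then a w z else 0) = rowSum a c k x := by
      intro x hx
      rw [Finset.sum_comm]
      refine Finset.sum_congr rfl fun z _ => ?_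
      rw [Finset.sum_ite_eq, if_pos hx]
    have s2 : ∀ x ∈ K, ∑ w ∈ K, ∑ z ∈ K, (if x = z then a w z else 0) = rowSum a c k x := by
      intro x hx
      rw [← col]
      refine Finset.sum_congr rfl fun z _ => ?_
      rw [Finset.sum_ite_eq, if_pos hx]
    have s3 : ∑ w ∈ K, ∑ z ∈ K, (if x = w then (if y = z then a w z else 0) else 0) = a x y := by
      rw [Finset.sum_comm]
      simp only [Finset.sum_ite_eq, if_pos hx, if_pos hy]
    have s4 : ∑ w ∈ K, ∑ z ∈ K, (if x = z then (if y = w then a w z else 0) else 0) = a x y := by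
      simp only [Finset.sum_ite_eq, if_pos hx, if_pos hy, ha x y]
    rw [s1 x hx, s2 x hx, s1 y hy, s2 y hy, s3, s4]
    ring
  rw [orbitMean_cellEnergy_mul]
  have h2 : ∀ x ∈ K, ∀ y ∈ K,
      a x y * orbitMean c v (fun u => u x * (u y * cellEnergy a c k k u)) =
        2 * (e2 - e4) * (a x y * rowSum a c k x) + 2 * (e2 - e4) * (a x y * rowSum a c k y)
          + 2 * (1 - 2 * e2 + e4) * a x y ^ 2 := by
    intro x hx y hy
    rcases eq_or_ne x y with rfl | hxy
    · simp [hdiag]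
    · rw [inner x hx y hy hxy]; ring
  rw [Finset.sum_congr rfl fun x hx => Finset.sum_congr rfl fun y hy => h2 x hx y hy]
  simp only [Finset.sum_add_distrib, ← Finset.mul_sum]
  have s1 : ∑ x ∈ K, ∑ y ∈ K, a x y * rowSum a c k x = ∑ x ∈ K, rowSum a c k x ^ 2 := by
    refine Finset.sum_congr rfl fun x _ => ?_
    rw [← Finset.sum_mul, sq]; rfl
  have s2 : ∑ x ∈ K, ∑ y ∈ K, a x y * rowSum a c k y = ∑ x ∈ K, rowSum a c k x ^ 2 := by
    rw [Finset.sum_comm]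
    refine Finset.sum_congr rfl fun x _ => ?_
    rw [← Finset.sum_mul, sq, col]
  rw [s1, s2]
  ring

/-- The second moment of the energy between two different cells. -/
theorem orbitMean_cellEnergy_sq (hQ : ∀ k, (cellFinset c k).card = Q)
    (hv : ∀ x, v x ^ 2 = 1) (ha : ∀ x y, a x y = a y x)
    (hzero : ∀ k l, ∑ x ∈ cellFinset c k, ∑ y ∈ cellFinset c l, a x y = 0) {k l : κ}
    (hkl : k ≠ l) :
    orbitMean c v (fun u => cellEnergy a c k l u * cellEnergy a c k l u) =
      (∑ x ∈ cellFinset c k, ∑ y ∈ cellFinset c l, a x y ^ 2) *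
        ((1 - E2 Q (plusSpins c v Q k)) * (1 - E2 Q (plusSpins c v Q l)))
      + (∑ x ∈ cellFinset c k, rowSum a c l x ^ 2) *
        ((1 - E2 Q (plusSpins c v Q k)) * E2 Q (plusSpins c v Q l))
      + (∑ y ∈ cellFinset c l, rowSum a c k y ^ 2) *
        (E2 Q (plusSpins c v Q k) * (1 - E2 Q (plusSpins c v Q l))) := by
  set e := E2 Q (plusSpins c v Q k) with he
  set e' := E2 Q (plusSpins c v Q l) with he'
  have col : ∀ x, ∑ w ∈ cellFinset c k, a w x = rowSum a c k x := fun x =>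
    Finset.sum_congr rfl fun w _ => ha w x
  have inner : ∀ x ∈ cellFinset c k, ∀ y ∈ cellFinset c l,
      orbitMean c v (fun u => u x * (u y * cellEnergy a c k l u)) =
        (1 - e) * e' * rowSum a c l x + e * (1 - e') * rowSum a c k y
          + (1 - e) * (1 - e') * a x y := by
    intro x hx y hy
    rw [orbitMean_spin_cellEnergy]
    have h1 : ∀ w ∈ cellFinset c k, ∀ z ∈ cellFinset c l,
        a w z * orbitMean c v (fun u => u x * (u y * (u w * u z))) =
        e * e' * a w z + (1 - e) * e' * (if x = w then a w z else 0)
          + e * (1 - e') * (if y = z then a w z else 0)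
          + (1 - e) * (1 - e') * (if x = w then (if y = z then a w z else 0) else 0) := by
      intro w hw z hz
      have h3 : orbitMean c v (fun u => u x * (u y * (u w * u z))) =
          orbitMean c v (fun u => u x * (u w * (u y * (u z * 1)))) := by
        congr 1; ext u; ring
      rw [mem_cellFinset] at hx hy hw hz
      rw [h3, orbitMean_pair_eq hQ hv (((CellInvariant.one c k).spin_mul
          (by rw [hz]; exact hkl.symm)).spin_mul (by rw [hy]; exact hkl.symm)) hx hw,
        orbitMean_pair_eq hQ hv (CellInvariant.one c l) hy hz, orbitMean_const, ← he, ← he']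
      split_ifs <;> ring
    rw [Finset.sum_congr rfl fun w hw => Finset.sum_congr rfl fun z hz => h1 w hw z hz]
    simp only [Finset.sum_add_distrib, ← Finset.mul_sum, hzero]
    have s1 : ∑ w ∈ cellFinset c k, ∑ z ∈ cellFinset c l, (if x = w then a w z else 0) =
        rowSum a c l x := by
      rw [Finset.sum_comm]
      refine Finset.sum_congr rfl fun z _ => ?_
      rw [Finset.sum_ite_eq, if_pos hx]
    have s2 : ∑ w ∈ cellFinset c k, ∑ z ∈ cellFinset c l, (if y = z then a w z else 0) =
        rowSum a c k y := by
      rw [← col]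
      refine Finset.sum_congr rfl fun z _ => ?_
      rw [Finset.sum_ite_eq, if_pos hy]
    have s3 : ∑ w ∈ cellFinset c k, ∑ z ∈ cellFinset c l,
        (if x = w then (if y = z then a w z else 0) else 0) = a x y := by
      rw [Finset.sum_comm]
      simp only [Finset.sum_ite_eq, if_pos hx, if_pos hy]
    rw [s1, s2, s3]
    ring
  rw [orbitMean_cellEnergy_mul]
  have h2 : ∀ x ∈ cellFinset c k, ∀ y ∈ cellFinset c l,
      a x y * orbitMean c v (fun u => u x * (u y * cellEnergy a c k l u)) =
        (1 - e) * e' * (a x y * rowSum a c l x) + e * (1 - e') * (a x y * rowSum a c k y)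
          + (1 - e) * (1 - e') * a x y ^ 2 := by
    intro x hx y hy
    rw [inner x hx y hy]; ring
  rw [Finset.sum_congr rfl fun x hx => Finset.sum_congr rfl fun y hy => h2 x hx y hy]
  simp only [Finset.sum_add_distrib, ← Finset.mul_sum]
  have s1 : ∑ x ∈ cellFinset c k, ∑ y ∈ cellFinset c l, a x y * rowSum a c l x =
      ∑ x ∈ cellFinset c k, rowSum a c l x ^ 2 := by
    refine Finset.sum_congr rfl fun x _ => ?_
    rw [← Finset.sum_mul, sq]; rfl
  have s2 : ∑ x ∈ cellFinset c k, ∑ y ∈ cellFinset c l, a x y * rowSum a c k y =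
      ∑ y ∈ cellFinset c l, rowSum a c k y ^ 2 := by
    rw [Finset.sum_comm]
    refine Finset.sum_congr rfl fun x _ => ?_
    rw [← Finset.sum_mul, sq, col]
  rw [s1, s2]
  ring

/-- The correlation of the energy inside a cell with the energy between this cell and another
one. -/
theorem orbitMean_cellEnergy_self_mul (hQ : ∀ k, (cellFinset c k).card = Q)
    (hv : ∀ x, v x ^ 2 = 1) (ha : ∀ x y, a x y = a y x) (hdiag : ∀ x, a x x = 0)
    (hzero : ∀ k l, ∑ x ∈ cellFinset c k, ∑ y ∈ cellFinset c l, a x y = 0) {k l : κ}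
    (hkl : k ≠ l) :
    orbitMean c v (fun u => cellEnergy a c k l u * cellEnergy a c k k u) =
      2 * (∑ y ∈ cellFinset c k, rowSum a c k y * rowSum a c l y) *
        ((E1 Q (plusSpins c v Q k) - E3 Q (plusSpins c v Q k)) * E1 Q (plusSpins c v Q l)) := by
  set e1 := E1 Q (plusSpins c v Q k) with he1
  set e3 := E3 Q (plusSpins c v Q k) with he3
  set e' := E1 Q (plusSpins c v Q l) with he'
  have col : ∀ x, ∑ w ∈ cellFinset c k, a w x = rowSum a c k x := fun x =>
    Finset.sum_congr rfl fun w _ => ha w x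
  have inner : ∀ x ∈ cellFinset c k, ∀ y ∈ cellFinset c l,
      orbitMean c v (fun u => u x * (u y * cellEnergy a c k k u)) =
        2 * ((e1 - e3) * e') * rowSum a c k x := by
    intro x hx y hy
    rw [orbitMean_spin_cellEnergy]
    have h1 : ∀ w ∈ cellFinset c k, ∀ z ∈ cellFinset c k,
        a w z * orbitMean c v (fun u => u x * (u y * (u w * u z))) =
        e3 * e' * a w z + (e1 - e3) * e' * ((if x = w then a w z else 0)
          + (if x = z then a w z else 0)) := by
      intro w hw z hz
      rcases eq_or_ne w z with rfl | hwz
      · simp [hdiag]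
      have h3 : orbitMean c v (fun u => u x * (u y * (u w * u z))) =
          orbitMean c v (fun u => u x * (u w * (u z * (u y * 1)))) := by
        congr 1; ext u; ring
      rw [mem_cellFinset] at hx hy hw hz
      rw [h3, orbitMean_triple_eq hQ hv ((CellInvariant.one c k).spin_mul
          (by rw [hy]; exact hkl.symm)) hx hw hz hwz,
        orbitMean_one_spin hQ (CellInvariant.one c l) hy, orbitMean_const, ← he1, ← he3, ← he']
      split_ifs <;> ring
    rw [Finset.sum_congr rfl fun w hw => Finset.sum_congr rfl fun z hz => h1 w hw z hz]
    simp only [Finset.sum_add_distrib, ← Finset.mul_sum, hzero]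
    have s1 : ∑ w ∈ cellFinset c k, ∑ z ∈ cellFinset c k, (if x = w then a w z else 0) =
        rowSum a c k x := by
      rw [Finset.sum_comm]
      refine Finset.sum_congr rfl fun z _ => ?_
      rw [Finset.sum_ite_eq, if_pos hx]
    have s2 : ∑ w ∈ cellFinset c k, ∑ z ∈ cellFinset c k, (if x = z then a w z else 0) =
        rowSum a c k x := by
      rw [← col]
      refine Finset.sum_congr rfl fun z _ => ?_
      rw [Finset.sum_ite_eq, if_pos hx]
    rw [s1, s2]
    ring
  rw [orbitMean_cellEnergy_mul,
    Finset.sum_congr rfl fun x hx => Finset.sum_congr rfl fun y hy => by rw [inner x hx y hy]]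
  simp only [← Finset.sum_mul]
  rw [mul_right_comm, Finset.mul_sum]
  refine Finset.sum_congr rfl fun x _ => ?_
  rw [rowSum, rowSum]
  ring

/-- The correlation of the energies of two pairs of cells that share the cell `k₂`. -/
theorem orbitMean_cellEnergy_mul_cellEnergy (hQ : ∀ k, (cellFinset c k).card = Q)
    (hv : ∀ x, v x ^ 2 = 1) (ha : ∀ x y, a x y = a y x)
    (hzero : ∀ k l, ∑ x ∈ cellFinset c k, ∑ y ∈ cellFinset c l, a x y = 0) {k₁ k₂ k₃ : κ}
    (h12 : k₁ ≠ k₂) (h13 : k₁ ≠ k₃) (h23 : k₂ ≠ k₃) :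
    orbitMean c v (fun u => cellEnergy a c k₁ k₂ u * cellEnergy a c k₂ k₃ u) =
      (∑ y ∈ cellFinset c k₂, rowSum a c k₁ y * rowSum a c k₃ y) *
        (E1 Q (plusSpins c v Q k₁) * (1 - E2 Q (plusSpins c v Q k₂)) *
          E1 Q (plusSpins c v Q k₃)) := by
  set e1 := E1 Q (plusSpins c v Q k₁) with he1
  set e2 := E2 Q (plusSpins c v Q k₂) with he2
  set e3 := E1 Q (plusSpins c v Q k₃) with he3
  have col : ∀ x, ∑ w ∈ cellFinset c k₁, a w x = rowSum a c k₁ x := fun x =>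
    Finset.sum_congr rfl fun w _ => ha w x
  have inner : ∀ x ∈ cellFinset c k₁, ∀ y ∈ cellFinset c k₂,
      orbitMean c v (fun u => u x * (u y * cellEnergy a c k₂ k₃ u)) =
        e1 * (1 - e2) * e3 * rowSum a c k₃ y := by
    intro x hx y hy
    rw [orbitMean_spin_cellEnergy]
    have h1 : ∀ w ∈ cellFinset c k₂, ∀ z ∈ cellFinset c k₃,
        a w z * orbitMean c v (fun u => u x * (u y * (u w * u z))) =
        e1 * e2 * e3 * a w z + e1 * (1 - e2) * e3 * (if y = w then a w z else 0) := by
      intro w hw z hz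
      have h3 : orbitMean c v (fun u => u x * (u y * (u w * u z))) =
          orbitMean c v (fun u => u x * (u y * (u w * (u z * 1)))) := by
        congr 1; ext u; ring
      rw [mem_cellFinset] at hx hy hw hz
      rw [h3, orbitMean_one_spin hQ ((((CellInvariant.one c k₁).spin_mul
          (by rw [hz]; exact h13.symm)).spin_mul (by rw [hw]; exact h12.symm)).spin_mul
          (by rw [hy]; exact h12.symm)) hx,
        orbitMean_pair_eq hQ hv ((CellInvariant.one c k₂).spin_mul
          (by rw [hz]; exact h23.symm)) hy hw,
        orbitMean_one_spin hQ (CellInvariant.one c k₃) hz, orbitMean_const, ← he1, ← he2, ← he3]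
      split_ifs <;> ring
    rw [Finset.sum_congr rfl fun w hw => Finset.sum_congr rfl fun z hz => h1 w hw z hz]
    simp only [Finset.sum_add_distrib, ← Finset.mul_sum, hzero]
    have s1 : ∑ w ∈ cellFinset c k₂, ∑ z ∈ cellFinset c k₃, (if y = w then a w z else 0) =
        rowSum a c k₃ y := by
      rw [Finset.sum_comm]
      refine Finset.sum_congr rfl fun z _ => ?_
      rw [Finset.sum_ite_eq, if_pos hy]
    rw [s1]
    ring
  rw [orbitMean_cellEnergy_mul,
    Finset.sum_congr rfl fun x hx => Finset.sum_congr rfl fun y hy => by rw [inner x hx y hy],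
    Finset.sum_comm, Finset.sum_mul]
  refine Finset.sum_congr rfl fun y _ => ?_
  rw [← Finset.sum_mul, col]
  ring

end PairMoments

/-! ### Sums over ordered cells -/

section OrderedSums

variable {κ O : Type*} [Fintype κ] [DecidableEq κ] [LinearOrder O]

theorem sum_sum_ne_eq_two_mul (e : κ → O) (he : Function.Injective e)
    [∀ k l, Decidable (e k < e l)] {f : κ → κ → ℝ} (hf : ∀ k l, f k l = f l k) :
    ∑ k, ∑ l with l ≠ k, f k l = 2 * ∑ k, ∑ l with e k < e l, f k l := by
  have h : ∀ k l, (if l ≠ k then f k l else 0) =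
      (if e k < e l then f k l else 0) + (if e l < e k then f l k else 0) := by
    intro k l
    rcases lt_trichotomy (e k) (e l) with h | h | h
    · rw [if_pos h, if_neg h.not_gt, if_pos (fun hh => h.ne (by rw [hh])), add_zero]
    · obtain rfl := he h
      simp
    · rw [if_pos h, if_neg h.not_gt, if_pos (fun hh => h.ne (by rw [hh])), zero_add, hf]
  simp only [Finset.sum_filter, h, Finset.sum_add_distrib]
  rw [Finset.sum_comm (f := fun k l => if e l < e k then f l k else 0)]
  ring

theorem sum_distinct_triples (e : κ → O) (he : Function.Injective e)
    [∀ k l, Decidable (e k < e l)] {f : κ → κ → κ → ℝ} (hf : ∀ j k l, f j k l = f l k j) :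
    ∑ j, ∑ k with k ≠ j, ∑ l ∈ ({j, k}ᶜ : Finset κ), f j k l =
      2 * ∑ j, ∑ k with e j < e k, ∑ l with e k < e l, (f j k l + f k l j + f l j k) := by
  let I : κ → κ → κ → ℝ := fun j k l => if e j < e k ∧ e k < e l then 1 else 0
  have h : ∀ j k l, (if k ≠ j then (if l ∈ ({j, k}ᶜ : Finset κ) then f j k l else 0) else 0) =
      (I j k l * f j k l + I j l k * f j k l + I k j l * f j k l)
      + (I k l j * f j k l + I l j k * f j k l + I l k j * f j k l) := by
    intro j k l
    have hmem : l ∈ ({j, k}ᶜ : Finset κ) ↔ l ≠ j ∧ l ≠ k := by simp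
    have irr : ∀ a b, ¬(e a < e b ∧ e b < e a) := fun a b h => lt_asymm h.1 h.2
    simp only [hmem, I]
    rcases eq_or_ne j k with rfl | hjk
    · simp [irr]
    rcases eq_or_ne j l with rfl | hjl
    · simp [irr]
    rcases eq_or_ne k l with rfl | hkl
    · simp [irr]
    rcases lt_or_gt_of_ne (he.ne hjk) with h1 | h1 <;>
      rcases lt_or_gt_of_ne (he.ne hkl) with h2 | h2 <;>
      rcases lt_or_gt_of_ne (he.ne hjl) with h3 | h3 <;>
      first
        | (exfalso; order)
        | simp [h1, h2, h3, h1.not_gt, h2.not_gt, h3.not_gt, hjk.symm, hjl.symm, hkl.symm]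
  have r : ∀ j k l, (if e j < e k then (if e k < e l then (f j k l + f k l j + f l j k) else 0)
      else 0) = I j k l * (f j k l + f k l j + f l j k) := by
    intro j k l
    simp only [I]
    split_ifs <;> simp_all
  have push : ∀ (p : Prop) [Decidable p] (F : κ → ℝ),
      (if p then ∑ l, F l else 0) = ∑ l, if p then F l else 0 := by
    intro p _ F
    split_ifs <;> simp
  have hL : ∑ j, ∑ k with k ≠ j, ∑ l ∈ ({j, k}ᶜ : Finset κ), f j k l =
      ∑ j, ∑ k, ∑ l, ((I j k l * f j k l + I j l k * f j k l + I k j l * f j k l)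
      + (I k l j * f j k l + I l j k * f j k l + I l k j * f j k l)) := by
    refine Finset.sum_congr rfl fun j _ => ?_
    rw [Finset.sum_filter]
    refine Finset.sum_congr rfl fun k _ => ?_
    rw [← Finset.sum_congr rfl fun l _ => h j k l, ← push]
    congr 1
    rw [← Finset.sum_filter]
    congr 1
    ext l
    simp
  have hR : ∑ j, ∑ k with e j < e k, ∑ l with e k < e l, (f j k l + f k l j + f l j k) =
      ∑ j, ∑ k, ∑ l, I j k l * (f j k l + f k l j + f l j k) := by
    refine Finset.sum_congr rfl fun j _ => ?_
    rw [Finset.sum_filter]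
    refine Finset.sum_congr rfl fun k _ => ?_
    rw [← Finset.sum_congr rfl fun l _ => r j k l, ← push, Finset.sum_filter]
  rw [hL, hR]
  simp only [mul_add, Finset.sum_add_distrib]
  -- relabel the indices in each of the six orderings
  have s23 : ∀ F : κ → κ → κ → ℝ, ∑ j, ∑ k, ∑ l, F j l k = ∑ j, ∑ k, ∑ l, F j k l := fun F =>
    Finset.sum_congr rfl fun j _ => Finset.sum_comm
  have s12 : ∀ F : κ → κ → κ → ℝ, ∑ j, ∑ k, ∑ l, F k j l = ∑ j, ∑ k, ∑ l, F j k l := fun F =>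
    Finset.sum_comm
  have p2 : ∑ j, ∑ k, ∑ l, I j l k * f j k l = ∑ j, ∑ k, ∑ l, I j k l * f k l j := by
    rw [← s23 fun j k l => I j k l * f k l j]
    simp only [hf _ _ (_ : κ)]
  have p3 : ∑ j, ∑ k, ∑ l, I k j l * f j k l = ∑ j, ∑ k, ∑ l, I j k l * f l j k := by
    rw [← s12 fun j k l => I j k l * f l j k]
    exact Finset.sum_congr rfl fun j _ => Finset.sum_congr rfl fun k _ =>
      Finset.sum_congr rfl fun l _ => by rw [hf j k l]
  have rot : ∀ F : κ → κ → κ → ℝ, ∑ j, ∑ k, ∑ l, F k l j = ∑ j, ∑ k, ∑ l, F j k l := fun F =>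
    (s12 fun j k l => F j l k).trans (s23 F)
  have p4 : ∑ j, ∑ k, ∑ l, I k l j * f j k l = ∑ j, ∑ k, ∑ l, I j k l * f l j k :=
    rot fun j k l => I j k l * f l j k
  have p5 : ∑ j, ∑ k, ∑ l, I l j k * f j k l = ∑ j, ∑ k, ∑ l, I j k l * f k l j :=
    (rot fun j k l => I k l j * f l j k).trans (rot fun j k l => I j k l * f k l j)
  have p6 : ∑ j, ∑ k, ∑ l, I l k j * f j k l = ∑ j, ∑ k, ∑ l, I j k l * f j k l := by
    rw [Finset.sum_congr rfl fun j _ => Finset.sum_congr rfl fun k _ =>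
      Finset.sum_congr rfl fun l _ => by rw [hf j k l]]
    exact (rot fun j k l => I k j l * f k j l).trans (s12 fun j k l => I j k l * f j k l)
  rw [p2, p3, p4, p5, p6]
  ring

end OrderedSums

/-! ### The second moment of a pair energy -/

section SecondMoment

theorem sum_eq_add_add_sum_compl {κ : Type*} [Fintype κ] [DecidableEq κ] {k l : κ} (h : k ≠ l)
    (F : κ → ℝ) : ∑ j, F j = F k + F l + ∑ j ∈ ({k, l}ᶜ : Finset κ), F j := by
  rw [← Finset.sum_add_sum_compl {k, l}, Finset.sum_pair h]

theorem sum_eq_add_sum_ne {κ : Type*} [Fintype κ] [DecidableEq κ] (k : κ)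
    (F : κ → ℝ) : ∑ j, F j = F k + ∑ j with j ≠ k, F j := by
  rw [← Finset.sum_filter_add_sum_filter_not Finset.univ (fun j => j = k)]
  congr 1
  rw [Finset.sum_filter, Finset.sum_ite_eq' Finset.univ k F, if_pos (Finset.mem_univ _)]

/-- A sum over pairs of edges `{i, j}`, `{k, l}` (loops allowed) of terms that vanish unless the
edges meet, sorted by the shape of the union of the two edges. -/
theorem sum_meeting_edges {κ : Type*} [Fintype κ] [DecidableEq κ] {D : κ → κ → κ → κ → ℝ}
    (h1 : ∀ i j k l, D i j k l = D j i k l) (h2 : ∀ i j k l, D i j k l = D i j l k)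
    (h3 : ∀ i j k l, D i j k l = D k l i j)
    (h0 : ∀ i j k l, i ≠ k → i ≠ l → j ≠ k → j ≠ l → D i j k l = 0) :
    ∑ i, ∑ j, ∑ k, ∑ l, D i j k l =
      ∑ k, D k k k k + 4 * ∑ k, ∑ l with l ≠ k, D k l k k + 2 * ∑ k, ∑ l with l ≠ k, D k l k l
      + 4 * ∑ i, ∑ j with j ≠ i, ∑ k ∈ ({i, j}ᶜ : Finset κ), D i j j k := by
  have hdiag : ∀ i, ∑ k, ∑ l, D i i k l = D i i i i + 2 * ∑ l with l ≠ i, D i l i i := by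
    intro i
    rw [sum_eq_add_sum_ne i, sum_eq_add_sum_ne i, two_mul, add_assoc]
    congr 2
    · exact Finset.sum_congr rfl fun l _ => h3 _ _ _ _
    · refine Finset.sum_congr rfl fun k hk => ?_
      have hk' : i ≠ k := fun h => (Finset.mem_filter.1 hk).2 h.symm
      rw [Finset.sum_eq_single i (fun l _ hl => h0 _ _ _ _ hk' hl.symm hk' hl.symm) (by simp),
        h2, h3]
  have hoff : ∀ i j, j ≠ i → ∑ k, ∑ l, D i j k l =
      2 * D i j i j + (D i j i i + D j i j j)
        + (2 * ∑ k ∈ ({i, j}ᶜ : Finset κ), D i j j k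
          + 2 * ∑ k ∈ ({j, i}ᶜ : Finset κ), D j i i k) := by
    intro i j hij
    have hrow : ∀ k ∈ ({i, j}ᶜ : Finset κ), ∑ l, D i j k l = D i j k i + D i j k j := by
      intro k hk
      have hk' : k ≠ i ∧ k ≠ j := by simpa using hk
      rw [sum_eq_add_add_sum_compl hij.symm, add_eq_left]
      refine Finset.sum_eq_zero fun l hl => ?_
      have hl' : l ≠ i ∧ l ≠ j := by simpa using hl
      exact h0 _ _ _ _ hk'.1.symm hl'.1.symm hk'.2.symm hl'.2.symm
    rw [sum_eq_add_add_sum_compl hij.symm, Finset.sum_congr rfl hrow,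
      sum_eq_add_add_sum_compl hij.symm (fun l => D i j i l),
      sum_eq_add_add_sum_compl hij.symm (fun l => D i j j l), Finset.sum_add_distrib,
      Finset.pair_comm j i, Finset.sum_congr rfl fun k _ => h2 i j k i,
      Finset.sum_congr rfl fun k _ => h2 i j k j, h2 i j j i, h1 j i j j,
      Finset.sum_congr rfl fun k _ => h1 j i i k]
    ring
  have htri : ∀ F : κ → κ → ℝ, ∑ i, ∑ j with j ≠ i, F j i = ∑ i, ∑ j with j ≠ i, F i j := by
    intro F
    simp only [Finset.sum_filter]
    rw [Finset.sum_comm]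
    simp only [ne_comm]
  have : ∑ i, ∑ j, ∑ k, ∑ l, D i j k l = ∑ i, (∑ k, ∑ l, D i i k l) +
      ∑ i, ∑ j with j ≠ i, ∑ k, ∑ l, D i j k l := by
    rw [← Finset.sum_add_distrib]
    exact Finset.sum_congr rfl fun i _ => sum_eq_add_sum_ne i _
  rw [this, Finset.sum_congr rfl fun i _ => hdiag i,
    Finset.sum_congr rfl fun i _ => Finset.sum_congr rfl fun j hj =>
      hoff i j (Finset.mem_filter.1 hj).2]
  simp only [Finset.sum_add_distrib, ← Finset.mul_sum]
  rw [htri fun i j => D i j i i, htri fun i j => ∑ k ∈ ({i, j}ᶜ : Finset κ), D i j j k]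
  ring

variable {ι κ O : Type*} [Fintype ι] [Fintype κ] [DecidableEq κ]
  {c : ι → κ} {v : ι → ℝ} {Q : ℕ} {a : ι → ι → ℝ}

theorem pairEnergy_eq_sum_cellEnergy (a : ι → ι → ℝ) (u : ι → ℝ) :
    pairEnergy a u = (∑ k, ∑ l, cellEnergy a c k l u) / 2 := by
  unfold pairEnergy cellEnergy cellFinset
  congr 1
  rw [← Finset.sum_fiberwise (s := Finset.univ) (g := c)]
  refine Finset.sum_congr rfl fun k _ => ?_
  rw [Finset.sum_comm (s := Finset.univ (α := κ))]
  refine Finset.sum_congr rfl fun x _ => ?_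
  rw [← Finset.sum_fiberwise (s := Finset.univ) (g := c)]

variable [DecidableEq ι] [LinearOrder O]

/-- Half the second moment of the pair energy, in terms of the moments of the spins in single
cells. -/
theorem orbitMean_pairEnergy_sq (e : κ → O) (he : Function.Injective e)
    [∀ k l, Decidable (e k < e l)] (hQ : ∀ k, (cellFinset c k).card = Q)
    (hv : ∀ x, v x ^ 2 = 1) (ha : ∀ x y, a x y = a y x) (hdiag : ∀ x, a x x = 0)
    (hzero : ∀ k l, ∑ x ∈ cellFinset c k, ∑ y ∈ cellFinset c l, a x y = 0)
    {e₁ e₂ e₃ e₄ : κ → ℝ} (he₁ : e₁ = fun k => E1 Q (plusSpins c v Q k))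
    (he₂ : e₂ = fun k => E2 Q (plusSpins c v Q k)) (he₃ : e₃ = fun k => E3 Q (plusSpins c v Q k))
    (he₄ : e₄ = fun k => E4 Q (plusSpins c v Q k))
    {j₁ j₂ : κ → κ → ℝ} {j₃ : κ → κ → κ → ℝ}
    (hj₁ : ∀ k l, j₁ k l = ∑ x ∈ cellFinset c k, ∑ y ∈ cellFinset c l, a x y ^ 2)
    (hj₂ : ∀ k l, j₂ k l = ∑ x ∈ cellFinset c k, rowSum a c l x ^ 2)
    (hj₃ : ∀ j k l, j₃ j k l = ∑ y ∈ cellFinset c k, rowSum a c j y * rowSum a c l y)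
    (hj₂s : ∀ k l, k ≠ l → j₂ k l = j₂ l k) (hj₃s : ∀ k l, k ≠ l → j₃ k k l = j₃ l l k) :
    orbitMean c v (fun u => pairEnergy a u ^ 2) / 2 =
      1 / 8 * ∑ k, (4 * j₂ k k * (-e₄ k + e₂ k) + 2 * j₁ k k * (e₄ k + 1 - 2 * e₂ k))
      + 1 / 2 * ∑ k, ∑ l with e k < e l, (j₁ k l * (e₂ k * e₂ l - e₂ l - e₂ k + 1)
          + j₂ k l * (-2 * e₂ k * e₂ l + e₂ k + e₂ l))
      + 1 / 2 * ∑ k, ∑ l with l ≠ k, j₃ k k l * (-e₃ k * e₁ l + 2 * e₁ k * e₁ l - e₃ l * e₁ k)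
      + ∑ k₁, ∑ k₂ with e k₁ < e k₂, ∑ k₃ with e k₂ < e k₃,
          (j₃ k₁ k₂ k₃ * (-e₁ k₁ * e₂ k₂ * e₁ k₃ + e₁ k₁ * e₁ k₃)
          + j₃ k₂ k₃ k₁ * (-e₁ k₂ * e₂ k₃ * e₁ k₁ + e₁ k₂ * e₁ k₁)
          + j₃ k₃ k₁ k₂ * (-e₁ k₃ * e₂ k₁ * e₁ k₂ + e₁ k₃ * e₁ k₂)) := by
  let D : κ → κ → κ → κ → ℝ := fun i j k l =>
    orbitMean c v (fun u => cellEnergy a c i j u * cellEnergy a c k l u)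
  have hD : orbitMean c v (fun u => pairEnergy a u ^ 2) =
      (∑ i, ∑ j, ∑ k, ∑ l, D i j k l) / 4 := by
    have : (fun u => pairEnergy a u ^ 2) = fun u => (1 / 4) *
        ∑ i, ∑ j, ∑ k, ∑ l, cellEnergy a c i j u * cellEnergy a c k l u := by
      ext u
      rw [pairEnergy_eq_sum_cellEnergy (c := c)]
      simp only [← Finset.mul_sum, ← Finset.sum_mul]
      ring
    rw [this]
    simp only [orbitMean_const_mul, orbitMean_sum, D]
    ring
  have D1 : ∀ i j k l, D i j k l = D j i k l := fun i j k l => by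
    simp only [D, cellEnergy_comm ha i j]
  have D2 : ∀ i j k l, D i j k l = D i j l k := fun i j k l => by
    simp only [D, cellEnergy_comm ha k l]
  have D3 : ∀ i j k l, D i j k l = D k l i j := fun i j k l => by
    simp only [D, mul_comm]
  have D0 : ∀ i j k l, i ≠ k → i ≠ l → j ≠ k → j ≠ l → D i j k l = 0 :=
    fun i j k l h1 h2 h3 h4 => orbitMean_cellEnergy_mul_eq_zero hQ hv hdiag hzero
      (cellInvariant_cellEnergy h1.symm h2.symm) (cellInvariant_cellEnergy h3.symm h4.symm)
  have d1 : ∀ k, D k k k k =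
      4 * j₂ k k * (-e₄ k + e₂ k) + 2 * j₁ k k * (e₄ k + 1 - 2 * e₂ k) := fun k => by
    rw [hj₁, hj₂, he₂, he₄]
    exact orbitMean_cellEnergy_self_sq hQ hv ha hdiag hzero k
  have d2 : ∀ k l, l ≠ k → D k l k l = j₁ k l * (e₂ k * e₂ l - e₂ l - e₂ k + 1)
          + j₂ k l * (-2 * e₂ k * e₂ l + e₂ k + e₂ l) := fun k l hkl => by
    have h := hj₂s k l hkl.symm
    have h2 := orbitMean_cellEnergy_sq hQ hv ha hzero hkl.symm (v := v)
    rw [← hj₁, ← hj₂, ← hj₂, ← h] at h2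
    simp only [D, h2, he₂]
    ring
  have d3 : ∀ k l, l ≠ k → D k l k k = 2 * (j₃ k k l * (e₁ k * e₁ l - e₃ k * e₁ l)) :=
    fun k l hkl => by
      have h2 := orbitMean_cellEnergy_self_mul hQ hv ha hdiag hzero hkl.symm (v := v)
      rw [← hj₃] at h2
      simp only [D, h2, he₁, he₃]
      ring
  have d4 : ∀ i j k, j ≠ i → k ∈ ({i, j}ᶜ : Finset κ) → D i j j k =
      j₃ i j k * (-e₁ i * e₂ j * e₁ k + e₁ i * e₁ k) := fun i j k hij hk => by
    have hk' : k ≠ i ∧ k ≠ j := by simpa using hk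
    have h2 := orbitMean_cellEnergy_mul_cellEnergy hQ hv ha hzero hij.symm hk'.1.symm hk'.2.symm
      (v := v)
    rw [← hj₃] at h2
    simp only [D, h2, he₁, he₂]
    ring
  have hj₁s : ∀ k l, j₁ k l = j₁ l k := fun k l => by
    rw [hj₁, hj₁, Finset.sum_comm]
    simp only [ha]
  have hj₃r : ∀ i j k, j₃ i j k = j₃ k j i := fun i j k => by
    rw [hj₃, hj₃]
    simp only [mul_comm]
  -- the mixed term, symmetrized in the two cells
  have hmix : ∑ k, ∑ l with l ≠ k, j₃ k k l * (e₁ k * e₁ l - e₃ k * e₁ l) =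
      1 / 2 * ∑ k, ∑ l with l ≠ k,
        j₃ k k l * (-e₃ k * e₁ l + 2 * e₁ k * e₁ l - e₃ l * e₁ k) := by
    have hs : ∑ k, ∑ l with l ≠ k, j₃ k k l * (e₁ k * e₁ l - e₃ k * e₁ l) =
        ∑ k, ∑ l with l ≠ k, j₃ k k l * (e₁ k * e₁ l - e₃ l * e₁ k) := by
      simp only [Finset.sum_filter]
      rw [Finset.sum_comm]
      refine Finset.sum_congr rfl fun k _ => Finset.sum_congr rfl fun l _ => ?_
      rcases eq_or_ne k l with rfl | hkl
      · simp
      · rw [if_pos hkl, if_pos hkl.symm, hj₃s k l hkl]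
        ring
    have : ∑ k, ∑ l with l ≠ k, j₃ k k l * (-e₃ k * e₁ l + 2 * e₁ k * e₁ l - e₃ l * e₁ k) =
        ∑ k, ∑ l with l ≠ k, j₃ k k l * (e₁ k * e₁ l - e₃ k * e₁ l)
        + ∑ k, ∑ l with l ≠ k, j₃ k k l * (e₁ k * e₁ l - e₃ l * e₁ k) := by
      simp only [← Finset.sum_add_distrib]
      refine Finset.sum_congr rfl fun k _ => Finset.sum_congr rfl fun l _ => ?_
      ring
    rw [this, ← hs]
    ring
  have hpair : ∑ k, ∑ l with l ≠ k, D k l k l = 2 * ∑ k, ∑ l with e k < e l,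
      (j₁ k l * (e₂ k * e₂ l - e₂ l - e₂ k + 1)
          + j₂ k l * (-2 * e₂ k * e₂ l + e₂ k + e₂ l)) := by
    rw [sum_sum_ne_eq_two_mul e he fun k l => by rw [D1, D2]]
    congr 1
    refine Finset.sum_congr rfl fun k _ => Finset.sum_congr rfl fun l hl => d2 k l ?_
    rintro rfl
    exact lt_irrefl _ (Finset.mem_filter.1 hl).2
  rw [hD, sum_meeting_edges D1 D2 D3 D0, Finset.sum_congr rfl fun k _ => d1 k, hpair,
    Finset.sum_congr rfl fun k _ => Finset.sum_congr rfl fun l hl =>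
      d3 k l (Finset.mem_filter.1 hl).2,
    Finset.sum_congr rfl fun i _ => Finset.sum_congr rfl fun j hj =>
      Finset.sum_congr rfl fun k hk => d4 i j k (Finset.mem_filter.1 hj).2 hk,
    sum_distinct_triples e he (f := fun i j k =>
      j₃ i j k * (-e₁ i * e₂ j * e₁ k + e₁ i * e₁ k)) fun i j k => by
        rw [hj₃r]; ring]
  simp only [← Finset.mul_sum (a := (2 : ℝ))]
  rw [hmix]
  ring

end SecondMoment

/-! ### The potential and the distance on the torus -/

section Potential

variable {V : ℝ → ℝ}

theorem bddAbove_derivWithin (hV : ContDiffOn ℝ 1 V (Set.Ici 0)) (hV1 : ∀ r, 1 ≤ r → V r = 0) :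
    BddAbove (Set.range fun r : Set.Ici (0 : ℝ) => |derivWithin V (Set.Ici 0) r|) := by
  have hc : ContinuousOn (derivWithin V (Set.Ici 0)) (Set.Ici 0) :=
    hV.continuousOn_derivWithin (uniqueDiffOn_Ici 0) le_rfl
  obtain ⟨B, hB⟩ := isCompact_Icc.exists_bound_of_continuousOn
    (hc.mono (Set.Icc_subset_Ici_self : Set.Icc (0 : ℝ) 1 ⊆ Set.Ici 0))
  refine ⟨max B 0, ?_⟩
  rintro _ ⟨⟨r, hr⟩, rfl⟩
  rcases le_or_gt r 1 with h | h
  · exact (hB r ⟨hr, h⟩).trans (le_max_left _ _)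
  · have : V =ᶠ[nhdsWithin r (Set.Ici 0)] fun _ => 0 :=
      nhdsWithin_le_nhds (Filter.eventually_of_mem (Ioi_mem_nhds h) fun s hs => hV1 s (le_of_lt hs))
    simp only
    rw [this.derivWithin_eq (hV1 r h.le), derivWithin_fun_const]
    simp

theorem supDeriv_nonneg (V : ℝ → ℝ) : 0 ≤ supDeriv V :=
  Real.iSup_nonneg fun _ => abs_nonneg _

theorem abs_sub_le_supDeriv (hV : ContDiffOn ℝ 1 V (Set.Ici 0)) (hV1 : ∀ r, 1 ≤ r → V r = 0)
    {r s : ℝ} (hr : 0 ≤ r) (hs : 0 ≤ s) : |V r - V s| ≤ supDeriv V * |r - s| := by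
  refine (convex_Ici (0 : ℝ)).norm_image_sub_le_of_norm_derivWithin_le
    (hV.differentiableOn one_ne_zero) (fun t ht => ?_) hs hr
  exact le_ciSup (bddAbove_derivWithin hV hV1) ⟨t, ht⟩

end Potential

section Distance

variable {d m q : ℕ}

/-- The displacement of two sites as a vector with coordinates in the unit circle. -/
def displacement (x y : Site d m q) : PiLp 2 fun _ : Fin d => UnitAddCircle :=
  WithLp.toLp 2 fun i => (((((x i : ℕ) : ℝ) - ((y i : ℕ) : ℝ)) / ((m * q : ℕ) : ℝ) : ℝ) :
    UnitAddCircle)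

theorem torusDist_eq_norm (x y : Site d m q) : torusDist x y = ‖displacement x y‖ := by
  rw [PiLp.norm_eq_of_L2]
  rfl

theorem torusDist_nonneg (x y : Site d m q) : 0 ≤ torusDist x y := Real.sqrt_nonneg _

/-- Distances only depend on the displacement up to sign. -/
theorem torusDist_eq_of_sub_eq {x y x' y' : Site d m q}
    (h : ∀ i, ((x' i : ℕ) : ℝ) - ((y' i : ℕ) : ℝ) = -(((x i : ℕ) : ℝ) - ((y i : ℕ) : ℝ))) :
    torusDist x' y' = torusDist x y := by
  unfold torusDist
  congr 1
  refine Finset.sum_congr rfl fun i _ => ?_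
  rw [h, neg_div, AddCircle.coe_neg, norm_neg]

theorem torusDist_comm (x y : Site d m q) : torusDist x y = torusDist y x :=
  torusDist_eq_of_sub_eq fun i => by ring

theorem norm_coord_le_torusDist (x y : Site d m q) (i : Fin d) :
    ‖(((((x i : ℕ) : ℝ) - ((y i : ℕ) : ℝ)) / ((m * q : ℕ) : ℝ) : ℝ) : UnitAddCircle)‖
      ≤ torusDist x y := by
  rw [torusDist_eq_norm]
  exact PiLp.norm_apply_le (displacement x y) i

/-- In lattice units, the norm of a coordinate difference is the absolute value of a representative
modulo `n`. -/
theorem exists_int_norm_circle {n : ℕ} (hn : 0 < n) (a : ℤ) :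
    ∃ b : ℤ, (n : ℤ) ∣ a - b ∧ (n : ℝ) * ‖((((a : ℝ) / (n : ℝ) : ℝ)) : UnitAddCircle)‖ = |(b : ℝ)| := by
  have hn' : (0 : ℝ) < n := by exact_mod_cast hn
  refine ⟨a - n * round ((a : ℝ) / n), ⟨round ((a : ℝ) / n), by ring⟩, ?_⟩
  rw [UnitAddCircle.norm_eq]
  nth_rewrite 1 [← abs_of_pos hn']
  rw [← abs_mul, mul_sub, mul_div_cancel₀ _ hn'.ne']
  push_cast
  rfl

theorem one_le_mul_torusDist {x y : Site d m q} (hxy : x ≠ y) :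
    1 ≤ ((m * q : ℕ) : ℝ) * torusDist x y := by
  obtain ⟨i, hi⟩ := Function.ne_iff.1 hxy
  have hn : 0 < m * q := (Nat.zero_le _).trans_lt (x i).2
  obtain ⟨b, hb, hnorm⟩ := exists_int_norm_circle hn ((x i : ℕ) - (y i : ℕ) : ℤ)
  push_cast at hnorm
  have h1 : 1 ≤ |(b : ℝ)| := by
    have : b ≠ 0 := by
      rintro rfl
      rw [sub_zero] at hb
      have h2 := Int.eq_zero_of_abs_lt_dvd hb (by
        have := (x i).2; have := (y i).2
        rw [abs_lt]; constructor <;> omega)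
      exact hi (Fin.ext (by omega))
    exact_mod_cast Int.one_le_abs this
  have := norm_coord_le_torusDist x y i
  push_cast at this ⊢
  rw [← hnorm] at h1
  exact h1.trans (mul_le_mul_of_nonneg_left this (by positivity))

/-- The number of lattice sites in a ball. -/
theorem card_torusDist_le (hn : 0 < m * q) (x : Site d m q) {R : ℝ} (hR : 0 ≤ R) :
    ((Finset.univ.filter fun y : Site d m q => ((m * q : ℕ) : ℝ) * torusDist x y ≤ R).card : ℝ)
      ≤ (2 * R + 1) ^ d := by
  have hn' : (0 : ℝ) < ((m * q : ℕ) : ℝ) := by exact_mod_cast hn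
  choose b hb hnorm using fun (i : Fin d) (y : Fin (m * q)) =>
    exists_int_norm_circle hn ((x i : ℕ) - (y : ℕ) : ℤ)
  let S : Fin d → Finset (Fin (m * q)) := fun i => Finset.univ.filter fun y => |(b i y : ℝ)| ≤ R
  have hsub : (Finset.univ.filter fun y : Site d m q => ((m * q : ℕ) : ℝ) * torusDist x y ≤ R) ⊆
      Fintype.piFinset S := by
    intro y hy
    rw [Fintype.mem_piFinset]
    intro i
    simp only [S, Finset.mem_filter, Finset.mem_univ, true_and] at hy ⊢
    rw [← hnorm]
    refine le_trans (mul_le_mul_of_nonneg_left ?_ hn'.le) hy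
    have := norm_coord_le_torusDist x y i
    push_cast at this ⊢
    exact this
  have hS : ∀ i, ((S i).card : ℝ) ≤ 2 * R + 1 := by
    intro i
    have hinj : Set.InjOn (b i) (S i) := by
      intro y _ y' _ hyy
      have h1 := dvd_sub (hb i y) (hb i y')
      rw [hyy] at h1
      have h2 := Int.eq_zero_of_abs_lt_dvd h1 (by
        have := y.2; have := y'.2
        rw [abs_lt]; constructor <;> omega)
      exact Fin.ext (by omega)
    have hmap : ∀ y ∈ S i, b i y ∈ Finset.Icc (-⌊R⌋) ⌊R⌋ := by
      intro y hy
      simp only [S, Finset.mem_filter, Finset.mem_univ, true_and] at hy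
      rw [abs_le] at hy
      rw [Finset.mem_Icc]
      constructor
      · rw [neg_le, Int.le_floor]
        push_cast
        linarith
      · rw [Int.le_floor]; exact hy.2
    have h3 := Finset.card_le_card_of_injOn (b i) hmap hinj
    have hfl : 0 ≤ ⌊R⌋ := Int.floor_nonneg.2 hR
    have h4 : ((S i).card : ℤ) ≤ 2 * ⌊R⌋ + 1 := by
      rw [Int.card_Icc] at h3
      omega
    have h5 : ((S i).card : ℝ) ≤ 2 * (⌊R⌋ : ℝ) + 1 := by exact_mod_cast h4
    linarith [Int.floor_le R]
  calc _ ≤ ((Fintype.piFinset S).card : ℝ) := by exact_mod_cast Finset.card_le_card hsub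
    _ = ∏ i, ((S i).card : ℝ) := by rw [Fintype.card_piFinset]; push_cast; rfl
    _ ≤ ∏ _i : Fin d, (2 * R + 1) := Finset.prod_le_prod (fun _ _ => by positivity) fun i _ => hS i
    _ = (2 * R + 1) ^ d := by simp

theorem abs_coord_sub_le {x x' : Site d m q} (h : cellOf x = cellOf x') (i : Fin d) :
    |((x i : ℕ) : ℝ) - ((x' i : ℕ) : ℝ)| ≤ q := by
  have h1 : (x i : ℕ) / q = (x' i : ℕ) / q := congrArg Fin.val (congrFun h i)
  have h2 : 0 < q := by
    have := (x i).2
    by_contra h0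
    obtain rfl : q = 0 := by omega
    simp at this
  have e1 := Nat.div_add_mod (x i : ℕ) q
  have e2 := Nat.div_add_mod (x' i : ℕ) q
  have l1 := Nat.mod_lt (x i : ℕ) h2
  have l2 := Nat.mod_lt (x' i : ℕ) h2
  rw [h1] at e1
  have h3 : |((x i : ℕ) : ℤ) - ((x' i : ℕ) : ℤ)| ≤ q := by
    rw [abs_le]; constructor <;> omega
  exact_mod_cast h3

/-- Moving two sites inside their cells changes their distance by at most `2 * d * q` lattice
units. -/
theorem abs_mul_torusDist_sub_le (hn : 0 < m * q) {x y x' y' : Site d m q}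
    (hx : cellOf x = cellOf x') (hy : cellOf y = cellOf y') :
    |((m * q : ℕ) : ℝ) * torusDist x y - ((m * q : ℕ) : ℝ) * torusDist x' y'| ≤ 2 * d * q := by
  have hn' : (0 : ℝ) < ((m * q : ℕ) : ℝ) := by exact_mod_cast hn
  rw [← mul_sub, abs_mul, abs_of_pos hn', torusDist_eq_norm, torusDist_eq_norm]
  have h1 : ‖displacement x y - displacement x' y'‖ ≤ 2 * d * q / ((m * q : ℕ) : ℝ) := by
    have hc : ∀ i, ‖(displacement x y - displacement x' y') i‖ ≤ 2 * q / ((m * q : ℕ) : ℝ) := by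
      intro i
      have : (displacement x y - displacement x' y') i = ((((((x i : ℕ) : ℝ) - ((x' i : ℕ) : ℝ)) -
        (((y i : ℕ) : ℝ) - ((y' i : ℕ) : ℝ))) / ((m * q : ℕ) : ℝ) : ℝ) : UnitAddCircle) := by
        simp only [displacement, PiLp.sub_apply]
        rw [← AddCircle.coe_sub]
        congr 1
        ring
      rw [this]
      have hle : ∀ r : ℝ, ‖(r : UnitAddCircle)‖ ≤ |r| := fun r => by
        rw [UnitAddCircle.norm_eq]; simpa using round_le r 0
      refine (hle _).trans ?_
      rw [abs_div, abs_of_pos hn']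
      gcongr
      exact (abs_sub _ _).trans (by
        linarith [abs_coord_sub_le hx i, abs_coord_sub_le hy i])
    rw [PiLp.norm_eq_of_L2]
    have hB : 0 ≤ 2 * q / ((m * q : ℕ) : ℝ) := by positivity
    refine Real.sqrt_le_iff.2 ⟨by positivity, ?_⟩
    calc ∑ i, ‖(displacement x y - displacement x' y') i‖ ^ 2
        ≤ ∑ _i : Fin d, (2 * q / ((m * q : ℕ) : ℝ)) ^ 2 :=
          Finset.sum_le_sum fun i _ => pow_le_pow_left₀ (norm_nonneg _) (hc i) 2
      _ = d * (2 * q / ((m * q : ℕ) : ℝ)) ^ 2 := by simp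
      _ ≤ (d : ℝ) ^ 2 * (2 * q / ((m * q : ℕ) : ℝ)) ^ 2 := by
          have hd : (d : ℝ) ≤ (d : ℝ) ^ 2 := by
            exact_mod_cast Nat.le_self_pow two_ne_zero d
          exact mul_le_mul_of_nonneg_right hd (by positivity)
      _ = (2 * d * q / ((m * q : ℕ) : ℝ)) ^ 2 := by ring
  calc _ ≤ ((m * q : ℕ) : ℝ) * (2 * d * q / ((m * q : ℕ) : ℝ)) :=
        mul_le_mul_of_nonneg_left ((abs_norm_sub_norm_le _ _).trans h1) hn'.le
    _ = 2 * d * q := mul_div_cancel₀ _ hn'.ne'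

end Distance

/-! ### Bounds and symmetries of the couplings -/

section Cells

variable {d m q : ℕ}

theorem mem_cellSites {k : Cell d m} {x : Site d m q} : x ∈ cellSites q k ↔ cellOf x = k := by
  simp [cellSites]

theorem card_cellSites (k : Cell d m) : (cellSites q k).card = q ^ d := by
  have h1 : cellSites q k =
      Fintype.piFinset fun i => Finset.univ.filter fun y : Fin (m * q) => y.divNat = k i := by
    ext x
    simp [mem_cellSites, cellOf, funext_iff]
  have h2 : ∀ j : Fin m, (Finset.univ.filter fun y : Fin (m * q) => y.divNat = j).card = q := by
    intro j
    conv_rhs => rw [← Fintype.card_fin q, ← Finset.card_univ]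
    symm
    refine Finset.card_bij' (fun b _ => finProdFinEquiv (j, b)) (fun y _ => y.modNat) ?_ ?_ ?_ ?_
    · intro b _
      simp only [Finset.mem_filter, Finset.mem_univ, true_and]
      exact congrArg Prod.fst (finProdFinEquiv.symm_apply_apply (j, b))
    · intro y _; simp
    · intro b _
      exact congrArg Prod.snd (finProdFinEquiv.symm_apply_apply (j, b))
    · intro y hy
      simp only [Finset.mem_filter, Finset.mem_univ, true_and] at hy
      rw [← hy]
      exact finProdFinEquiv.apply_symm_apply y
  rw [h1, Fintype.card_piFinset]
  simp [h2]

/-- The point reflection of the torus that exchanges the cells `k` and `l`; the sites of the other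
cells are reflected inside their cell. -/
def cellReflection (k l : Cell d m) (x : Site d m q) : Site d m q := fun i =>
  finProdFinEquiv (Equiv.swap k l (cellOf x) i, (x i).modNat.rev)

theorem cellOf_cellReflection (k l : Cell d m) (x : Site d m q) :
    cellOf (cellReflection k l x) = Equiv.swap k l (cellOf x) := by
  ext i
  exact congrArg (fun p => (Prod.fst p).val)
    (finProdFinEquiv.symm_apply_apply (Equiv.swap k l (cellOf x) i, (x i).modNat.rev))

theorem modNat_cellReflection (k l : Cell d m) (x : Site d m q) (i : Fin d) :
    (cellReflection k l x i).modNat = (x i).modNat.rev :=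
  congrArg Prod.snd
    (finProdFinEquiv.symm_apply_apply (Equiv.swap k l (cellOf x) i, (x i).modNat.rev))

theorem coe_eq_cellOf (x : Site d m q) (i : Fin d) :
    ((x i : ℕ) : ℝ) = ((x i).modNat : ℕ) + (q : ℝ) * (cellOf x i : ℕ) := by
  have : (x i : ℕ) = ((x i).modNat : ℕ) + q * (cellOf x i : ℕ) :=
    (Nat.mod_add_div (x i : ℕ) q).symm
  exact_mod_cast this

theorem cellReflection_involutive (k l : Cell d m) :
    Function.Involutive (cellReflection (q := q) k l) := by
  intro x
  ext i
  have h1 : cellOf (cellReflection k l (cellReflection k l x)) = cellOf x := by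
    rw [cellOf_cellReflection, cellOf_cellReflection, Equiv.swap_apply_self]
  have h2 := coe_eq_cellOf (cellReflection k l (cellReflection k l x)) i
  rw [h1, modNat_cellReflection, modNat_cellReflection, Fin.rev_rev, ← coe_eq_cellOf] at h2
  exact_mod_cast h2

theorem torusDist_cellReflection {k l : Cell d m} {x y : Site d m q}
    (hx : cellOf x = k ∨ cellOf x = l) (hy : cellOf y = k ∨ cellOf y = l) :
    torusDist (cellReflection k l x) (cellReflection k l y) = torusDist x y := by
  refine torusDist_eq_of_sub_eq fun i => ?_
  rw [coe_eq_cellOf x, coe_eq_cellOf y, coe_eq_cellOf (cellReflection k l x),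
    coe_eq_cellOf (cellReflection k l y), modNat_cellReflection, modNat_cellReflection,
    cellOf_cellReflection, cellOf_cellReflection]
  have hrev : ∀ a : Fin q, ((a.rev : ℕ) : ℝ) = q - 1 - (a : ℕ) := by
    intro a
    rw [Fin.val_rev, Nat.cast_sub a.2]
    push_cast; ring
  rw [hrev, hrev]
  rcases hx with hx | hx <;> rcases hy with hy | hy <;> rw [hx, hy] <;>
    simp only [Equiv.swap_apply_left, Equiv.swap_apply_right] <;> ring

end Cells

section Couplings

variable {d m q : ℕ} {L : ℝ} {V : ℝ → ℝ}

theorem pairJ_comm (L : ℝ) (V : ℝ → ℝ) (x y : Site d m q) : pairJ L V x y = pairJ L V y x := by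
  rw [pairJ, pairJ, torusDist_comm]

theorem avgJ_comm (L : ℝ) (V : ℝ → ℝ) (k l : Cell d m) : avgJ q L V k l = avgJ q L V l k := by
  unfold avgJ
  congr 1
  · simp only [Finset.sum_filter]
    rw [Finset.sum_comm]
    refine Finset.sum_congr rfl fun x _ => Finset.sum_congr rfl fun y _ => ?_
    rw [pairJ_comm]
    simp only [ne_comm]
  · simp only [eq_comm]

theorem errJ_comm (L : ℝ) (V : ℝ → ℝ) (x y : Site d m q) : errJ L V x y = errJ L V y x := by
  rw [errJ, errJ, pairJ_comm, avgJ_comm]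

theorem pairJ_cellReflection (L : ℝ) (V : ℝ → ℝ) {k l : Cell d m} {x y : Site d m q}
    (hx : cellOf x = k ∨ cellOf x = l) (hy : cellOf y = k ∨ cellOf y = l) :
    pairJ L V (cellReflection k l x) (cellReflection k l y) = pairJ L V x y := by
  rw [pairJ, pairJ, torusDist_cellReflection hx hy]

theorem sum_cellSites_reflection (k l : Cell d m) {j : Cell d m} (F : Site d m q → ℝ) :
    ∑ x ∈ cellSites q (Equiv.swap k l j), F x =
      ∑ x ∈ cellSites q j, F (cellReflection k l x) := by
  refine (Finset.sum_equiv (cellReflection_involutive k l).toPerm (fun x => ?_)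
    fun x _ => rfl).symm
  rw [mem_cellSites, mem_cellSites, Function.Involutive.coe_toPerm, cellOf_cellReflection,
    (Equiv.swap k l).injective.eq_iff]

theorem avgJ_swap (L : ℝ) (V : ℝ → ℝ) {k l i j : Cell d m} (hi : i = k ∨ i = l)
    (hj : j = k ∨ j = l) :
    avgJ q L V (Equiv.swap k l i) (Equiv.swap k l j) = avgJ q L V i j := by
  unfold avgJ
  congr 1
  · simp only [Finset.sum_filter]
    rw [sum_cellSites_reflection]
    refine Finset.sum_congr rfl fun x hx => ?_
    rw [sum_cellSites_reflection]
    refine Finset.sum_congr rfl fun y hy => ?_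
    rw [mem_cellSites] at hx hy
    simp only [ne_eq, (cellReflection_involutive k l).injective.eq_iff]
    rw [pairJ_cellReflection L V (by rwa [hx]) (by rwa [hy])]
  · simp only [(Equiv.swap k l).injective.eq_iff]

theorem errJ_cellReflection (L : ℝ) (V : ℝ → ℝ) {k l : Cell d m} {x y : Site d m q}
    (hx : cellOf x = k ∨ cellOf x = l) (hy : cellOf y = k ∨ cellOf y = l) :
    errJ L V (cellReflection k l x) (cellReflection k l y) = errJ L V x y := by
  rw [errJ, errJ, pairJ_cellReflection L V hx hy, cellOf_cellReflection, cellOf_cellReflection,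
    avgJ_swap L V hx hy]

/-- The couplings of the fluctuating part of the energy: `β` times the deviation of the potential
from its cell average, set to zero on the diagonal. -/
def coupling (L β : ℝ) (V : ℝ → ℝ) (x y : Site d m q) : ℝ :=
  if y = x then 0 else β * errJ L V x y

theorem coupling_comm (L β : ℝ) (V : ℝ → ℝ) (x y : Site d m q) :
    coupling L β V x y = coupling L β V y x := by
  unfold coupling
  rw [errJ_comm]
  simp only [eq_comm]

theorem coupling_self (L β : ℝ) (V : ℝ → ℝ) (x : Site d m q) : coupling L β V x x = 0 :=
  if_pos rfl

theorem coupling_cellReflection (L β : ℝ) (V : ℝ → ℝ) {k l : Cell d m} {x y : Site d m q}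
    (hx : cellOf x = k ∨ cellOf x = l) (hy : cellOf y = k ∨ cellOf y = l) :
    coupling L β V (cellReflection k l x) (cellReflection k l y) = coupling L β V x y := by
  unfold coupling
  rw [errJ_cellReflection L V hx hy]
  simp only [(cellReflection_involutive k l).injective.eq_iff]

/-- The number of ordered pairs of different sites of two cells. -/
theorem sum_pairs_one (k l : Cell d m) :
    ∑ x ∈ cellSites q k, ∑ _y ∈ (cellSites q l).filter (fun y => y ≠ x), (1 : ℝ) =
      if k = l then (q : ℝ) ^ d * ((q : ℝ) ^ d - 1) else ((q : ℝ) ^ d) ^ 2 := by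
  have h : ∀ x ∈ cellSites q k, ∑ _y ∈ (cellSites q l).filter (fun y => y ≠ x), (1 : ℝ) =
      if k = l then (q : ℝ) ^ d - 1 else (q : ℝ) ^ d := by
    intro x hx
    rw [mem_cellSites] at hx
    rw [Finset.filter_ne', Finset.sum_const, nsmul_one]
    split_ifs with hkl
    · rw [Finset.card_erase_of_mem (mem_cellSites.2 (hx.trans hkl)), card_cellSites,
        Nat.cast_pred (by
          rw [← card_cellSites (q := q) k]
          exact Finset.card_pos.2 ⟨x, mem_cellSites.2 hx⟩)]
      push_cast; rfl
    · rw [Finset.erase_eq_of_notMem fun h => hkl (hx.symm.trans (mem_cellSites.1 h)),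
        card_cellSites]
      push_cast; rfl
  rw [Finset.sum_congr rfl h, Finset.sum_const, card_cellSites, nsmul_eq_mul]
  push_cast
  split_ifs <;> ring

theorem sum_pairs_pairJ (L : ℝ) (V : ℝ → ℝ) (k l : Cell d m) :
    ∑ x ∈ cellSites q k, ∑ y ∈ (cellSites q l).filter (fun y => y ≠ x), pairJ L V x y =
      avgJ q L V k l * ∑ x ∈ cellSites q k, ∑ _y ∈ (cellSites q l).filter (fun y => y ≠ x),
        (1 : ℝ) := by
  rw [avgJ, ← sum_pairs_one]
  set Z := ∑ x ∈ cellSites q k, ∑ _y ∈ (cellSites q l).filter (fun y => y ≠ x), (1 : ℝ) with hZ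
  rcases eq_or_ne Z 0 with h | h
  · -- there are no pairs, and the sum is empty
    have h1 := (Finset.sum_eq_zero_iff_of_nonneg fun x _ =>
      Finset.sum_nonneg fun y _ => zero_le_one).1 (hZ.symm.trans h)
    rw [h, mul_zero]
    refine Finset.sum_eq_zero fun x hx => ?_
    have h2 := h1 x hx
    rw [Finset.sum_const, nsmul_one, Nat.cast_eq_zero, Finset.card_eq_zero] at h2
    rw [h2, Finset.sum_empty]
  · rw [div_mul_cancel₀ _ h]

theorem sum_coupling_eq_zero (L β : ℝ) (V : ℝ → ℝ) (k l : Cell d m) :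
    ∑ x ∈ cellSites q k, ∑ y ∈ cellSites q l, coupling L β V x y = 0 := by
  have h1 : ∀ x ∈ cellSites q k, ∑ y ∈ cellSites q l, coupling L β V x y =
      β * (∑ y ∈ (cellSites q l).filter (fun y => y ≠ x), pairJ L V x y
        - avgJ q L V k l * ∑ _y ∈ (cellSites q l).filter (fun y => y ≠ x), (1 : ℝ)) := by
    intro x hx
    rw [mem_cellSites] at hx
    rw [Finset.mul_sum, ← Finset.sum_sub_distrib, Finset.mul_sum, Finset.sum_filter]
    refine Finset.sum_congr rfl fun y hy => ?_
    rw [mem_cellSites] at hy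
    rw [coupling, errJ, hx, hy, ite_not, mul_one]
  rw [Finset.sum_congr rfl h1, ← Finset.mul_sum, Finset.sum_sub_distrib, sum_pairs_pairJ,
    ← Finset.mul_sum, sub_self, mul_zero]

/-- The deviation of the potential from its cell average is at most its oscillation. -/
theorem abs_errJ_le (L : ℝ) (V : ℝ → ℝ) {x y : Site d m q} (hxy : y ≠ x) {B : ℝ}
    (h : ∀ x' y' : Site d m q, cellOf x' = cellOf x → cellOf y' = cellOf y → y' ≠ x' →
      |pairJ L V x y - pairJ L V x' y'| ≤ B) : |errJ L V x y| ≤ B := by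
  set k := cellOf x with hk
  set l := cellOf y with hl
  set Z := ∑ x ∈ cellSites q k, ∑ _y ∈ (cellSites q l).filter (fun y => y ≠ x), (1 : ℝ) with hZ
  have hZpos : 0 < Z := by
    refine Finset.sum_pos' (fun x _ => Finset.sum_nonneg fun y _ => zero_le_one)
      ⟨x, mem_cellSites.2 rfl, ?_⟩
    exact Finset.sum_pos (fun _ _ => zero_lt_one)
      ⟨y, Finset.mem_filter.2 ⟨mem_cellSites.2 rfl, hxy⟩⟩
  have h1 : errJ L V x y * Z = ∑ x' ∈ cellSites q k,
      ∑ y' ∈ (cellSites q l).filter (fun y => y ≠ x'), (pairJ L V x y - pairJ L V x' y') := by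
    simp only [Finset.sum_sub_distrib, sum_pairs_pairJ]
    rw [errJ, sub_mul, hZ, Finset.mul_sum]
    simp only [Finset.mul_sum, mul_one]
    rfl
  rw [← mul_le_mul_iff_of_pos_right hZpos, ← abs_of_pos hZpos, ← abs_mul, h1, abs_of_pos hZpos, hZ,
    Finset.mul_sum]
  refine (Finset.abs_sum_le_sum_abs _ _).trans (Finset.sum_le_sum fun x' hx' => ?_)
  rw [Finset.mul_sum]
  refine (Finset.abs_sum_le_sum_abs _ _).trans (Finset.sum_le_sum fun y' hy' => ?_)
  rw [Finset.mem_filter, mem_cellSites] at hy'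
  rw [mul_one]
  exact h x' y' (mem_cellSites.1 hx') hy'.1 hy'.2

theorem abs_pairJ_sub_le (hL : 0 < L) (hV : ContDiffOn ℝ 1 V (Set.Ici 0))
    (hV1 : ∀ r, 1 ≤ r → V r = 0) (x y x' y' : Site d m q) :
    |pairJ L V x y - pairJ L V x' y'| ≤ 1 / L ^ d * (supDeriv V *
      (|((m * q : ℕ) : ℝ) * torusDist x y - ((m * q : ℕ) : ℝ) * torusDist x' y'| / L)) := by
  rw [pairJ, pairJ, ← mul_sub, abs_mul, abs_of_pos (by positivity)]
  have h0 : ∀ x y : Site d m q, 0 ≤ ((m * q : ℕ) : ℝ) / L * torusDist x y := fun x y =>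
    mul_nonneg (by positivity) (torusDist_nonneg x y)
  refine mul_le_mul_of_nonneg_left ((abs_sub_le_supDeriv hV hV1 (h0 _ _) (h0 _ _)).trans_eq ?_)
    (by positivity)
  congr 1
  rw [← abs_of_pos hL, ← abs_div, abs_of_pos hL]
  congr 1
  ring

theorem pairJ_eq_zero (hL : 0 < L) (hV1 : ∀ r, 1 ≤ r → V r = 0) {x y : Site d m q}
    (h : L ≤ ((m * q : ℕ) : ℝ) * torusDist x y) : pairJ L V x y = 0 := by
  rw [pairJ, hV1, mul_zero]
  rw [div_mul_eq_mul_div, one_le_div hL]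
  exact h

theorem abs_pairJ_le (hL : 0 < L) (hV : ContDiffOn ℝ 1 V (Set.Ici 0))
    (hV1 : ∀ r, 1 ≤ r → V r = 0) (x y : Site d m q) :
    |pairJ L V x y| ≤ 1 / L ^ d * supDeriv V := by
  rcases le_or_gt L (((m * q : ℕ) : ℝ) * torusDist x y) with h | h
  · rw [pairJ_eq_zero hL hV1 h, abs_zero]
    have := supDeriv_nonneg V
    positivity
  · have h0 : 0 ≤ ((m * q : ℕ) : ℝ) / L * torusDist x y :=
      mul_nonneg (by positivity) (torusDist_nonneg x y)
    have h1 : ((m * q : ℕ) : ℝ) / L * torusDist x y ≤ 1 := by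
      rw [div_mul_eq_mul_div, div_le_one hL]; exact h.le
    have h2 := abs_sub_le_supDeriv hV hV1 h0 zero_le_one
    rw [hV1 1 le_rfl, sub_zero] at h2
    rw [pairJ, abs_mul, abs_of_pos (by positivity)]
    refine mul_le_mul_of_nonneg_left (h2.trans ?_) (by positivity)
    refine mul_le_of_le_one_right (supDeriv_nonneg V) ?_
    rw [abs_le]; constructor <;> linarith

/-- The total strength of the potential at a site is bounded, whatever its range. -/
theorem sum_abs_pairJ_le (hL : 0 < L) (hV : ContDiffOn ℝ 1 V (Set.Ici 0))
    (hV1 : ∀ r, 1 ≤ r → V r = 0) (hn : 0 < m * q) (x : Site d m q) :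
    ∑ y ∈ Finset.univ.filter (fun y => y ≠ x), |pairJ L V x y| ≤ 3 ^ d * supDeriv V := by
  have hD := supDeriv_nonneg V
  rcases lt_or_ge L 1 with h1 | h1
  · rw [Finset.sum_eq_zero]
    · positivity
    · intro y hy
      rw [pairJ_eq_zero hL hV1, abs_zero]
      exact h1.le.trans (one_le_mul_torusDist (Finset.mem_filter.1 hy).2.symm)
  · have hle : ∀ y, |pairJ L V x y| ≤
        if ((m * q : ℕ) : ℝ) * torusDist x y ≤ L then 1 / L ^ d * supDeriv V else 0 := by
      intro y
      split_ifs with h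
      · exact abs_pairJ_le hL hV hV1 x y
      · rw [pairJ_eq_zero hL hV1 (not_le.1 h).le, abs_zero]
    calc _ ≤ ∑ y, |pairJ L V x y| :=
          Finset.sum_le_sum_of_subset_of_nonneg (Finset.filter_subset _ _)
            fun _ _ _ => abs_nonneg _
      _ ≤ _ := Finset.sum_le_sum fun y _ => hle y
      _ = ((Finset.univ.filter fun y : Site d m q =>
            ((m * q : ℕ) : ℝ) * torusDist x y ≤ L).card : ℝ) * (1 / L ^ d * supDeriv V) := by
          rw [← Finset.sum_filter, Finset.sum_const, nsmul_eq_mul]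
      _ ≤ (3 * L) ^ d * (1 / L ^ d * supDeriv V) := by
          refine mul_le_mul_of_nonneg_right ?_ (by positivity)
          exact (card_torusDist_le hn x hL.le).trans
            (pow_le_pow_left₀ (by positivity) (by linarith) d)
      _ = 3 ^ d * supDeriv V := by
          rw [mul_pow]; field_simp

/-- The row sums of the deviations when the range of the potential is at least the cell size: the
potential oscillates little on a pair of cells. -/
theorem sum_abs_errJ_le_of_le (hL : 0 < L) (hV : ContDiffOn ℝ 1 V (Set.Ici 0))
    (hV1 : ∀ r, 1 ≤ r → V r = 0) (hn : 0 < m * q) (hqL : (q : ℝ) ≤ L) (x : Site d m q) :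
    ∑ y ∈ Finset.univ.filter (fun y => y ≠ x), |errJ L V x y| ≤
      2 * d * (4 * d + 3) ^ d * (q / L * supDeriv V) := by
  have hD := supDeriv_nonneg V
  have hq1 : (1 : ℝ) ≤ q := by
    have : 0 < q := Nat.pos_of_mul_pos_left hn
    exact_mod_cast this
  set B := 1 / L ^ d * (supDeriv V * (2 * d * q / L)) with hB
  have hB0 : 0 ≤ B := by positivity
  have hle : ∀ y ∈ Finset.univ.filter (fun y => y ≠ x), |errJ L V x y| ≤
      if ((m * q : ℕ) : ℝ) * torusDist x y ≤ L + 2 * d * q then B else 0 := by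
    intro y hy
    refine abs_errJ_le L V (Finset.mem_filter.1 hy).2 fun x' y' hx' hy' _ => ?_
    have h1 := abs_mul_torusDist_sub_le hn hx'.symm hy'.symm
    split_ifs with h
    · refine (abs_pairJ_sub_le hL hV hV1 x y x' y').trans ?_
      rw [hB]
      gcongr
    · rw [not_le] at h
      have h2 := (abs_le.1 h1).2
      have hdq : (0 : ℝ) ≤ 2 * d * q := by positivity
      rw [pairJ_eq_zero hL hV1 (by linarith), pairJ_eq_zero hL hV1 (by linarith), sub_zero,
        abs_zero]
  calc _ ≤ _ := Finset.sum_le_sum hle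
    _ ≤ ∑ y, (if ((m * q : ℕ) : ℝ) * torusDist x y ≤ L + 2 * d * q then B else 0) :=
        Finset.sum_le_sum_of_subset_of_nonneg (Finset.filter_subset _ _)
          fun _ _ _ => by split_ifs <;> positivity
    _ = ((Finset.univ.filter fun y : Site d m q =>
            ((m * q : ℕ) : ℝ) * torusDist x y ≤ L + 2 * d * q).card : ℝ) * B := by
        rw [← Finset.sum_filter, Finset.sum_const, nsmul_eq_mul]
    _ ≤ ((4 * d + 3) * L) ^ d * B := by
        refine mul_le_mul_of_nonneg_right ?_ hB0
        refine (card_torusDist_le hn x (by positivity)).trans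
          (pow_le_pow_left₀ (by positivity) ?_ d)
        have : (d : ℝ) * q ≤ d * L := mul_le_mul_of_nonneg_left hqL (by positivity)
        linarith
    _ = _ := by
        rw [hB, mul_pow]; field_simp

/-- The row sums of the deviations are bounded by the total strength of the potential. -/
theorem sum_abs_errJ_le_of_sum (hL : 0 < L) (hV : ContDiffOn ℝ 1 V (Set.Ici 0))
    (hV1 : ∀ r, 1 ≤ r → V r = 0) (hn : 0 < m * q) (x : Site d m q) :
    ∑ y ∈ Finset.univ.filter (fun y => y ≠ x), |errJ L V x y| ≤ 2 * (3 ^ d * supDeriv V) := by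
  set k := cellOf x with hk
  have hq : 0 < q := Nat.pos_of_mul_pos_left hn
  have hQ : (0 : ℝ) < (q : ℝ) ^ d := by positivity
  have hfib : ∀ (w : Site d m q) (F : Site d m q → ℝ), ∑ y ∈ Finset.univ.filter (fun y => y ≠ w), F y =
      ∑ l, ∑ y ∈ (cellSites q l).filter (fun y => y ≠ w), F y := by
    intro w F
    rw [← Finset.sum_fiberwise (s := Finset.univ.filter (fun y => y ≠ w)) (g := cellOf)]
    refine Finset.sum_congr rfl fun l _ => Finset.sum_congr ?_ fun _ _ => rfl
    ext y
    simp [mem_cellSites, and_comm]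
  -- averaging over a cell does not increase the total strength
  have havg : ∀ l, ∑ y ∈ (cellSites q l).filter (fun y => y ≠ x), |avgJ q L V k l| ≤
      (∑ x' ∈ cellSites q k, ∑ y ∈ (cellSites q l).filter (fun y => y ≠ x'), |pairJ L V x' y|)
        / (q : ℝ) ^ d := by
    intro l
    have hcount : ∀ x' ∈ cellSites q k, ∑ _y ∈ (cellSites q l).filter (fun y => y ≠ x'), (1 : ℝ) =
        ∑ _y ∈ (cellSites q l).filter (fun y => y ≠ x), (1 : ℝ) := by
      intro x' hx'
      rw [mem_cellSites] at hx'
      simp only [Finset.filter_ne', Finset.sum_const, nsmul_one, Finset.card_erase_eq_ite,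
        mem_cellSites, hx', ← hk]
    have h1 := sum_pairs_pairJ (q := q) L V k l
    rw [Finset.sum_congr rfl hcount, Finset.sum_const, card_cellSites, nsmul_eq_mul] at h1
    rw [le_div_iff₀ hQ]
    have h2 : (∑ y ∈ (cellSites q l).filter (fun y => y ≠ x), |avgJ q L V k l|) * (q : ℝ) ^ d =
        |∑ x ∈ cellSites q k, ∑ y ∈ (cellSites q l).filter (fun y => y ≠ x), pairJ L V x y| := by
      rw [h1, abs_mul, abs_of_nonneg (a := _ * _) (mul_nonneg (by positivity)
        (Finset.sum_nonneg fun _ _ => zero_le_one))]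
      simp only [Finset.sum_const, nsmul_eq_mul]
      push_cast
      ring
    rw [h2]
    exact (Finset.abs_sum_le_sum_abs _ _).trans
      (Finset.sum_le_sum fun _ _ => Finset.abs_sum_le_sum_abs _ _)
  have htri : ∀ y, |errJ L V x y| ≤ |pairJ L V x y| + |avgJ q L V k (cellOf y)| := fun y =>
    abs_sub _ _
  refine (Finset.sum_le_sum fun y _ => htri y).trans ?_
  rw [Finset.sum_add_distrib, two_mul]
  refine add_le_add (sum_abs_pairJ_le hL hV hV1 hn x) ?_
  rw [hfib]
  calc ∑ l, ∑ y ∈ (cellSites q l).filter (fun y => y ≠ x), |avgJ q L V k (cellOf y)|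
      = ∑ l, ∑ y ∈ (cellSites q l).filter (fun y => y ≠ x), |avgJ q L V k l| := by
        refine Finset.sum_congr rfl fun l _ => Finset.sum_congr rfl fun y hy => ?_
        rw [mem_cellSites.1 (Finset.mem_filter.1 hy).1]
    _ ≤ _ := Finset.sum_le_sum fun l _ => havg l
    _ = (∑ x' ∈ cellSites q k, ∑ y ∈ Finset.univ.filter (fun y => y ≠ x'), |pairJ L V x' y|)
          / (q : ℝ) ^ d := by
        rw [← Finset.sum_div, Finset.sum_comm]
        simp only [hfib]
    _ ≤ (∑ _x' ∈ cellSites q k, 3 ^ d * supDeriv V) / (q : ℝ) ^ d := by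
        gcongr
        exact sum_abs_pairJ_le hL hV hV1 hn _
    _ = 3 ^ d * supDeriv V := by
        rw [Finset.sum_const, card_cellSites, nsmul_eq_mul]
        push_cast
        field_simp

/-- The dimensional constant in the bound of the couplings by the small parameter. -/
def couplingConst (d : ℕ) : ℝ := 2 * d * (4 * d + 3) ^ d + 2 * 3 ^ d

theorem couplingConst_pos (d : ℕ) : 0 < couplingConst d := by
  unfold couplingConst; positivity

/-- The couplings at a site add up to at most a multiple of the small parameter, uniformly in all
other parameters. -/
theorem sum_abs_coupling_le {β : ℝ} (hL : 0 < L) (hβ : 0 < β) (hV : ContDiffOn ℝ 1 V (Set.Ici 0))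
    (hV1 : ∀ r, 1 ≤ r → V r = 0) (hn : 0 < m * q) (x : Site d m q) :
    ∑ y, |coupling L β V x y| ≤ couplingConst d * smallParam q L β V := by
  have hD := supDeriv_nonneg V
  have h1 : ∑ y, |coupling L β V x y| =
      β * ∑ y ∈ Finset.univ.filter (fun y => y ≠ x), |errJ L V x y| := by
    rw [Finset.mul_sum, Finset.sum_filter]
    refine Finset.sum_congr rfl fun y _ => ?_
    rw [coupling, ite_not]
    split_ifs
    · exact abs_zero
    · rw [abs_mul, abs_of_pos hβ]
  have h2 : ∑ y ∈ Finset.univ.filter (fun y => y ≠ x), |errJ L V x y| ≤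
      couplingConst d * (q / L * supDeriv V) := by
    rw [couplingConst, add_mul]
    rcases le_total (q : ℝ) L with h | h
    · have : 0 ≤ 2 * 3 ^ d * (q / L * supDeriv V) := by positivity
      linarith [sum_abs_errJ_le_of_le hL hV hV1 hn h x]
    · have h3 : 0 ≤ 2 * (d : ℝ) * (4 * d + 3) ^ d * (q / L * supDeriv V) := by positivity
      have h4 : supDeriv V ≤ q / L * supDeriv V :=
        le_mul_of_one_le_left hD ((one_le_div hL).2 h)
      have h5 := sum_abs_errJ_le_of_sum hL hV hV1 hn x
      have h6 : (2 : ℝ) * (3 ^ d * supDeriv V) ≤ 2 * 3 ^ d * (q / L * supDeriv V) := by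
        rw [mul_assoc]; gcongr
      linarith
  rw [h1, smallParam]
  calc _ ≤ β * (couplingConst d * (q / L * supDeriv V)) := mul_le_mul_of_nonneg_left h2 hβ.le
    _ = _ := by ring

end Couplings

/-! ### Relative entropy and conditioning on the block spins -/

section Entropy

variable {S : Type*} [MeasurableSpace S]

/-- The relative entropy of a probability measure with respect to one of its tilts. -/
theorem klDiv_tilted_right {μ : Measure S} [IsProbabilityMeasure μ] {f : S → ℝ}
    (hf : Integrable f μ) (hexp : Integrable (fun x => Real.exp (f x)) μ) :
    InformationTheory.klDiv μ (μ.tilted f) ≠ ⊤ ∧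
    (InformationTheory.klDiv μ (μ.tilted f)).toReal =
      -∫ x, f x ∂μ + Real.log (∫ x, Real.exp (f x) ∂μ) := by
  have hself : Integrable (llr μ μ) μ := (integrable_congr (llr_self μ)).2 (integrable_zero _ _ _)
  have hac : μ ≪ μ.tilted f := absolutelyContinuous_tilted hexp
  have := isProbabilityMeasure_tilted hexp
  refine ⟨InformationTheory.klDiv_ne_top hac
    (integrable_llr_tilted_right Measure.AbsolutelyContinuous.rfl hf hself hexp), ?_⟩
  rw [InformationTheory.toReal_klDiv_of_measure_eq hac (by simp),
    integral_llr_tilted_right Measure.AbsolutelyContinuous.rfl hf hexp hself,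
    integral_congr_ae (llr_self μ)]
  simp

/-- The relative entropy of a measure with respect to its tilt by `f` is a Lipschitz function
of `f` in the supremum norm. -/
theorem abs_tilted_entropy_sub_le {μ : Measure S} [IsProbabilityMeasure μ] {f g : S → ℝ} {δ : ℝ}
    (hf : Integrable f μ) (hg : Integrable g μ) (hef : Integrable (fun x => Real.exp (f x)) μ)
    (heg : Integrable (fun x => Real.exp (g x)) μ) (h : ∀ᵐ x ∂μ, |f x - g x| ≤ δ) :
    |(-∫ x, f x ∂μ + Real.log (∫ x, Real.exp (f x) ∂μ))
      - (-∫ x, g x ∂μ + Real.log (∫ x, Real.exp (g x) ∂μ))| ≤ 2 * δ := by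
  have h1 : |∫ x, f x ∂μ - ∫ x, g x ∂μ| ≤ δ := by
    rw [← integral_sub hf hg]
    have := norm_integral_le_of_norm_le_const (μ := μ) (f := fun x => f x - g x) (C := δ) h
    simpa using this
  have key : ∀ {f g : S → ℝ}, Integrable (fun x => Real.exp (f x)) μ →
      Integrable (fun x => Real.exp (g x)) μ → (∀ᵐ x ∂μ, |f x - g x| ≤ δ) →
      Real.log (∫ x, Real.exp (f x) ∂μ) ≤ Real.log (∫ x, Real.exp (g x) ∂μ) + δ := by
    intro f g hef heg h
    rw [← Real.log_exp δ, ← Real.log_mul (integral_exp_pos heg).ne' (Real.exp_pos δ).ne',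
      ← integral_mul_const]
    refine Real.log_le_log (integral_exp_pos hef)
      (integral_mono_ae hef (heg.mul_const _) (h.mono fun x hx => ?_))
    simp only
    rw [← Real.exp_add]
    exact Real.exp_le_exp.2 (by linarith [(abs_le.1 hx).2])
  have h2 := key hef heg h
  have h3 := key heg hef (h.mono fun x hx => by rwa [abs_sub_comm])
  rw [abs_le] at h1 ⊢
  constructor <;> linarith [h1.1, h1.2]

end Entropy

section FiniteSpace

variable {Ω S : Type*} [Fintype Ω] [MeasurableSpace Ω] [MeasurableSingletonClass Ω]
  [MeasurableSpace S] [MeasurableSingletonClass S]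

theorem integrable_map_of_finite [Countable S] (P : Measure Ω) [IsProbabilityMeasure P] (X : Ω → S)
    (f : S → ℝ) : Integrable f (P.map X) :=
  (integrable_map_measure (measurable_of_countable f).aestronglyMeasurable
    (measurable_of_finite X).aemeasurable).2 (Integrable.of_finite ..)

variable [DecidableEq S]

theorem setIntegral_fiber (P : Measure Ω) [IsProbabilityMeasure P] (X : Ω → S) (η : S)
    (f : Ω → ℝ) : ∫ ω in X ⁻¹' {η}, f ω ∂P = ∑ ω with X ω = η, P.real {ω} * f ω := by
  rw [← integral_indicator (measurable_of_finite X (measurableSet_singleton η)),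
    integral_fintype (Integrable.of_finite ..), Finset.sum_filter]
  refine Finset.sum_congr rfl fun ω _ => ?_
  by_cases h : X ω = η
  · rw [Set.indicator_of_mem (by simpa using h), if_pos h, smul_eq_mul]
  · rw [Set.indicator_of_notMem (by simpa using h), if_neg h, smul_zero]

theorem measureReal_fiber (P : Measure Ω) [IsProbabilityMeasure P] (X : Ω → S) (η : S) :
    P.real (X ⁻¹' {η}) = ∑ ω with X ω = η, P.real {ω} := by
  have := setIntegral_fiber P X η fun _ => 1
  simpa using this

theorem integral_cond_fiber (P : Measure Ω) [IsProbabilityMeasure P] (X : Ω → S) (η : S)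
    (f : Ω → ℝ) : ∫ ω, f ω ∂(ProbabilityTheory.cond P (X ⁻¹' {η})) =
      (∑ ω with X ω = η, P.real {ω} * f ω) / ∑ ω with X ω = η, P.real {ω} := by
  rw [ProbabilityTheory.cond, integral_smul_measure, setIntegral_fiber, ← measureReal_fiber,
    smul_eq_mul, ENNReal.toReal_inv, div_eq_inv_mul]
  rfl

/-- The image of a tilted measure is the image measure tilted by the logarithm of the conditional
exponential moments. -/
theorem map_tilted_eq [Countable S] (P : Measure Ω) [IsProbabilityMeasure P] (X : Ω → S) {f : Ω → ℝ}
    {u : S → ℝ} (h : ∀ η, ∑ ω with X ω = η, P.real {ω} * Real.exp (f ω) =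
      (∑ ω with X ω = η, P.real {ω}) * Real.exp (u η)) :
    (P.tilted f).map X = (P.map X).tilted u := by
  have hX : Measurable X := measurable_of_finite X
  have hZ : ∫ η, Real.exp (u η) ∂(P.map X) = ∫ ω, Real.exp (f ω) ∂P := by
    rw [integral_map hX.aemeasurable (measurable_of_countable _).aestronglyMeasurable,
      integral_fintype (Integrable.of_finite ..), integral_fintype (Integrable.of_finite ..),
      ← Finset.sum_fiberwise_of_maps_to (g := X) (t := Finset.univ.image X)
        (fun ω _ => Finset.mem_image_of_mem X (Finset.mem_univ ω)),
      ← Finset.sum_fiberwise_of_maps_to (g := X) (t := Finset.univ.image X)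
        (fun ω _ => Finset.mem_image_of_mem X (Finset.mem_univ ω))]
    refine Finset.sum_congr rfl fun η _ => ?_
    simp only [smul_eq_mul]
    rw [h, Finset.sum_mul]
    refine Finset.sum_congr rfl fun ω hω => ?_
    rw [(Finset.mem_filter.1 hω).2]
  refine Measure.ext_of_singleton fun η => ?_
  rw [Measure.map_apply hX (measurableSet_singleton η), tilted_apply_eq_ofReal_integral,
    tilted_apply_eq_ofReal_integral, hZ, integral_div, integral_div, setIntegral_fiber, h,
    integral_singleton, measureReal_def, Measure.map_apply hX (measurableSet_singleton η),
    ← measureReal_def, measureReal_fiber, smul_eq_mul]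

end FiniteSpace

section Prior

variable {d m q : ℕ}

theorem prior_real_singleton (ρ : Measure Bool) [IsProbabilityMeasure ρ] (σ : Config d m q) :
    (prior d m q ρ).real {σ} = ∏ x, ρ.real {σ x} := by
  rw [prior, measureReal_def, Measure.pi_singleton, ENNReal.toReal_prod]
  rfl

instance (ρ : Measure Bool) [IsProbabilityMeasure ρ] : IsProbabilityMeasure (prior d m q ρ) := by
  unfold prior; infer_instance

theorem blockSpin_comp {π : Equiv.Perm (Site d m q)} (hπ : π ∈ cellPerms (cellOf (q := q)))
    (σ : Config d m q) : blockSpin (σ ∘ ⇑π) = blockSpin σ := by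
  ext k
  unfold blockSpin
  refine Finset.sum_equiv π (fun x => ?_) fun x _ => rfl
  rw [mem_cellSites, mem_cellSites, hπ x]

/-- Two configurations with the same block spins differ by a permutation inside the cells. -/
theorem exists_cellPerm_of_blockSpin_eq {σ σ' : Config d m q}
    (h : blockSpin σ = blockSpin σ') : ∃ π ∈ cellPerms (cellOf (q := q)), σ' = σ ∘ ⇑π := by
  have hspin : ∀ b, spin b = 2 * (if b = true then 1 else 0) - 1 := by decide
  have htrue : ∀ k, ((cellSites q k).filter fun x => σ' x = true).card =
      ((cellSites q k).filter fun x => σ x = true).card := by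
    intro k
    have h1 := congrFun h k
    simp only [blockSpin, hspin, Finset.sum_sub_distrib, ← Finset.mul_sum, Finset.sum_boole] at h1
    have h2 : (((cellSites q k).filter fun x => σ x = true).card : ℤ) =
      ((cellSites q k).filter fun x => σ' x = true).card := by linarith
    exact_mod_cast h2.symm
  have hcard : ∀ (k : Cell d m) (b : Bool), ((cellSites q k).filter fun x => σ' x = b).card =
      ((cellSites q k).filter fun x => σ x = b).card := by
    intro k b
    cases b
    · have h1 := Finset.card_filter_add_card_filter_not (s := cellSites q k) (fun x => σ x = true)
      have h2 := Finset.card_filter_add_card_filter_not (s := cellSites q k) (fun x => σ' x = true)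
      simp only [Bool.not_eq_true] at h1 h2
      have := htrue k
      omega
    · exact htrue k
  have e : ∀ p : Cell d m × Bool, Nonempty ({x : Site d m q // (cellOf x, σ' x) = p} ≃
      {x : Site d m q // (cellOf x, σ x) = p}) := by
    rintro ⟨k, b⟩
    refine ⟨Fintype.equivOfCardEq ?_⟩
    rw [Fintype.card_subtype, Fintype.card_subtype]
    convert hcard k b using 2 <;> ext x <;> simp [mem_cellSites]
  let π := Equiv.ofFiberEquiv (f := fun x => (cellOf x, σ' x)) (g := fun x => (cellOf x, σ x))
    fun p => (e p).some
  have hπ : ∀ x, (cellOf (π x), σ (π x)) = (cellOf x, σ' x) := fun x =>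
    Equiv.ofFiberEquiv_map (f := fun x => (cellOf x, σ' x)) (g := fun x => (cellOf x, σ x)) _ x
  refine ⟨π, fun x => congrArg Prod.fst (hπ x), ?_⟩
  funext x
  exact (congrArg Prod.snd (hπ x)).symm

/-- Conditioned on the block spins, the prior is the uniform distribution on the orbit of any
compatible configuration under the permutations inside the cells. -/
theorem sum_fiber_eq_orbitMean (ρ : Measure Bool) [IsProbabilityMeasure ρ] (σ₀ : Config d m q)
    (f : Config d m q → ℝ) :
    ∑ σ with blockSpin σ = blockSpin σ₀, (prior d m q ρ).real {σ} * f σ =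
      (∑ σ with blockSpin σ = blockSpin σ₀, (prior d m q ρ).real {σ}) *
        orbitMean cellOf σ₀ f := by
  have hG := card_cellPerms_pos (cellOf (d := d) (m := m) (q := q))
  have hinv : ∀ π ∈ cellPerms (cellOf (d := d) (m := m) (q := q)),
      ∑ σ with blockSpin σ = blockSpin σ₀, (prior d m q ρ).real {σ} * f σ =
      ∑ σ with blockSpin σ = blockSpin σ₀, (prior d m q ρ).real {σ} * f (σ ∘ ⇑π) := by
    intro π hπ
    symm
    refine Finset.sum_equiv (Equiv.arrowCongr π.symm (Equiv.refl Bool)) (fun σ => ?_)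
      fun σ _ => ?_
    · have : (Equiv.arrowCongr π.symm (Equiv.refl Bool)) σ = σ ∘ ⇑π := rfl
      simp only [Finset.mem_filter, Finset.mem_univ, true_and, this, blockSpin_comp hπ]
    · have : (Equiv.arrowCongr π.symm (Equiv.refl Bool)) σ = σ ∘ ⇑π := rfl
      rw [this, prior_real_singleton, prior_real_singleton]
      congr 1
      exact (Equiv.prod_comp π fun x => ρ.real {σ x}).symm
  have havg : (Fintype.card (cellPerms (cellOf (d := d) (m := m) (q := q))) : ℝ) *
      ∑ σ with blockSpin σ = blockSpin σ₀, (prior d m q ρ).real {σ} * f σ =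
      ∑ σ with blockSpin σ = blockSpin σ₀, (prior d m q ρ).real {σ} *
        ∑ π : cellPerms (cellOf (d := d) (m := m) (q := q)),
          f (σ ∘ ⇑(π : Equiv.Perm (Site d m q))) := by
    have h1 := Finset.sum_congr (s₁ := (Finset.univ : Finset (cellPerms
      (cellOf (d := d) (m := m) (q := q))))) rfl fun π _ => hinv π.1 π.2
    rw [Finset.sum_const, Finset.card_univ, nsmul_eq_mul, Finset.sum_comm] at h1
    simp only [h1, Finset.mul_sum]
  rw [← mul_right_inj' hG.ne', havg, Finset.sum_mul, Finset.mul_sum]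
  refine Finset.sum_congr rfl fun σ hσ => ?_
  obtain ⟨π, hπ, rfl⟩ := exists_cellPerm_of_blockSpin_eq (Finset.mem_filter.1 hσ).2.symm
  rw [← orbitMean_base cellOf σ₀ f hπ, orbitMean]
  field_simp

theorem sum_fiber_prior_pos {ρ : Measure Bool} [IsProbabilityMeasure ρ] (h1 : ρ {true} ≠ 0)
    (h0 : ρ {false} ≠ 0) (σ₀ : Config d m q) :
    0 < ∑ σ with blockSpin σ = blockSpin σ₀, (prior d m q ρ).real {σ} := by
  refine Finset.sum_pos (fun σ _ => ?_) ⟨σ₀, by simp⟩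
  rw [prior_real_singleton]
  refine Finset.prod_pos fun x _ => ?_
  rw [measureReal_def, ENNReal.toReal_pos_iff]
  refine ⟨?_, measure_lt_top _ _⟩
  cases σ x
  · exact pos_iff_ne_zero.2 h0
  · exact pos_iff_ne_zero.2 h1

theorem coarseH0_eq_orbitMean {ρ : Measure Bool} [IsProbabilityMeasure ρ] (h1 : ρ {true} ≠ 0)
    (h0 : ρ {false} ≠ 0) (L : ℝ) (V : ℝ → ℝ) (h : Site d m q → ℝ) (σ₀ : Config d m q) :
    coarseH0 ρ L V h (blockSpin σ₀) = orbitMean cellOf σ₀ (microH L V h) := by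
  rw [coarseH0, integral_cond_fiber, sum_fiber_eq_orbitMean,
    mul_div_cancel_left₀ _ (sum_fiber_prior_pos h1 h0 σ₀).ne']

end Prior

/-! ### The residuum as a conditional second moment -/

section Residuum

variable {d m q : ℕ}

/-- The spins of a configuration as real numbers. -/
def realSpins (σ : Config d m q) (x : Site d m q) : ℝ := (spin (σ x) : ℝ)

theorem realSpins_sq (σ : Config d m q) (x : Site d m q) : realSpins σ x ^ 2 = 1 := by
  unfold realSpins spin
  split_ifs <;> norm_num

theorem abs_realSpins_le (σ : Config d m q) (x : Site d m q) : |realSpins σ x| ≤ 1 := by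
  rw [← sq_le_one_iff_abs_le_one, realSpins_sq]

theorem blockSum_realSpins (σ : Config d m q) (k : Cell d m) :
    blockSum cellOf (realSpins σ) k = (blockSpin σ k : ℝ) := by
  unfold blockSum blockSpin realSpins
  push_cast
  rfl

theorem rowSum_coupling (L β : ℝ) (V : ℝ → ℝ) (x : Site d m q) (l : Cell d m) :
    rowSum (coupling L β V) cellOf l x =
      β * ∑ y ∈ (cellSites q l).filter (fun y => y ≠ x), errJ L V x y := by
  rw [Finset.mul_sum, Finset.sum_filter]
  refine Finset.sum_congr rfl fun y _ => ?_
  rw [coupling, ite_not]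

theorem sum_coupling_sq (L β : ℝ) (V : ℝ → ℝ) (k l : Cell d m) :
    ∑ x ∈ cellFinset (cellOf (q := q)) k, ∑ y ∈ cellFinset cellOf l, coupling L β V x y ^ 2 =
      β ^ 2 * j1 q L V k l := by
  rw [j1, Finset.mul_sum]
  refine Finset.sum_congr rfl fun x _ => ?_
  rw [Finset.mul_sum, Finset.sum_filter]
  refine Finset.sum_congr rfl fun y _ => ?_
  rw [coupling, ite_not]
  split_ifs <;> ring

theorem sum_rowSum_sq (L β : ℝ) (V : ℝ → ℝ) (k l : Cell d m) :
    ∑ x ∈ cellFinset (cellOf (q := q)) k, rowSum (coupling L β V) cellOf l x ^ 2 =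
      β ^ 2 * j2 q L V k l := by
  rw [j2, Finset.mul_sum]
  refine Finset.sum_congr rfl fun x _ => ?_
  rw [rowSum_coupling, mul_pow, sq (Finset.sum _ _), Finset.sum_mul_sum]

theorem sum_rowSum_mul_rowSum (L β : ℝ) (V : ℝ → ℝ) (j k l : Cell d m) :
    ∑ y ∈ cellFinset (cellOf (q := q)) k,
      rowSum (coupling L β V) cellOf j y * rowSum (coupling L β V) cellOf l y =
      β ^ 2 * j3 q L V j k l := by
  rw [j3, Finset.mul_sum]
  refine Finset.sum_congr rfl fun y _ => ?_
  rw [rowSum_coupling, rowSum_coupling, mul_mul_mul_comm, Finset.sum_mul_sum, ← sq]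
  congr 1
  exact Finset.sum_congr rfl fun x _ => Finset.sum_congr rfl fun z _ => by rw [errJ_comm L V y x]

theorem rowSum_cellReflection (L β : ℝ) (V : ℝ → ℝ) {k l i : Cell d m} {x : Site d m q}
    (hx : cellOf x = k ∨ cellOf x = l) (hi : i = k ∨ i = l) :
    rowSum (coupling L β V) cellOf (Equiv.swap k l i) (cellReflection k l x) =
      rowSum (coupling L β V) cellOf i x := by
  have := sum_cellSites_reflection (q := q) k l (j := i)
    fun y => coupling L β V (cellReflection k l x) y
  refine this.trans (Finset.sum_congr rfl fun y hy => ?_)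
  rw [mem_cellFinset] at hy
  exact coupling_cellReflection L β V hx (by rwa [hy])

/-- Two cells see each other in the same way, by the point reflection that exchanges them. -/
theorem sum_rowSum_reflection (L β : ℝ) (V : ℝ → ℝ) {k l i j : Cell d m}
    (hi : i = k ∨ i = l) (hj : j = k ∨ j = l) :
    ∑ x ∈ cellFinset (cellOf (q := q)) l, rowSum (coupling L β V) cellOf (Equiv.swap k l i) x *
        rowSum (coupling L β V) cellOf (Equiv.swap k l j) x =
      ∑ x ∈ cellFinset (cellOf (q := q)) k, rowSum (coupling L β V) cellOf i x *
        rowSum (coupling L β V) cellOf j x := by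
  have := sum_cellSites_reflection (q := q) k l (j := k)
    fun x => rowSum (coupling L β V) cellOf (Equiv.swap k l i) x *
        rowSum (coupling L β V) cellOf (Equiv.swap k l j) x
  rw [Equiv.swap_apply_left] at this
  refine this.trans (Finset.sum_congr rfl fun x hx => ?_)
  rw [mem_cellFinset] at hx
  rw [rowSum_cellReflection L β V (Or.inl hx) hi, rowSum_cellReflection L β V (Or.inl hx) hj]

/-- The residuum is minus half the conditional second moment of the fluctuating part of the
energy. -/
theorem residuum_eq (L β : ℝ) (V : ℝ → ℝ) (σ : Config d m q) :
    residuum q L β V (blockSpin σ) =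
      -(orbitMean cellOf (realSpins σ) (fun u => pairEnergy (coupling L β V) u ^ 2) / 2) := by
  classical
  have hplus : ∀ k, plusSpins cellOf (realSpins σ) (q ^ d) k = plusCount q (blockSpin σ) k := by
    intro k
    rw [plusSpins, plusCount, blockSum_realSpins]
    push_cast
    rfl
  rw [orbitMean_pairEnergy_sq (Q := q ^ d) (toLex : Cell d m → Lex (Cell d m)) toLex.injective
    card_cellSites (realSpins_sq σ) (coupling_comm L β V) (coupling_self L β V)
    (sum_coupling_eq_zero L β V) rfl rfl rfl rfl
    (j₁ := fun k l => β ^ 2 * j1 q L V k l) (j₂ := fun k l => β ^ 2 * j2 q L V k l)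
    (j₃ := fun i k l => β ^ 2 * j3 q L V i k l)
    (fun k l => (sum_coupling_sq L β V k l).symm) (fun k l => (sum_rowSum_sq L β V k l).symm)
    (fun i k l => (sum_rowSum_mul_rowSum L β V i k l).symm) ?_ ?_]
  · simp only [hplus, Nat.cast_pow]
    have split : ∀ {S₁ S₂ S₃ S₄ T₁ T₂ T₃ T₄ : ℝ}, T₁ = β ^ 2 * S₁ → T₂ = β ^ 2 * S₂ →
        T₃ = β ^ 2 * S₃ → T₄ = β ^ 2 * S₄ →
        β * (-(β / 8 * S₁ + β / 2 * S₂ + β / 2 * S₃) + -(β * S₄)) =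
          -(1 / 8 * T₁ + 1 / 2 * T₂ + 1 / 2 * T₃ + T₄) := by
      rintro S₁ S₂ S₃ S₄ _ _ _ _ rfl rfl rfl rfl
      ring
    simp only [residuum, coarseH1, coarseH2]
    refine split ?_ ?_ ?_ ?_ <;> simp only [Finset.mul_sum]
    · exact Finset.sum_congr rfl fun k _ => by ring
    · exact Finset.sum_congr rfl fun k _ => Finset.sum_congr (by ext; simp only [Finset.mem_filter]; rfl) fun l _ => by ring
    · exact Finset.sum_congr rfl fun k _ => Finset.sum_congr rfl fun l _ => by ring
    · exact Finset.sum_congr rfl fun k _ => Finset.sum_congr (by ext; simp only [Finset.mem_filter]; rfl) fun l _ =>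
        Finset.sum_congr (by ext; simp only [Finset.mem_filter]; rfl) fun j _ => by ring
  · intro k l _
    rw [← sum_rowSum_sq, ← sum_rowSum_sq]
    have := sum_rowSum_reflection (q := q) L β V (k := k) (l := l) (Or.inr rfl) (Or.inr rfl)
    rw [Equiv.swap_apply_right] at this
    simp only [sq, this]
  · intro k l _
    rw [← sum_rowSum_mul_rowSum, ← sum_rowSum_mul_rowSum]
    have := sum_rowSum_reflection (q := q) L β V (k := k) (l := l) (Or.inl rfl) (Or.inr rfl)
    rw [Equiv.swap_apply_right, Equiv.swap_apply_left] at this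
    exact this.symm

end Residuum

/-! ### The log-Laplace form of the coarse Hamiltonian -/

section Splitting

variable {d m q : ℕ}

/-- The part of `-β H` that is determined by the block spins. -/
def blockEnergy (L β : ℝ) (V : ℝ → ℝ) (h : Site d m q → ℝ) (u : Site d m q → ℝ) : ℝ :=
  β / 2 * ∑ x, ∑ y with y ≠ x, avgJ q L V (cellOf x) (cellOf y) * (u x * u y) - β * ∑ x, h x * u x

theorem neg_mul_microH (L β : ℝ) (V : ℝ → ℝ) (h : Site d m q → ℝ) (σ : Config d m q) :
    -β * microH L V h σ =
      pairEnergy (coupling L β V) (realSpins σ) + blockEnergy L β V h (realSpins σ) := by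
  have h1 : pairEnergy (coupling L β V) (realSpins σ) =
      β / 2 * ∑ x, ∑ y with y ≠ x, errJ L V x y * (realSpins σ x * realSpins σ y) := by
    rw [pairEnergy, div_mul_eq_mul_div, Finset.mul_sum]
    congr 1
    refine Finset.sum_congr rfl fun x _ => ?_
    rw [Finset.mul_sum, Finset.sum_filter]
    refine Finset.sum_congr rfl fun y _ => ?_
    rw [coupling, ite_not]
    split_ifs <;> ring
  have h2 : ∑ x, ∑ y with y ≠ x, pairJ L V x y * realSpins σ x * realSpins σ y =
      ∑ x, ∑ y with y ≠ x, errJ L V x y * (realSpins σ x * realSpins σ y)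
      + ∑ x, ∑ y with y ≠ x, avgJ q L V (cellOf x) (cellOf y) * (realSpins σ x * realSpins σ y) := by
    simp only [← Finset.sum_add_distrib]
    refine Finset.sum_congr rfl fun x _ => Finset.sum_congr rfl fun y _ => ?_
    rw [errJ]
    ring
  have h3 : microH L V h σ = -(1 / 2) * ∑ x, ∑ y with y ≠ x,
      pairJ L V x y * realSpins σ x * realSpins σ y + ∑ x, h x * realSpins σ x := rfl
  rw [h3, h2, h1, blockEnergy]
  ring

theorem blockEnergy_comp (L β : ℝ) (V : ℝ → ℝ) {h : Site d m q → ℝ}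
    (hh : ∀ x y, cellOf x = cellOf y → h x = h y) {π : Equiv.Perm (Site d m q)}
    (hπ : π ∈ cellPerms (cellOf (q := q))) (u : Site d m q → ℝ) :
    blockEnergy L β V h (u ∘ ⇑π) = blockEnergy L β V h u := by
  unfold blockEnergy
  simp only [Finset.sum_filter]
  congr 2
  · refine Fintype.sum_equiv π _ _ fun x => Fintype.sum_equiv π _ _ fun y => ?_
    simp only [Function.comp, hπ x, hπ y, ne_eq, π.injective.eq_iff]
  · refine Fintype.sum_equiv π _ _ fun x => ?_
    rw [Function.comp, hh (π x) x (hπ x)]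

/-- The logarithm of the conditional mean of the Gibbs weight, given the block spins `η`; for an
`η` that is not attained the argument of the logarithm is the junk value `0 / 0 = 0`. -/
def logFiberMean (ρ : Measure Bool) (L β : ℝ) (V : ℝ → ℝ) (h : Site d m q → ℝ)
    (η : CoarseConfig d m) : ℝ :=
  Real.log ((∑ σ with blockSpin σ = η, (prior d m q ρ).real {σ} * Real.exp (-β * microH L V h σ)) /
    ∑ σ with blockSpin σ = η, (prior d m q ρ).real {σ})

theorem logFiberMean_eq {ρ : Measure Bool} [IsProbabilityMeasure ρ] (h1 : ρ {true} ≠ 0)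
    (h0 : ρ {false} ≠ 0) (L β : ℝ) (V : ℝ → ℝ) (h : Site d m q → ℝ) (σ₀ : Config d m q) :
    logFiberMean ρ L β V h (blockSpin σ₀) =
      Real.log (orbitMean cellOf σ₀ fun σ => Real.exp (-β * microH L V h σ)) := by
  rw [logFiberMean, sum_fiber_eq_orbitMean,
    mul_div_cancel_left₀ _ (sum_fiber_prior_pos h1 h0 σ₀).ne']

/-- The exact coarse Gibbs measure is a tilt of the prior on coarse configurations. -/
theorem map_microGibbs {ρ : Measure Bool} [IsProbabilityMeasure ρ] (h1 : ρ {true} ≠ 0)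
    (h0 : ρ {false} ≠ 0) (L β : ℝ) (V : ℝ → ℝ) (h : Site d m q → ℝ) :
    (microGibbs ρ L β V h).map blockSpin =
      ((prior d m q ρ).map blockSpin).tilted (logFiberMean ρ L β V h) := by
  refine map_tilted_eq _ _ fun η => ?_
  by_cases hη : ∃ σ₀ : Config d m q, blockSpin σ₀ = η
  · obtain ⟨σ₀, rfl⟩ := hη
    rw [logFiberMean_eq h1 h0, sum_fiber_eq_orbitMean, Real.exp_log]
    exact orbitMean_pos fun _ => Real.exp_pos _
  · have : (Finset.univ.filter fun σ : Config d m q => blockSpin σ = η) = ∅ :=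
      Finset.filter_eq_empty_iff.2 fun σ _ hσ => hη ⟨σ, hσ⟩
    rw [this]
    simp

/-- The correction to the first approximation of the coarse Hamiltonian is the log-Laplace transform
of the fluctuating pair energy. -/
theorem logFiberMean_add_coarseH0 {ρ : Measure Bool} [IsProbabilityMeasure ρ] (h1 : ρ {true} ≠ 0)
    (h0 : ρ {false} ≠ 0) (L β : ℝ) (V : ℝ → ℝ) {h : Site d m q → ℝ}
    (hh : ∀ x y, cellOf x = cellOf y → h x = h y) (σ₀ : Config d m q) :
    logFiberMean ρ L β V h (blockSpin σ₀) - -β * coarseH0 ρ L V h (blockSpin σ₀) =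
      Real.log (orbitMean cellOf (realSpins σ₀) fun u =>
        Real.exp (pairEnergy (coupling L β V) u)) := by
  set C := blockEnergy L β V h (realSpins σ₀)
  have hspl : ∀ π ∈ cellPerms (cellOf (d := d) (m := m) (q := q)),
      -β * microH L V h (σ₀ ∘ ⇑π) = pairEnergy (coupling L β V) (realSpins σ₀ ∘ ⇑π) + C := by
    intro π hπ
    rw [neg_mul_microH, show C = blockEnergy L β V h (realSpins σ₀ ∘ ⇑π) from
      (blockEnergy_comp L β V hh hπ _).symm]
    rfl
  have hzero : orbitMean cellOf (realSpins σ₀) (pairEnergy (coupling L β V)) = 0 := by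
    have : pairEnergy (coupling L β V) = fun u => (1 / 2) *
        ∑ k, ∑ l, cellEnergy (coupling L β V) (cellOf (d := d) (m := m) (q := q)) k l u := by
      ext u
      rw [pairEnergy_eq_sum_cellEnergy (c := cellOf (d := d) (m := m) (q := q))]
      ring
    rw [this, orbitMean_const_mul, orbitMean_sum]
    simp only [orbitMean_sum]
    have hz : ∀ k l, orbitMean cellOf (realSpins σ₀) (cellEnergy (coupling L β V) cellOf k l) = 0 :=
      orbitMean_cellEnergy (Q := q ^ d) card_cellSites (realSpins_sq σ₀) (coupling_self L β V)
        (sum_coupling_eq_zero L β V)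
    simp [hz]
  have e1 : orbitMean cellOf σ₀ (fun σ => Real.exp (-β * microH L V h σ)) =
      Real.exp C * orbitMean cellOf (realSpins σ₀)
        (fun u => Real.exp (pairEnergy (coupling L β V) u)) := by
    rw [← orbitMean_const_mul]
    unfold orbitMean
    congr 1
    refine Finset.sum_congr rfl fun π _ => ?_
    simp only [hspl π.1 π.2, add_comm _ C, Real.exp_add]
  have e2 : -β * orbitMean cellOf σ₀ (microH L V h) = C := by
    rw [← orbitMean_const_mul]
    calc orbitMean cellOf σ₀ (fun σ => -β * microH L V h σ)
        = orbitMean cellOf (realSpins σ₀) (fun u => pairEnergy (coupling L β V) u + C) := by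
          unfold orbitMean
          congr 1
          exact Finset.sum_congr rfl fun π _ => hspl π.1 π.2
      _ = C := by rw [orbitMean_add, orbitMean_const, hzero, zero_add]
  rw [logFiberMean_eq h1 h0, coarseH0_eq_orbitMean h1 h0, e1, e2,
    Real.log_mul (Real.exp_pos _).ne' (orbitMean_pos fun _ => Real.exp_pos _).ne', Real.log_exp]
  ring

theorem smallParam_nonneg {L β : ℝ} (hL : 0 < L) (hβ : 0 < β) (V : ℝ → ℝ) :
    0 ≤ smallParam q L β V := by
  have := supDeriv_nonneg V
  unfold smallParam
  positivity

/-- On attained block spins the residuum approximates the correction of the coarse Hamiltonian with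
an error of third order per site. -/
theorem abs_logFiberMean_add_residuum_le {ρ : Measure Bool} [IsProbabilityMeasure ρ]
    (h1 : ρ {true} ≠ 0) (h0 : ρ {false} ≠ 0) {L β : ℝ} {V : ℝ → ℝ} {h : Site d m q → ℝ}
    (hL : 0 < L) (hβ : 0 < β) (hV : ContDiffOn ℝ 1 V (Set.Ici 0))
    (hV1 : ∀ r, 1 ≤ r → V r = 0) (hn : 0 < m * q)
    (hh : ∀ x y, cellOf x = cellOf y → h x = h y)
    (hε : 16 * (couplingConst d * smallParam q L β V) ≤ 1) (σ₀ : Config d m q) :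
    |(logFiberMean ρ L β V h (blockSpin σ₀) - -β * coarseH0 ρ L V h (blockSpin σ₀))
      - -residuum q L β V (blockSpin σ₀)| ≤
      144 * ((m * q : ℕ) : ℝ) ^ d * (couplingConst d * smallParam q L β V) ^ 3 := by
  rw [logFiberMean_add_coarseH0 h1 h0 L β V hh, residuum_eq, neg_neg]
  have hcard : (Fintype.card (Site d m q) : ℝ) = ((m * q : ℕ) : ℝ) ^ d := by simp
  rw [← hcard]
  exact abs_log_orbitMean_exp_sub_le (coupling_comm L β V) (coupling_self L β V)
    (sum_abs_coupling_le hL hβ hV hV1 hn) hε (abs_realSpins_le σ₀) (sum_coupling_eq_zero L β V)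

end Splitting

end

end CoarseGrain

open CoarseGrain in
theorem mainTheorem2 (d : ℕ) (hd : 1 ≤ d) :
    ∃ δ₀ : ℝ, 0 < δ₀ ∧ ∃ K : ℝ, 0 < K ∧
      ∀ (m q : ℕ) (L β : ℝ) (V : ℝ → ℝ) (h : CoarseGrain.Site d m q → ℝ)
        (ρ : MeasureTheory.Measure Bool) [MeasureTheory.IsProbabilityMeasure ρ],
        1 ≤ m → 1 ≤ q → 0 < L → 0 < β →
        ContDiffOn ℝ 1 V (Set.Ici 0) → (∀ r : ℝ, 1 ≤ r → V r = 0) →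
        (∀ x y : CoarseGrain.Site d m q,
          CoarseGrain.cellOf x = CoarseGrain.cellOf y → h x = h y) →
        ρ {true} ≠ 0 → ρ {false} ≠ 0 →
        (q : ℝ) ^ d * CoarseGrain.smallParam q L β V < δ₀ →
        InformationTheory.klDiv (CoarseGrain.coarseGibbs0 ρ L β V h)
            ((CoarseGrain.microGibbs ρ L β V h).map CoarseGrain.blockSpin) ≠ ⊤ ∧
        |1 / ((m * q : ℕ) : ℝ) ^ d *
              (InformationTheory.klDiv (CoarseGrain.coarseGibbs0 ρ L β V h)
                ((CoarseGrain.microGibbs ρ L β V h).map CoarseGrain.blockSpin)).toReal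
            - 1 / ((m * q : ℕ) : ℝ) ^ d *
              ((∫ η, CoarseGrain.residuum q L β V η ∂(CoarseGrain.coarseGibbs0 ρ L β V h))
                + Real.log (∫ η, Real.exp (-CoarseGrain.residuum q L β V η)
                    ∂(CoarseGrain.coarseGibbs0 ρ L β V h)))|
          ≤ K * CoarseGrain.smallParam q L β V ^ 3 := by
  have hC := couplingConst_pos d
  refine ⟨1 / (16 * couplingConst d), by positivity, 288 * couplingConst d ^ 3, by positivity, ?_⟩
  intro m q L β V h ρ _ hm hq hL hβ hV hV1 hh h1 h0 hδ
  have hn : 0 < m * q := Nat.mul_pos hm hq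
  have hn' : (0 : ℝ) < ((m * q : ℕ) : ℝ) := by exact_mod_cast hn
  have hε0 : 0 ≤ smallParam q L β V := smallParam_nonneg hL hβ V
  have hε : 16 * (couplingConst d * smallParam q L β V) ≤ 1 := by
    have hq1 : (1 : ℝ) ≤ (q : ℝ) ^ d := one_le_pow₀ (by exact_mod_cast hq)
    have h2 : smallParam q L β V ≤ 1 / (16 * couplingConst d) :=
      (le_mul_of_one_le_left hε0 hq1).trans hδ.le
    rw [le_div_iff₀ (by positivity)] at h2
    linarith
  set P := (prior d m q ρ).map blockSpin with hP
  have hPp : IsProbabilityMeasure P :=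
    Measure.isProbabilityMeasure_map (measurable_of_finite _).aemeasurable
  have hint : ∀ f : CoarseConfig d m → ℝ, Integrable f P := integrable_map_of_finite _ _
  set f : CoarseConfig d m → ℝ := fun η => -β * coarseH0 ρ L V h η with hf
  have hμ : coarseGibbs0 ρ L β V h = P.tilted f := rfl
  have hμp : IsProbabilityMeasure (coarseGibbs0 ρ L β V h) := by
    rw [hμ]; exact isProbabilityMeasure_tilted (hint _)
  have hintμ : ∀ g : CoarseConfig d m → ℝ, Integrable g (coarseGibbs0 ρ L β V h) := fun g => by
    rw [hμ, integrable_tilted_iff (hint _)]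
    exact hint _
  set g : CoarseConfig d m → ℝ := fun η => logFiberMean ρ L β V h η - f η with hg
  have hν : (microGibbs ρ L β V h).map blockSpin = (coarseGibbs0 ρ L β V h).tilted g := by
    rw [map_microGibbs h1 h0, hμ, tilted_tilted (hint _)]
    congr 1
    ext η
    simp [hg]
  obtain ⟨hfin, hkl⟩ := klDiv_tilted_right (hintμ g) (hintμ fun η => Real.exp (g η))
  rw [hν]
  refine ⟨hfin, ?_⟩
  rw [hkl]
  have hP_ae : ∀ᵐ η ∂P, |g η - -residuum q L β V η| ≤
      144 * ((m * q : ℕ) : ℝ) ^ d * (couplingConst d * smallParam q L β V) ^ 3 := by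
    rw [hP, ae_map_iff (measurable_of_finite _).aemeasurable (Set.to_countable _).measurableSet]
    exact Filter.Eventually.of_forall fun σ =>
      abs_logFiberMean_add_residuum_le h1 h0 hL hβ hV hV1 hn hh hε σ
  have hae : ∀ᵐ η ∂(coarseGibbs0 ρ L β V h), |g η - -residuum q L β V η| ≤
      144 * ((m * q : ℕ) : ℝ) ^ d * (couplingConst d * smallParam q L β V) ^ 3 :=
    (tilted_absolutelyContinuous P f).ae_le hP_ae
  have hmain := abs_tilted_entropy_sub_le (hintμ g) (hintμ fun η => -residuum q L β V η)
    (hintμ _) (hintμ _) hae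
  rw [integral_neg, neg_neg] at hmain
  rw [← mul_sub, abs_mul, abs_of_pos (by positivity)]
  calc _ ≤ 1 / ((m * q : ℕ) : ℝ) ^ d * (2 * (144 * ((m * q : ℕ) : ℝ) ^ d *
        (couplingConst d * smallParam q L β V) ^ 3)) :=
        mul_le_mul_of_nonneg_left hmain (by positivity)
    _ = 288 * couplingConst d ^ 3 * smallParam q L β V ^ 3 := by
        field_simp
        ring
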